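/- Let $W:\mathbb{R}^d\to\mathbb{R}\cup\{\infty\}$. **Definitions.** Condition (W0): $W$ is locally integrable, bounded from below, lower semicontinuous, and $W(x)=W(-x)$. Condition (W1): $W$ is (finite and) continuous on $\mathbb{R}^d\setminus\{0\}$, $W(0)=\lim_{x\to0}W(x)\in\mathbb{R}\cup\{\infty\}$, and for every $R>0$ there are constants $C_1(R)\in\mathbb{R}$, $C_2(R)>0$ with $\frac{1}{|B(x;\epsilon)|}\int_{B(x;\epsilon)}W(y)\,dy\le C_1(R)+C_2(R)W(x)$ for all $|x|<R$, $0<\epsilon<1$. Condition (PB), for $W\in C^2(\mathbb{R}^d\setminus\{0\})$: there are $a,b\in(-d,\min\{2-d,0\})$ and $C>0$ such that $$|W|\le C|x|^{b},\quad |\nabla W|\le C|x|^{b-1},\quad |\Delta W|\le C|x|^{b-2}\qquad(0<|x|<1),$$ $$|W|\le C|x|^{a},\quad |\nabla W|\le C|x|^{a-1},\quad |\Delta W|\le C|x|^{a-2}\qquad(|x|\ge1).$$ $W$ is *essentially convex* if $W\in C^2(\mathbb{R}^d\setminus\{0\})$, (W0), (W1) and (PB) hold, and $\Delta W>0$ on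 $\mathbb{R}^d\setminus\{0\}$. For a finite signed Borel measure $\mu=\mu_+-\mu_-$ (Jordan decomposition) let $E_W[\mu]=\frac12\iint W(x-y)\,d\mu(y)\,d\mu(x)$, understood as half the integral of $W(x-y)$ against the signed measure $\mu\otimes\mu$; it is well-defined in $[-\infty,\infty]$ if this integral is not of the form $\infty-\infty$. $W$ is *strictly positive definite* if $E_W[\mu]>0$ for every nonzero finite signed measure $\mu$ with $E_W[\mu]$ well-defined. Let $N(x)=-\frac{1}{(2-d)|S^{d-1}|}|x|^{2-d}$ for $d\ne2$ and $N(x)=-\frac1{2\pi}\ln|x|$ for $d=2$, and normalize the Fourier transform by $\hat f(\xi)=\int f(x)e^{-2\pi i x\cdot\xi}\,dx$. Limits $\epsilon\to0^+$, $R\to\infty$ are joint limits. **Theorem.** (i) Let $W\in C^2(\mathbb{R}^d\setminus\{0\})$ satisfy (W0) and (PB). Then $$W(x)=\lim_{\epsilon\to0,\,R\to\infty}\int_{\epsilon\le|y|\le R}\Big(N(x)-\tfrac12N(x-y)-\tfrac12N(x+y)\Big)\Delta W(y)\,dy,$$ where the integrals converge absolutely for $x\neq0$ and the limit holds uniformly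 on compact subsets of $\mathbb{R}^d\setminus\{0\}$ as well as in the sense of tempered distributions. Moreover the Fourier transform $\hat W$ of the tempered distribution $W$ is a locally integrable function, and $$\hat W(\xi)=\lim_{\epsilon\to0,\,R\to\infty}\frac1{4\pi^2}\int_{\epsilon\le|y|\le R}|\xi|^{-2}\big(1-\cos(2\pi y\cdot\xi)\big)\Delta W(y)\,dy$$ in the sense of tempered distributions and (for a suitable representative of $\hat W$) for every $\xi\ne0$. (ii) If $W$ is essentially convex, then this representative satisfies $\hat W(\xi)>0$ for every $\xi\neq0$. (iii) Every essentially convex potential is strictly positive definite. -/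

import Mathlib

open MeasureTheory Filter Topology SchwartzMap
open scoped ENNReal FourierTransform

noncomputable section

namespace EssConvex

/-- The Euclidean space `ℝᵈ`. -/
abbrev Space (d : ℕ) : Type := EuclideanSpace ℝ (Fin d)

variable {d : ℕ}

/-! ### Interaction potentials -/

/-- The real-valued function underlying a potential `W : ℝᵈ → ℝ ∪ {∞}`; all potentials below are
finite off the origin, and it is only used there or under a Lebesgue integral. -/
def re (W : Space d → EReal) (x : Space d) : ℝ := (W x).toReal

/-- Condition (W0): locally integrable, bounded from below (so that `-∞` is not a value),
lower semicontinuous and even. -/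
structure W0 (W : Space d → EReal) : Prop where
  ae_finite : ∀ᵐ x : Space d, W x ≠ ⊤
  locallyIntegrable : LocallyIntegrable (re W) volume
  boundedBelow : ∃ m : ℝ, ∀ x, (m : EReal) ≤ W x
  lowerSemicontinuous : LowerSemicontinuous W
  even : ∀ x, W (-x) = W x

/-- Condition (W1): finite and continuous off the origin, `W 0` is the limit at the origin, and the
averages of `W` over small balls are controlled by its values, locally uniformly. -/
structure W1 (W : Space d → EReal) : Prop where
  finite : ∀ x, x ≠ 0 → W x ≠ ⊥ ∧ W x ≠ ⊤
  continuousOn : ContinuousOn W {0}ᶜ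
  tendsto_zero : Tendsto W (𝓝[≠] 0) (𝓝 (W 0))
  average_le : ∀ R : ℝ, 0 < R → ∃ C₁ C₂ : ℝ, 0 < C₂ ∧
    ∀ (x : Space d) (ε : ℝ), ‖x‖ < R → 0 < ε → ε < 1 →
      ((⨍ y in Metric.ball x ε, re W y : ℝ) : EReal) ≤ (C₁ : EReal) + (C₂ : EReal) * W x

/-- `W ∈ C²(ℝᵈ \ {0})`, as a real-valued function there. -/
structure IsC2OffOrigin (W : Space d → EReal) : Prop where
  finite : ∀ x, x ≠ 0 → W x ≠ ⊥ ∧ W x ≠ ⊤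
  contDiffOn : ContDiffOn ℝ 2 (re W) {0}ᶜ

/-- The Laplacian `ΔW`, to be evaluated off the origin. -/
def lap (W : Space d → EReal) (x : Space d) : ℝ := Laplacian.laplacian (re W) x

/-- The power-law bounds on `W`, `∇W`, `ΔW`, with exponent `b` near the origin and exponent `a` at
infinity, where `-d < a, b < min {2 - d, 0}`. -/
structure PowerBounds (W : Space d → EReal) (a b : ℝ) : Prop where
  a_gt : -(d : ℝ) < a
  a_lt : a < min (2 - (d : ℝ)) 0
  b_gt : -(d : ℝ) < b
  b_lt : b < min (2 - (d : ℝ)) 0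
  bound : ∃ C : ℝ, ∀ x : Space d,
    (0 < ‖x‖ → ‖x‖ < 1 → |re W x| ≤ C * ‖x‖ ^ b) ∧
    (1 ≤ ‖x‖ → |re W x| ≤ C * ‖x‖ ^ a)
  gradient_bound : ∃ C : ℝ, ∀ x : Space d,
    (0 < ‖x‖ → ‖x‖ < 1 → ‖gradient (re W) x‖ ≤ C * ‖x‖ ^ (b - 1)) ∧
    (1 ≤ ‖x‖ → ‖gradient (re W) x‖ ≤ C * ‖x‖ ^ (a - 1))
  lap_bound : ∃ C : ℝ, ∀ x : Space d,
    (0 < ‖x‖ → ‖x‖ < 1 → |lap W x| ≤ C * ‖x‖ ^ (b - 2)) ∧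
    (1 ≤ ‖x‖ → |lap W x| ≤ C * ‖x‖ ^ (a - 2))

/-- Essentially convex potentials. -/
structure EssentiallyConvex (W : Space d → EReal) : Prop where
  w0 : W0 W
  w1 : W1 W
  c2 : IsC2OffOrigin W
  lap_pos : ∀ x, x ≠ 0 → 0 < lap W x
  powerBounds : ∃ a b : ℝ, PowerBounds W a b

/-! ### Interaction energy of a signed measure -/

/-- `∬ W(x - y)⁺ d(μ⊗μ)⁺ + ∬ W(x - y)⁻ d(μ⊗μ)⁻`; the Jordan decomposition of `μ ⊗ μ` is
`(μ⁺⊗μ⁺ + μ⁻⊗μ⁻) - (μ⁺⊗μ⁻ + μ⁻⊗μ⁺)`. -/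
def energyPos (W : Space d → EReal) (μ : SignedMeasure (Space d)) : ℝ≥0∞ :=
  let p := μ.toJordanDecomposition.posPart
  let n := μ.toJordanDecomposition.negPart
  (∫⁻ z, (W (z.1 - z.2)).toENNReal ∂(p.prod p + n.prod n)) +
    ∫⁻ z, (-W (z.1 - z.2)).toENNReal ∂(p.prod n + n.prod p)

/-- `∬ W(x - y)⁻ d(μ⊗μ)⁺ + ∬ W(x - y)⁺ d(μ⊗μ)⁻`. -/
def energyNeg (W : Space d → EReal) (μ : SignedMeasure (Space d)) : ℝ≥0∞ :=
  let p := μ.toJordanDecomposition.posPart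
  let n := μ.toJordanDecomposition.negPart
  (∫⁻ z, (-W (z.1 - z.2)).toENNReal ∂(p.prod p + n.prod n)) +
    ∫⁻ z, (W (z.1 - z.2)).toENNReal ∂(p.prod n + n.prod p)

/-- The energy is well-defined in `[-∞, ∞]`: it is not of the form `∞ - ∞`. -/
def EnergyWellDefined (W : Space d → EReal) (μ : SignedMeasure (Space d)) : Prop :=
  energyPos W μ ≠ ⊤ ∨ energyNeg W μ ≠ ⊤

/-- `E_W[μ] = ½ ∬ W(x - y) dμ(y) dμ(x)`. -/
def energy (W : Space d → EReal) (μ : SignedMeasure (Space d)) : EReal :=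
  ((1 / 2 : ℝ) : EReal) * ((energyPos W μ : EReal) - (energyNeg W μ : EReal))

/-- Strict positive definiteness (SPD). -/
def StrictlyPositiveDefinite (W : Space d → EReal) : Prop :=
  ∀ μ : SignedMeasure (Space d), μ ≠ 0 → EnergyWellDefined W μ → 0 < energy W μ

/-! ### The representation formula -/

/-- The surface area `|S^{d-1}|` of the unit sphere of `ℝᵈ`. -/
def sphereArea (d : ℕ) : ℝ := ((volume : Measure (Space d)).toSphere).real Set.univ

/-- The repulsive Newtonian potential, `-ΔN = δ`. -/
def newton (x : Space d) : ℝ :=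
  if d = 2 then -(1 / (2 * Real.pi)) * Real.log ‖x‖
  else -(1 / ((2 - (d : ℝ)) * sphereArea d)) * ‖x‖ ^ (2 - (d : ℝ))

/-- The closed annulus `{ε ≤ |y| ≤ R}`. -/
def annulus (d : ℕ) (ε R : ℝ) : Set (Space d) := {y | ε ≤ ‖y‖ ∧ ‖y‖ ≤ R}

/-- The integrand `(N(x) - ½ N(x-y) - ½ N(x+y)) ΔW(y)`. -/
def diffIntegrand (W : Space d → EReal) (x y : Space d) : ℝ :=
  (newton x - 1 / 2 * newton (x - y) - 1 / 2 * newton (x + y)) * lap W y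

/-- The truncated superposition of second differences of `N` weighted by `ΔW`. -/
def truncated (W : Space d → EReal) (ε R : ℝ) (x : Space d) : ℝ :=
  ∫ y in annulus d ε R, diffIntegrand W x y

/-- The integrand `|ξ|⁻² (1 - cos (2π y·ξ)) ΔW(y)`. -/
def fourierIntegrand (W : Space d → EReal) (ξ y : Space d) : ℝ :=
  (1 - Real.cos (2 * Real.pi * inner ℝ y ξ)) / ‖ξ‖ ^ 2 * lap W y

/-- The truncated integral formula for the Fourier transform. -/
def truncatedFourier (W : Space d → EReal) (ε R : ℝ) (ξ : Space d) : ℝ :=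
  1 / (4 * Real.pi ^ 2) * ∫ y in annulus d ε R, fourierIntegrand W ξ y

/-! ### Functions as tempered distributions -/

/-- The tempered distribution `T` is the locally integrable function `f`. -/
structure IsGivenBy (T : 𝓢'(Space d, ℂ)) (f : Space d → ℝ) : Prop where
  locallyIntegrable : LocallyIntegrable f volume
  integrable : ∀ φ : 𝓢(Space d, ℂ), Integrable (fun x => φ x * (f x : ℂ)) volume
  apply_eq : ∀ φ : 𝓢(Space d, ℂ), T φ = ∫ x, φ x * (f x : ℂ)

/-- The locally integrable functions `F i` converge to the locally integrable function `f` in the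
sense of tempered distributions. -/
def TendstoTempered {ι : Type} (F : ι → Space d → ℝ) (l : Filter ι) (f : Space d → ℝ) : Prop :=
  ∃ (S : ι → 𝓢'(Space d, ℂ)) (T : 𝓢'(Space d, ℂ)),
    (∀ᶠ i in l, IsGivenBy (S i) (F i)) ∧ IsGivenBy T f ∧ Tendsto S l (𝓝 T)

/-- `f` and `g` are locally integrable functions defining tempered distributions, and `g` is the
Fourier transform of `f`, with the normalization `∫ f(x) e^{-2πi x·ξ} dx`. -/
def HasFourierTransform (f g : Space d → ℝ) : Prop :=
  ∃ T : 𝓢'(Space d, ℂ), IsGivenBy T f ∧ IsGivenBy (𝓕 T) g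

/-- The joint limit `ε → 0⁺`, `R → ∞`. -/
def cutoffLimit : Filter (ℝ × ℝ) := 𝓝[>] 0 ×ˢ atTop

end EssConvex

end

/-!
The formulas for `W` and its Fourier transform are proved first for even functions `f` of class
`C²` with compact support. For these, `-ΔN = δ` gives `f(x) = -∫ N(x - y) Δf(y) dy`; averaging
over `y ↦ -y` and subtracting `N(x) ∫ Δf = 0` turns the kernel into the second difference
`N(x) - ½ N(x - y) - ½ N(x + y)` (`integral_secondDiff_mul_laplacian`). On the Fourier side, Green's
identity against `1 - cos (2π y·ξ)` gives `f̂(ξ) = (4π²)⁻¹ ∫ |ξ|⁻² (1 - cos (2π y·ξ)) Δf(y) dy`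
(`fourier_eq_of_even`). That `-ΔN = δ` follows by regularizing `|x|²` to `|x|² + δ²` inside `N`,
which makes `-ΔN` an explicit approximate identity (`integral_newton_sub_mul_laplacian`).

Both kernels are of second order at `y = 0`, the first grows at most like `N` at infinity and the
second is bounded. Since `-d < a, b < min {2 - d, 0}`, they are absolutely integrable against the
power-law majorant of `ΔW` (`integrable_secondDiff_mul_rpow`, `exists_fourierKernel_bound`), and
homogeneity in the scale shows that the integrals are bounded by powers of `|x|` and of `|ξ|` that
are locally integrable. Applying the formulas to `W` multiplied by smooth cutoffs to annuli, whose
Laplacians have a common majorant (`exists_laplacian_cutPotential_bound`), dominated convergence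
yields them for `W` (`integral_diffIntegrand`, `hasFourierTransform_re`). The truncation errors
are handled by the same majorants: the complements of annuli rescale well, which gives local
uniformity (`tendstoUniformlyOn_truncated`), and functions with a common locally integrable
majorant converge as tempered distributions as soon as they converge almost everywhere
(`tendstoTempered_of_hasMajorant`). If `ΔW > 0`, then `Ŵ(ξ) > 0` because `1 - cos` is nonnegative
and not identically zero (`fourierFun_pos`).

For strict positive definiteness, `W` is mollified by `k = κ * κ` with `κ` an even bump function,
so that `k̂ = κ̂² ≥ 0`. The mollified potential is the Fourier transform of the integrable
function `k̂ Ŵ`, and Parseval's identity expresses twice its energy as `∫ k̂ Ŵ |p̂ - q̂|²`, where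
`p` and `q` are the parts of the Jordan decomposition (`energy_parseval`). If the
self-interactions of `p` and `q` are finite, then as the mollification is removed they converge by
dominated convergence, because the averaging condition bounds the mollified potential by `W`
itself (`EssentiallyConvex.exists_mollified_le`), while Fatou's lemma applies to the mutual
interaction and to the Parseval integral. The latter has a positive limit, as `p ≠ q` have
different Fourier transforms (`EssentiallyConvex.integral_prod_lt`). If the self-interactions are
infinite, the energy is `∞` as soon as it is well-defined.
-/

namespace EssConvex

variable {d : ℕ}

/-! ### Powers of the norm -/

theorem measurable_norm_rpow (c : ℝ) : Measurable fun x : Space d => ‖x‖ ^ c := by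
  fun_prop

theorem integrableOn_ball_norm_rpow [NeZero d] {c : ℝ} (hc : -(d : ℝ) < c) (r : ℝ) :
    IntegrableOn (fun x : Space d => ‖x‖ ^ c) (Metric.ball 0 r) := by
  have hd : 1 ≤ d := NeZero.one_le
  rw [integrableOn_fun_norm_addHaar volume (f := fun y : ℝ => y ^ c)]
  have h : IntegrableOn (fun y : ℝ => y ^ ((d : ℝ) - 1 + c)) (Set.Ioo 0 r) := by
    rcases le_or_gt r 0 with hr | hr
    · simp [Set.Ioo_eq_empty_of_le hr]
    · rw [intervalIntegral.integrableOn_Ioo_rpow_iff hr]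
      linarith
  refine h.congr_fun (fun y hy => ?_) measurableSet_Ioo
  have hy' : 0 < y := hy.1
  simp only [finrank_euclideanSpace, Fintype.card_fin, smul_eq_mul]
  rw [Real.rpow_add hy', ← Real.rpow_natCast, Nat.cast_sub hd, Nat.cast_one]

theorem integrableOn_compl_ball_norm_rpow [NeZero d] {c : ℝ} (hc : c < -(d : ℝ)) {r : ℝ}
    (hr : 0 < r) :
    IntegrableOn (fun x : Space d => ‖x‖ ^ c) (Metric.ball 0 r)ᶜ := by
  have hd : 1 ≤ d := NeZero.one_le
  rw [← integrable_indicator_iff Metric.isOpen_ball.measurableSet.compl]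
  have h := integrable_fun_norm_addHaar (volume : Measure (Space d))
    (f := (Set.Ici r).indicator fun y : ℝ => y ^ c)
  have h' : IntegrableOn (fun y : ℝ => y ^ ((d : ℝ) - 1 + c)) (Set.Ici r) := by
    rw [integrableOn_Ici_iff_integrableOn_Ioi]
    exact integrableOn_Ioi_rpow_of_lt (by linarith) hr
  have h2 := h.2 (by
    rw [← integrable_indicator_iff measurableSet_Ici] at h'
    refine (h'.integrableOn (s := Set.Ioi 0)).congr_fun (fun y hy => ?_) measurableSet_Ioi
    have hy' : 0 < y := hy
    simp only [finrank_euclideanSpace, Fintype.card_fin, smul_eq_mul, Set.indicator_apply]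
    split_ifs
    · rw [Real.rpow_add hy', ← Real.rpow_natCast, Nat.cast_sub hd, Nat.cast_one]
    · simp)
  refine h2.congr (Eventually.of_forall fun x => ?_)
  by_cases hx : r ≤ ‖x‖
  · simp [hx]
  · simp [hx, not_le.1 hx]

theorem ae_ne_zero [NeZero d] : ∀ᵐ x : Space d, x ≠ 0 := by
  simp [ae_iff, measure_singleton]

/-- The radial function `‖x‖ ^ α + ‖x‖ ^ β`, dominating functions with power-law behaviour at the
origin and at infinity. -/
noncomputable def majorant (α β : ℝ) (x : Space d) : ℝ := ‖x‖ ^ α + ‖x‖ ^ β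

theorem majorant_nonneg (α β : ℝ) (x : Space d) : 0 ≤ majorant α β x := by
  unfold majorant; positivity

theorem measurable_majorant (α β : ℝ) : Measurable (majorant (d := d) α β) := by
  unfold majorant; fun_prop

theorem majorant_le_two {α β : ℝ} (hα : α ≤ 0) (hβ : β ≤ 0) {x : Space d} (hx : 1 ≤ ‖x‖) :
    majorant α β x ≤ 2 := by
  have h1 := Real.rpow_le_one_of_one_le_of_nonpos hx hα
  have h2 := Real.rpow_le_one_of_one_le_of_nonpos hx hβ
  unfold majorant; linarith

theorem integrableOn_ball_majorant [NeZero d] {α β : ℝ} (hα : -(d : ℝ) < α) (hβ : -(d : ℝ) < β)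
    (r : ℝ) : IntegrableOn (majorant (d := d) α β) (Metric.ball 0 r) :=
  (integrableOn_ball_norm_rpow hα r).add (integrableOn_ball_norm_rpow hβ r)

theorem locallyIntegrable_of_integrableOn_ball {f : Space d → ℝ}
    (h : ∀ r : ℝ, IntegrableOn f (Metric.ball 0 r)) : LocallyIntegrable f := by
  rw [locallyIntegrable_iff]
  intro K hK
  obtain ⟨r, hr⟩ := hK.isBounded.subset_ball (0 : Space d)
  exact (h r).mono_set hr

/-! ### Functions with a power-law majorant as tempered distributions -/

theorem norm_le_seminorm_zero (φ : 𝓢(Space d, ℂ)) (x : Space d) :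
    ‖φ x‖ ≤ SchwartzMap.seminorm ℂ 0 0 φ := by
  simpa using SchwartzMap.le_seminorm ℂ 0 0 φ x

theorem norm_mul_majorant_le {α β : ℝ} (hα : α ≤ 0) (hβ : β ≤ 0) (φ : 𝓢(Space d, ℂ))
    (x : Space d) :
    ‖φ x‖ * majorant α β x ≤ SchwartzMap.seminorm ℂ 0 0 φ *
      (Metric.ball 0 1).indicator (majorant (d := d) α β) x + 2 * ‖φ x‖ := by
  have h0 := majorant_nonneg α β x
  have h1 := norm_le_seminorm_zero φ x
  by_cases hx : x ∈ Metric.ball (0 : Space d) 1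
  · rw [Set.indicator_of_mem hx]
    nlinarith [norm_nonneg (φ x)]
  · rw [Set.indicator_of_notMem hx]
    have : 1 ≤ ‖x‖ := by simpa using hx
    have := majorant_le_two hα hβ this
    nlinarith [norm_nonneg (φ x)]

theorem integrable_schwartz_mul_majorant [NeZero d] {α β : ℝ} (hα : -(d : ℝ) < α) (hα' : α ≤ 0)
    (hβ : -(d : ℝ) < β) (hβ' : β ≤ 0) (φ : 𝓢(Space d, ℂ)) :
    Integrable fun x => ‖φ x‖ * majorant α β x := by
  have hw := (integrable_indicator_iff Metric.isOpen_ball.measurableSet).2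
    (integrableOn_ball_majorant (d := d) hα hβ 1)
  refine ((hw.const_mul (SchwartzMap.seminorm ℂ 0 0 φ)).add (φ.integrable.norm.const_mul 2)).mono'
    (φ.continuous.norm.aestronglyMeasurable.mul (measurable_majorant α β).aestronglyMeasurable)
    (Eventually.of_forall fun x => ?_)
  rw [Real.norm_of_nonneg (mul_nonneg (norm_nonneg _) (majorant_nonneg _ _ _))]
  exact norm_mul_majorant_le hα' hβ' φ x

/-- `f` is measurable and bounded, almost everywhere, by a multiple of a power-law majorant. -/
structure HasMajorant (α β C : ℝ) (f : Space d → ℝ) : Prop where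
  aestronglyMeasurable : AEStronglyMeasurable f
  bound : ∀ᵐ x, |f x| ≤ C * majorant α β x

theorem HasMajorant.locallyIntegrable [NeZero d] {α β C : ℝ} {f : Space d → ℝ}
    (hα : -(d : ℝ) < α) (hβ : -(d : ℝ) < β) (hf : HasMajorant α β C f) : LocallyIntegrable f := by
  refine locallyIntegrable_of_integrableOn_ball fun r => ?_
  refine ((integrableOn_ball_majorant hα hβ r).const_mul C).mono' hf.1.restrict ?_
  filter_upwards [ae_restrict_of_ae hf.2] with x hx
  simpa using hx

theorem HasMajorant.norm_schwartz_mul_le {α β C : ℝ} {f : Space d → ℝ}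
    (hf : HasMajorant α β C f) (φ : 𝓢(Space d, ℂ)) :
    ∀ᵐ x, ‖φ x * (f x : ℂ)‖ ≤ C * (‖φ x‖ * majorant α β x) := by
  filter_upwards [hf.2] with x hx
  rw [norm_mul, Complex.norm_real, Real.norm_eq_abs]
  nlinarith [norm_nonneg (φ x)]

theorem HasMajorant.integrable_schwartz_mul [NeZero d] {α β C : ℝ} {f : Space d → ℝ}
    (hα : -(d : ℝ) < α) (hα' : α ≤ 0) (hβ : -(d : ℝ) < β) (hβ' : β ≤ 0)
    (hf : HasMajorant α β C f) (φ : 𝓢(Space d, ℂ)) :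
    Integrable fun x => φ x * (f x : ℂ) :=
  ((integrable_schwartz_mul_majorant hα hα' hβ hβ' φ).const_mul C).mono'
    (φ.continuous.aestronglyMeasurable.mul
      (Complex.continuous_ofReal.comp_aestronglyMeasurable hf.1)) (hf.norm_schwartz_mul_le φ)

/-- Continuity of `φ ↦ ∫ φ f` on Schwartz functions: the integral over the unit ball is controlled
by the supremum of `φ`, and the rest by its `L¹` norm, as the majorant is bounded there. -/
theorem HasMajorant.exists_isGivenBy [NeZero d] {α β C : ℝ} {f : Space d → ℝ}
    (hα : -(d : ℝ) < α) (hα' : α ≤ 0) (hβ : -(d : ℝ) < β) (hβ' : β ≤ 0)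
    (hf : HasMajorant α β C f) : ∃ T : 𝓢'(Space d, ℂ), IsGivenBy T f := by
  have hint := hf.integrable_schwartz_mul hα hα' hβ hβ'
  have hw := integrableOn_ball_majorant (d := d) hα hβ 1
  set I : ℝ := ∫ x in Metric.ball (0 : Space d) 1, majorant α β x
  have hI : 0 ≤ I := integral_nonneg fun x => majorant_nonneg α β x
  set k := (volume : Measure (Space d)).integrablePower
  set K : ℝ := 2 ^ k * ∫ x : Space d, (1 + ‖x‖) ^ (-(k : ℝ))
  have hK : 0 ≤ K := mul_nonneg (by positivity) (integral_nonneg fun x => by positivity)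
  have hk : ∀ φ : 𝓢(Space d, ℂ), ∫ x, ‖φ x‖ ≤
      K * (SchwartzMap.seminorm ℂ 0 0 φ + SchwartzMap.seminorm ℂ k 0 φ) := fun φ => by
    have h := SchwartzMap.integral_pow_mul_iteratedFDeriv_le ℂ volume φ 0 0
    simp only [norm_iteratedFDeriv_zero, pow_zero, one_mul, zero_add] at h
    exact h
  let A : 𝓢(Space d, ℂ) →L[ℂ] ℂ := SchwartzMap.mkCLMtoNormedSpace (σ := RingHom.id ℂ)
    (fun φ => ∫ x, φ x * (f x : ℂ))
    (fun φ ψ => by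
      rw [← integral_add (hint φ) (hint ψ)]
      simp only [add_apply, add_mul])
    (fun c φ => by
      simp only [smul_apply, smul_eq_mul, RingHom.id_apply, mul_assoc]
      rw [integral_const_mul])
    (by
      refine ⟨{(0, 0), (k, 0)}, |C| * (I + 4 * K), by positivity, fun φ => ?_⟩
      set S := (({(0, 0), (k, 0)} : Finset (ℕ × ℕ)).sup (schwartzSeminormFamily ℂ (Space d) ℂ)) φ
      have hS1 : SchwartzMap.seminorm ℂ 0 0 φ ≤ S :=
        Seminorm.le_def.1 (Finset.le_sup (f := schwartzSeminormFamily ℂ (Space d) ℂ)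
          (show (0, 0) ∈ ({(0, 0), (k, 0)} : Finset (ℕ × ℕ)) by simp)) φ
      have hS2 : SchwartzMap.seminorm ℂ k 0 φ ≤ S :=
        Seminorm.le_def.1 (Finset.le_sup (f := schwartzSeminormFamily ℂ (Space d) ℂ)
          (show (k, 0) ∈ ({(0, 0), (k, 0)} : Finset (ℕ × ℕ)) by simp)) φ
      have hwm := integrable_schwartz_mul_majorant hα hα' hβ hβ' φ
      have hwi := (integrable_indicator_iff Metric.isOpen_ball.measurableSet).2 hw
      calc ‖∫ x, φ x * (f x : ℂ)‖ ≤ ∫ x, C * (‖φ x‖ * majorant α β x) :=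
            norm_integral_le_of_norm_le (hwm.const_mul C) (hf.norm_schwartz_mul_le φ)
        _ = C * ∫ x, ‖φ x‖ * majorant α β x := integral_const_mul _ _
        _ ≤ |C| * ∫ x, ‖φ x‖ * majorant α β x := by
            gcongr
            · exact integral_nonneg fun x => mul_nonneg (norm_nonneg _) (majorant_nonneg _ _ _)
            · exact le_abs_self C
        _ ≤ |C| * ∫ x, (SchwartzMap.seminorm ℂ 0 0 φ *
              (Metric.ball 0 1).indicator (majorant (d := d) α β) x + 2 * ‖φ x‖) := by
            refine mul_le_mul_of_nonneg_left (integral_mono hwm ?_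
              (norm_mul_majorant_le hα' hβ' φ)) (abs_nonneg C)
            exact (hwi.const_mul _).add (φ.integrable.norm.const_mul 2)
        _ = |C| * (SchwartzMap.seminorm ℂ 0 0 φ * I + 2 * ∫ x, ‖φ x‖) := by
            rw [integral_add (hwi.const_mul _) (φ.integrable.norm.const_mul 2),
              integral_const_mul, integral_const_mul,
              integral_indicator Metric.isOpen_ball.measurableSet]
        _ ≤ |C| * (S * I + 2 * (K * (S + S))) := by
            gcongr
            exact (hk φ).trans (by gcongr)
        _ = |C| * (I + 4 * K) * S := by ring)
  refine ⟨ContinuousLinearMap.toPointwiseConvergenceCLM _ _ _ _ A,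
    hf.locallyIntegrable hα hβ, hint, fun φ => rfl⟩

/-- Dominated convergence for tempered distributions: functions with a common power-law majorant
that converge almost everywhere converge as tempered distributions. -/
theorem tendstoTempered_of_hasMajorant [NeZero d] {ι : Type} {l : Filter ι}
    [l.IsCountablyGenerated] {F : ι → Space d → ℝ} {f : Space d → ℝ} {α β C : ℝ}
    (hα : -(d : ℝ) < α) (hα' : α ≤ 0) (hβ : -(d : ℝ) < β) (hβ' : β ≤ 0)
    (hF : ∀ᶠ i in l, HasMajorant α β C (F i)) (hf : HasMajorant α β C f)
    (hlim : ∀ᵐ x, Tendsto (fun i => F i x) l (𝓝 (f x))) : TendstoTempered F l f := by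
  classical
  obtain ⟨T, hT⟩ := hf.exists_isGivenBy hα hα' hβ hβ'
  have hS : ∀ i, ∃ S : 𝓢'(Space d, ℂ), HasMajorant α β C (F i) → IsGivenBy S (F i) := by
    intro i
    by_cases hi : HasMajorant α β C (F i)
    · obtain ⟨S, hS⟩ := hi.exists_isGivenBy hα hα' hβ hβ'
      exact ⟨S, fun _ => hS⟩
    · exact ⟨0, fun h => absurd h hi⟩
  choose S hS using hS
  refine ⟨S, T, hF.mono fun i hi => hS i hi, hT, ?_⟩
  rw [PointwiseConvergenceCLM.tendsto_iff_forall_tendsto]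
  intro φ
  rw [hT.apply_eq]
  have : Tendsto (fun i => ∫ x, φ x * (F i x : ℂ)) l (𝓝 (∫ x, φ x * (f x : ℂ))) := by
    refine tendsto_integral_filter_of_dominated_convergence
      (fun x => C * (‖φ x‖ * majorant α β x)) ?_ ?_
      ((integrable_schwartz_mul_majorant hα hα' hβ hβ' φ).const_mul C) ?_
    · filter_upwards [hF] with i hi
      exact (hi.integrable_schwartz_mul hα hα' hβ hβ' φ).aestronglyMeasurable
    · filter_upwards [hF] with i hi using hi.norm_schwartz_mul_le φ
    · filter_upwards [hlim] with x hx
      exact ((Complex.continuous_ofReal.tendsto _).comp hx).const_mul (φ x)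
  refine this.congr' ?_
  filter_upwards [hF] with i hi
  rw [(hS i hi).apply_eq]

/-! ### The Laplacian of products and rescalings -/

theorem fderiv_fderiv_apply {f : Space d → ℝ} {x : Space d} (hf : ContDiffAt ℝ 2 f x)
    (v : Space d) :
    DifferentiableAt ℝ (fun y => fderiv ℝ f y v) x ∧
      fderiv ℝ (fun y => fderiv ℝ f y v) x v = iteratedFDeriv ℝ 2 f x ![v, v] := by
  have h : DifferentiableAt ℝ (fderiv ℝ f) x :=
    (hf.fderiv_right (m := 1) (by norm_num)).differentiableAt (by norm_num)
  refine ⟨h.clm_apply (differentiableAt_const v), ?_⟩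
  rw [iteratedFDeriv_two_apply, fderiv_clm_apply h (differentiableAt_const v)]
  simp

theorem laplacian_eq_sum_fderiv {f : Space d → ℝ} {x : Space d} (hf : ContDiffAt ℝ 2 f x) :
    Laplacian.laplacian f x = ∑ i, fderiv ℝ (fun y => fderiv ℝ f y
      (EuclideanSpace.basisFun (Fin d) ℝ i)) x (EuclideanSpace.basisFun (Fin d) ℝ i) := by
  rw [InnerProductSpace.laplacian_eq_iteratedFDeriv_orthonormalBasis f
    (EuclideanSpace.basisFun (Fin d) ℝ)]
  exact Finset.sum_congr rfl fun i _ => (fderiv_fderiv_apply hf _).2.symm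

theorem laplacian_mul {f g : Space d → ℝ} {x : Space d} (hf : ContDiffAt ℝ 2 f x)
    (hg : ContDiffAt ℝ 2 g x) :
    Laplacian.laplacian (fun y => f y * g y) x = f x * Laplacian.laplacian g x +
      2 * inner ℝ (gradient f x) (gradient g x) + g x * Laplacian.laplacian f x := by
  have hdir : ∀ v : Space d, fderiv ℝ (fun y => fderiv ℝ (fun y => f y * g y) y v) x v =
      f x * fderiv ℝ (fun y => fderiv ℝ g y v) x v + 2 * (fderiv ℝ f x v * fderiv ℝ g x v) +
      g x * fderiv ℝ (fun y => fderiv ℝ f y v) x v := by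
    intro v
    have hev : (fun y => fderiv ℝ (fun y => f y * g y) y v) =ᶠ[𝓝 x]
        fun y => f y * fderiv ℝ g y v + g y * fderiv ℝ f y v := by
      filter_upwards [hf.eventually (by simp), hg.eventually (by simp)] with y hfy hgy
      rw [fderiv_fun_mul (hfy.differentiableAt (by norm_num)) (hgy.differentiableAt (by norm_num))]
      simp
    have hf1 := hf.differentiableAt (by norm_num)
    have hg1 := hg.differentiableAt (by norm_num)
    have hf2 := (fderiv_fderiv_apply hf v).1
    have hg2 := (fderiv_fderiv_apply hg v).1
    have hadd := fderiv_add (hf1.mul hg2) (hg1.mul hf2)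
    rw [fderiv_mul hf1 hg2, fderiv_mul hg1 hf2] at hadd
    rw [hev.fderiv_eq]
    refine (congrArg (fun L : Space d →L[ℝ] ℝ => L v) hadd).trans ?_
    simp only [add_apply, smul_apply, smul_eq_mul]
    ring
  have hgrad : ∀ (h : Space d → ℝ) (v : Space d), fderiv ℝ h x v = inner ℝ (gradient h x) v := by
    intro h v
    simp [gradient]
  rw [laplacian_eq_sum_fderiv (hf.mul hg), laplacian_eq_sum_fderiv hf, laplacian_eq_sum_fderiv hg,
    ← OrthonormalBasis.sum_inner_mul_inner (EuclideanSpace.basisFun (Fin d) ℝ) (gradient f x),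
    Finset.mul_sum, Finset.mul_sum, Finset.mul_sum, ← Finset.sum_add_distrib,
    ← Finset.sum_add_distrib]
  refine Finset.sum_congr rfl fun i _ => ?_
  rw [hdir, hgrad f, hgrad g, real_inner_comm (gradient g x)]

theorem fderiv_comp_const_smul {f : Space d → ℝ} (hf : ContDiff ℝ 2 f) (c : ℝ) (x : Space d) :
    fderiv ℝ (fun y => f (c • y)) x = c • fderiv ℝ f (c • x) := by
  have h : HasFDerivAt (fun y : Space d => f (c • y))
      ((fderiv ℝ f (c • x)).comp (c • ContinuousLinearMap.id ℝ (Space d))) x :=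
    ((hf.differentiable (by norm_num)) (c • x)).hasFDerivAt.comp x
      ((hasFDerivAt_id x).const_smul c)
  rw [h.fderiv]
  ext v
  simp

theorem laplacian_comp_const_smul {f : Space d → ℝ} (hf : ContDiff ℝ 2 f) (c : ℝ) (x : Space d) :
    Laplacian.laplacian (fun y => f (c • y)) x = c ^ 2 * Laplacian.laplacian f (c • x) := by
  have hc : ContDiff ℝ 2 fun y : Space d => f (c • y) := hf.comp (contDiff_const_smul c)
  rw [laplacian_eq_sum_fderiv hc.contDiffAt, laplacian_eq_sum_fderiv hf.contDiffAt, Finset.mul_sum]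
  refine Finset.sum_congr rfl fun i _ => ?_
  simp only [fderiv_comp_const_smul hf c, smul_apply]
  set v := EuclideanSpace.basisFun (Fin d) ℝ i
  have h : HasFDerivAt (fun y : Space d => c • fderiv ℝ f (c • y) v)
      (c • (fderiv ℝ (fun y => fderiv ℝ f y v) (c • x)).comp
        (c • ContinuousLinearMap.id ℝ (Space d))) x :=
    ((fderiv_fderiv_apply hf.contDiffAt v).1.hasFDerivAt.comp x
      ((hasFDerivAt_id x).const_smul c)).const_smul c
  rw [h.fderiv]
  simp
  ring

theorem continuous_laplacian {f : Space d → ℝ} (hf : ContDiff ℝ 2 f) :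
    Continuous (Laplacian.laplacian f) := by
  rw [InnerProductSpace.laplacian_eq_iteratedFDeriv_orthonormalBasis f
    (EuclideanSpace.basisFun (Fin d) ℝ)]
  have h := hf.continuous_iteratedFDeriv (m := 2) le_rfl
  exact continuous_finsetSum _ fun i _ => (continuous_eval_const _).comp h

theorem hasCompactSupport_laplacian {f : Space d → ℝ} (hf : HasCompactSupport f) :
    HasCompactSupport (Laplacian.laplacian f) := by
  refine hf.mono' fun x hx => ?_
  by_contra hxf
  refine hx ?_
  have h : f =ᶠ[𝓝 x] fun _ => 0 := by
    filter_upwards [(isClosed_tsupport f).isOpen_compl.mem_nhds hxf] with y hy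
    exact image_eq_zero_of_notMem_tsupport hy
  rw [InnerProductSpace.laplacian_congr_nhds h |>.eq_of_nhds]
  simp

/-- Green's identity without boundary terms. -/
theorem integral_mul_laplacian {f g : Space d → ℝ} (hg : ContDiff ℝ 2 g) (hf : ContDiff ℝ 2 f)
    (hfc : HasCompactSupport f) :
    ∫ x, g x * Laplacian.laplacian f x = ∫ x, Laplacian.laplacian g x * f x := by
  have hd : ∀ (h : Space d → ℝ) (v : Space d), ContDiff ℝ 2 h →
      ContDiff ℝ 1 fun y => fderiv ℝ h y v := fun h v hh =>
    (hh.fderiv_right (m := 1) (by norm_num)).clm_apply contDiff_const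
  have hdd : ∀ (h : Space d → ℝ) (v : Space d), ContDiff ℝ 1 h →
      Continuous fun y => fderiv ℝ h y v := fun h v hh =>
    (hh.continuous_fderiv (by norm_num)).clm_apply continuous_const
  have hcs : ∀ (h : Space d → ℝ) (v : Space d), HasCompactSupport h →
      HasCompactSupport fun y => fderiv ℝ h y v := fun h v hh => hh.fderiv_apply ℝ v
  set b := EuclideanSpace.basisFun (Fin d) ℝ
  have hint : ∀ u v : Space d → ℝ, Continuous u → Continuous v → HasCompactSupport v →
      Integrable fun x => u x * v x := fun u v hu hv hvc =>
    (hu.mul hv).integrable_of_hasCompactSupport hvc.mul_left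
  have key : ∀ i, ∫ x, g x * fderiv ℝ (fun y => fderiv ℝ f y (b i)) x (b i) =
      ∫ x, fderiv ℝ (fun y => fderiv ℝ g y (b i)) x (b i) * f x := by
    intro i
    have hf1 := hd f (b i) hf
    have hg1 := hd g (b i) hg
    have hfc1 := hcs f (b i) hfc
    rw [integral_mul_fderiv_eq_neg_fderiv_mul_of_integrable
      (hint _ _ hg1.continuous hf1.continuous hfc1)
      (hint _ _ hg.continuous (hdd _ _ hf1) (hcs _ _ hfc1))
      (hint _ _ hg.continuous hf1.continuous hfc1)
      (fun x _ => hg.differentiable (by norm_num) x)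
      (fun x _ => hf1.differentiable (by norm_num) x),
      integral_mul_fderiv_eq_neg_fderiv_mul_of_integrable
      (hint _ _ (hdd _ _ hg1) hf.continuous hfc)
      (hint _ _ hg1.continuous hf1.continuous hfc1)
      (hint _ _ hg1.continuous hf.continuous hfc)
      (fun x _ => hg1.differentiable (by norm_num) x)
      (fun x _ => hf.differentiable (by norm_num) x), neg_neg]
  calc ∫ x, g x * Laplacian.laplacian f x
      = ∫ x, ∑ i, g x * fderiv ℝ (fun y => fderiv ℝ f y (b i)) x (b i) := by
        congr 1 with x
        rw [laplacian_eq_sum_fderiv hf.contDiffAt, Finset.mul_sum]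
    _ = ∑ i, ∫ x, g x * fderiv ℝ (fun y => fderiv ℝ f y (b i)) x (b i) :=
        integral_finsetSum _ fun i _ => hint _ _ hg.continuous (hdd _ _ (hd f (b i) hf))
          (hcs _ _ (hcs f (b i) hfc))
    _ = ∑ i, ∫ x, fderiv ℝ (fun y => fderiv ℝ g y (b i)) x (b i) * f x := by simp only [key]
    _ = ∫ x, ∑ i, fderiv ℝ (fun y => fderiv ℝ g y (b i)) x (b i) * f x :=
        (integral_finsetSum _ fun i _ => hint _ _ (hdd _ _ (hd g (b i) hg)) hf.continuous
          hfc).symm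
    _ = ∫ x, Laplacian.laplacian g x * f x := by
        congr 1 with x
        rw [laplacian_eq_sum_fderiv hg.contDiffAt, Finset.sum_mul]

/-! ### Smooth cutoffs to annuli -/

/-- The bump function equal to one on the unit ball and supported in the ball of radius two. -/
noncomputable def unitBump (d : ℕ) : ContDiffBump (0 : Space d) := ⟨1, 2, one_pos, one_lt_two⟩

/-- A smooth even cutoff, equal to one for `2 / n ≤ ‖x‖ ≤ n` and vanishing for `‖x‖ ≤ 1 / n` and
for `‖x‖ ≥ 2 * n`. -/
noncomputable def cutoff (n : ℕ) (x : Space d) : ℝ :=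
  unitBump d ((n : ℝ)⁻¹ • x) - unitBump d ((n : ℝ) • x)

theorem contDiff_unitBump : ContDiff ℝ 2 (unitBump d) := (unitBump d).contDiff

theorem contDiff_cutoff (n : ℕ) : ContDiff ℝ 2 (cutoff (d := d) n) :=
  (contDiff_unitBump.comp (contDiff_const_smul _)).sub
    (contDiff_unitBump.comp (contDiff_const_smul _))

theorem unitBump_eq_one {x : Space d} (hx : ‖x‖ ≤ 1) : unitBump d x = 1 :=
  (unitBump d).one_of_mem_closedBall (by simpa [unitBump] using hx)

theorem unitBump_eq_zero {x : Space d} (hx : 2 ≤ ‖x‖) : unitBump d x = 0 :=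
  (unitBump d).zero_of_le_dist (by simpa [unitBump] using hx)

theorem abs_cutoff_le_one (n : ℕ) (x : Space d) : |cutoff n x| ≤ 1 := by
  unfold cutoff
  have h1 := (unitBump d).nonneg (x := (n : ℝ)⁻¹ • x)
  have h2 := (unitBump d).nonneg (x := (n : ℝ) • x)
  have h3 := (unitBump d).le_one (x := (n : ℝ)⁻¹ • x)
  have h4 := (unitBump d).le_one (x := (n : ℝ) • x)
  rw [abs_le]; constructor <;> linarith

theorem cutoff_neg (n : ℕ) (x : Space d) : cutoff n (-x) = cutoff n x := by
  simp only [cutoff, smul_neg, ContDiffBump.neg]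

theorem cutoff_eq_zero_of_le {n : ℕ} (hn : 1 ≤ n) {x : Space d} (hx : ‖x‖ ≤ (n : ℝ)⁻¹) :
    cutoff n x = 0 := by
  have hn' : (1 : ℝ) ≤ n := by exact_mod_cast hn
  have hinv : (n : ℝ)⁻¹ ≤ 1 := inv_le_one_of_one_le₀ hn'
  have h1 : ‖(n : ℝ)⁻¹ • x‖ ≤ 1 := by
    rw [norm_smul, Real.norm_of_nonneg (by positivity)]
    nlinarith [norm_nonneg x, inv_nonneg.2 (zero_le_one.trans hn')]
  have h2 : ‖(n : ℝ) • x‖ ≤ 1 := by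
    rw [norm_smul, Real.norm_of_nonneg (by positivity)]
    calc (n : ℝ) * ‖x‖ ≤ n * (n : ℝ)⁻¹ := by gcongr
      _ = 1 := mul_inv_cancel₀ (by positivity)
  rw [cutoff, unitBump_eq_one h1, unitBump_eq_one h2, sub_self]

theorem cutoff_eq_zero_of_ge {n : ℕ} (hn : 1 ≤ n) {x : Space d} (hx : 2 * (n : ℝ) ≤ ‖x‖) :
    cutoff n x = 0 := by
  have hn' : (1 : ℝ) ≤ n := by exact_mod_cast hn
  have h1 : 2 ≤ ‖(n : ℝ)⁻¹ • x‖ := by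
    rw [norm_smul, Real.norm_of_nonneg (by positivity), inv_mul_eq_div, le_div_iff₀ (by positivity)]
    exact hx
  have h2 : 2 ≤ ‖(n : ℝ) • x‖ := by
    rw [norm_smul, Real.norm_of_nonneg (by positivity)]
    nlinarith
  rw [cutoff, unitBump_eq_zero h1, unitBump_eq_zero h2, sub_self]

theorem cutoff_eq_one {n : ℕ} (hn : 1 ≤ n) {x : Space d} (hx : 2 ≤ n * ‖x‖) (hx' : ‖x‖ ≤ n) :
    cutoff n x = 1 := by
  have hn' : (1 : ℝ) ≤ n := by exact_mod_cast hn
  have h1 : ‖(n : ℝ)⁻¹ • x‖ ≤ 1 := by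
    rw [norm_smul, Real.norm_of_nonneg (by positivity), inv_mul_eq_div, div_le_one (by positivity)]
    exact hx'
  have h2 : 2 ≤ ‖(n : ℝ) • x‖ := by
    rwa [norm_smul, Real.norm_of_nonneg (by positivity)]
  rw [cutoff, unitBump_eq_one h1, unitBump_eq_zero h2, sub_zero]

theorem eventually_cutoff_eq_one {x : Space d} (hx : x ≠ 0) :
    ∀ᶠ n : ℕ in atTop, cutoff n =ᶠ[𝓝 x] fun _ => (1 : ℝ) := by
  have hx' : 0 < ‖x‖ := norm_pos_iff.2 hx
  filter_upwards [eventually_ge_atTop 1,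
    tendsto_natCast_atTop_atTop.eventually_ge_atTop (4 / ‖x‖),
    tendsto_natCast_atTop_atTop.eventually_ge_atTop (2 * ‖x‖)] with n hn h1 h2
  have h1' : 4 ≤ n * ‖x‖ := (div_le_iff₀ hx').1 h1
  have e1 : ∀ᶠ y in 𝓝 x, ‖x‖ / 2 < ‖y‖ :=
    continuous_norm.continuousAt.eventually_const_lt (by linarith)
  have e2 : ∀ᶠ y in 𝓝 x, ‖y‖ < 2 * ‖x‖ :=
    continuous_norm.continuousAt.eventually_lt_const (by linarith)
  filter_upwards [e1, e2] with y hy1 hy2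
  refine cutoff_eq_one hn ?_ (by linarith)
  have : (1 : ℝ) ≤ n := by exact_mod_cast hn
  nlinarith

/-- The derivatives of the cutoffs scale like powers of the norm, uniformly in `n`. -/
theorem exists_cutoff_deriv_bound (d : ℕ) : ∃ C : ℝ, 0 ≤ C ∧ ∀ (n : ℕ) (x : Space d),
    ‖x‖ * ‖fderiv ℝ (cutoff n) x‖ ≤ C ∧ ‖x‖ ^ 2 * |Laplacian.laplacian (cutoff n) x| ≤ C := by
  have hc : HasCompactSupport (unitBump d) := (unitBump d).hasCompactSupport
  obtain ⟨C₁, h₁⟩ := (hc.fderiv ℝ).norm.mul_left (f := fun x : Space d => ‖x‖)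
    |>.exists_bound_of_continuous
      (continuous_norm.mul (contDiff_unitBump.continuous_fderiv (by norm_num)).norm)
  obtain ⟨C₂, h₂⟩ := (hasCompactSupport_laplacian hc).norm.mul_left
    (f := fun x : Space d => ‖x‖ ^ 2) |>.exists_bound_of_continuous
      ((continuous_norm.pow 2).mul (continuous_laplacian contDiff_unitBump).norm)
  have h₁' : ∀ x : Space d, ‖x‖ * ‖fderiv ℝ (unitBump d) x‖ ≤ C₁ := fun x => by
    simpa using h₁ x
  have h₂' : ∀ x : Space d,
      ‖x‖ ^ 2 * |Laplacian.laplacian (unitBump d : Space d → ℝ) x| ≤ C₂ := fun x => by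
    simpa using h₂ x
  have hC₁ : 0 ≤ C₁ := (by positivity : (0 : ℝ) ≤ _).trans (h₁' 0)
  have hC₂ : 0 ≤ C₂ := (by positivity : (0 : ℝ) ≤ _).trans (h₂' 0)
  have s₁ : ∀ (c : ℝ) (x : Space d), ‖x‖ * ‖fderiv ℝ (fun y => unitBump d (c • y)) x‖ ≤ C₁ := by
    intro c x
    rw [fderiv_comp_const_smul contDiff_unitBump, norm_smul, ← mul_assoc, mul_comm ‖x‖, ← norm_smul]
    exact h₁' _
  have s₂ : ∀ (c : ℝ) (x : Space d),
      ‖x‖ ^ 2 * |Laplacian.laplacian (fun y => unitBump d (c • y)) x| ≤ C₂ := by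
    intro c x
    have := h₂' (c • x)
    rw [norm_smul, mul_pow, Real.norm_eq_abs, sq_abs] at this
    rw [laplacian_comp_const_smul contDiff_unitBump, abs_mul, abs_of_nonneg (sq_nonneg c)]
    linarith
  refine ⟨2 * C₁ + 2 * C₂, by positivity, fun n x => ?_⟩
  have c₁ : ContDiff ℝ 2 fun y : Space d => unitBump d ((n : ℝ)⁻¹ • y) :=
    contDiff_unitBump.comp (contDiff_const_smul _)
  have c₂ : ContDiff ℝ 2 fun y : Space d => unitBump d ((n : ℝ) • y) :=
    contDiff_unitBump.comp (contDiff_const_smul _)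
  constructor
  · have : fderiv ℝ (cutoff n) x = fderiv ℝ (fun y => unitBump d ((n : ℝ)⁻¹ • y)) x -
        fderiv ℝ (fun y => unitBump d ((n : ℝ) • y)) x :=
      fderiv_fun_sub (c₁.differentiable (by norm_num) x) (c₂.differentiable (by norm_num) x)
    rw [this]
    have h := norm_sub_le (fderiv ℝ (fun y => unitBump d ((n : ℝ)⁻¹ • y)) x)
      (fderiv ℝ (fun y => unitBump d ((n : ℝ) • y)) x)
    have := mul_le_mul_of_nonneg_left h (norm_nonneg x)
    linarith [s₁ (n : ℝ)⁻¹ x, s₁ n x]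
  · have : Laplacian.laplacian (cutoff n) x =
        Laplacian.laplacian (fun y => unitBump d ((n : ℝ)⁻¹ • y)) x -
        Laplacian.laplacian (fun y => unitBump d ((n : ℝ) • y)) x :=
      c₁.contDiffAt.laplacian_sub c₂.contDiffAt
    rw [this]
    have h := abs_sub (Laplacian.laplacian (fun y => unitBump d ((n : ℝ)⁻¹ • y)) x)
      (Laplacian.laplacian (fun y => unitBump d ((n : ℝ) • y)) x)
    have := mul_le_mul_of_nonneg_left h (sq_nonneg ‖x‖)
    linarith [s₂ (n : ℝ)⁻¹ x, s₂ n x]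

/-! ### Potentials cut off to annuli -/

theorem majorant_sub_two_mul {α β : ℝ} {x : Space d} (hx : x ≠ 0) :
    majorant (α - 2) (β - 2) x * ‖x‖ ^ 2 = majorant α β x := by
  have hx' : 0 < ‖x‖ := norm_pos_iff.2 hx
  unfold majorant
  rw [add_mul, ← Real.rpow_natCast, ← Real.rpow_add hx', ← Real.rpow_add hx']
  norm_num

/-- The power bounds combined into one majorant for each derivative, valid on all of
`ℝᵈ \ {0}`. -/
theorem PowerBounds.exists_bound {W : Space d → EReal} {a b : ℝ} (h : PowerBounds W a b) :
    ∃ C : ℝ, 0 ≤ C ∧ ∀ x : Space d, x ≠ 0 → |re W x| ≤ C * majorant a b x ∧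
      ‖gradient (re W) x‖ ≤ C * (majorant (a - 2) (b - 2) x * ‖x‖) ∧
      |lap W x| ≤ C * majorant (a - 2) (b - 2) x := by
  obtain ⟨C₁, h₁⟩ := h.bound
  obtain ⟨C₂, h₂⟩ := h.gradient_bound
  obtain ⟨C₃, h₃⟩ := h.lap_bound
  have key : ∀ (C c c' t : ℝ) (x : Space d), x ≠ 0 → C ≤ |C₁| + |C₂| + |C₃| →
      (0 < ‖x‖ → ‖x‖ < 1 → t ≤ C * ‖x‖ ^ c') → (1 ≤ ‖x‖ → t ≤ C * ‖x‖ ^ c) →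
      t ≤ (|C₁| + |C₂| + |C₃|) * majorant c c' x := by
    intro C c c' t x hx hC h1 h2
    have hx' : 0 < ‖x‖ := norm_pos_iff.2 hx
    have p1 : 0 < ‖x‖ ^ c := by positivity
    have p2 : 0 < ‖x‖ ^ c' := by positivity
    have hs : 0 ≤ |C₁| + |C₂| + |C₃| := by positivity
    unfold majorant
    rcases lt_or_ge ‖x‖ 1 with hx1 | hx1
    · have := h1 hx' hx1
      nlinarith
    · have := h2 hx1
      nlinarith
  have e1 := le_abs_self C₁
  have e2 := le_abs_self C₂
  have e3 := le_abs_self C₃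
  have p1 := abs_nonneg C₁
  have p2 := abs_nonneg C₂
  have p3 := abs_nonneg C₃
  refine ⟨|C₁| + |C₂| + |C₃|, by positivity, fun x hx => ⟨?_, ?_, ?_⟩⟩
  · exact key C₁ a b _ x hx (by linarith) (h₁ x).1 (h₁ x).2
  · have hx' : 0 < ‖x‖ := norm_pos_iff.2 hx
    have : majorant (a - 2) (b - 2) x * ‖x‖ = majorant (a - 1) (b - 1) x := by
      unfold majorant
      rw [add_mul, ← Real.rpow_add_one hx'.ne', ← Real.rpow_add_one hx'.ne']
      ring_nf
    rw [this]
    exact key C₂ _ _ _ x hx (by linarith) (h₂ x).1 (h₂ x).2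
  · exact key C₃ _ _ _ x hx (by linarith) (h₃ x).1 (h₃ x).2

theorem IsC2OffOrigin.contDiffAt {W : Space d → EReal} (h : IsC2OffOrigin W) {x : Space d}
    (hx : x ≠ 0) : ContDiffAt ℝ 2 (re W) x :=
  h.contDiffOn.contDiffAt (isOpen_compl_singleton.mem_nhds hx)

/-- The potential multiplied by the cutoff to an annulus. -/
noncomputable def cutPotential (W : Space d → EReal) (n : ℕ) (x : Space d) : ℝ :=
  cutoff n x * re W x

section cutPotential

variable {W : Space d → EReal}

theorem cutPotential_eventuallyEq_zero {n : ℕ} (hn : 1 ≤ n) : cutPotential W n =ᶠ[𝓝 0] 0 := by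
  have hn' : (0 : ℝ) < (n : ℝ)⁻¹ := by positivity
  filter_upwards [Metric.closedBall_mem_nhds (0 : Space d) hn'] with x hx
  simp [cutPotential, cutoff_eq_zero_of_le hn (mem_closedBall_zero_iff.1 hx)]

theorem contDiff_cutPotential (hW : IsC2OffOrigin W) {n : ℕ} (hn : 1 ≤ n) :
    ContDiff ℝ 2 (cutPotential W n) := by
  rw [contDiff_iff_contDiffAt]
  intro x
  rcases eq_or_ne x 0 with rfl | hx
  · exact contDiffAt_const.congr_of_eventuallyEq (cutPotential_eventuallyEq_zero hn)
  · exact (contDiff_cutoff n).contDiffAt.mul (hW.contDiffAt hx)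

theorem hasCompactSupport_cutPotential {n : ℕ} (hn : 1 ≤ n) :
    HasCompactSupport (cutPotential W n) := by
  refine HasCompactSupport.intro (isCompact_closedBall (0 : Space d) (2 * n)) fun x hx => ?_
  have : 2 * (n : ℝ) < ‖x‖ := by simpa using hx
  simp [cutPotential, cutoff_eq_zero_of_ge hn this.le]

theorem abs_cutPotential_le (n : ℕ) (x : Space d) : |cutPotential W n x| ≤ |re W x| := by
  rw [cutPotential, abs_mul]
  exact mul_le_of_le_one_left (abs_nonneg _) (abs_cutoff_le_one n x)

theorem cutPotential_neg (hW : ∀ x, W (-x) = W x) (n : ℕ) (x : Space d) :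
    cutPotential W n (-x) = cutPotential W n x := by
  simp only [cutPotential, cutoff_neg, re, hW]

theorem eventually_cutPotential_eq {x : Space d} (hx : x ≠ 0) :
    ∀ᶠ n : ℕ in atTop, cutPotential W n =ᶠ[𝓝 x] re W := by
  filter_upwards [eventually_cutoff_eq_one hx] with n hn
  filter_upwards [hn] with y hy
  simp [cutPotential, hy]

theorem eventually_laplacian_cutPotential_eq {x : Space d} (hx : x ≠ 0) :
    ∀ᶠ n : ℕ in atTop, Laplacian.laplacian (cutPotential W n) x = lap W x := by
  filter_upwards [eventually_cutPotential_eq (W := W) hx] with n hn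
  exact (InnerProductSpace.laplacian_congr_nhds hn).eq_of_nhds

/-- The Laplacians of the cut-off potentials are dominated, uniformly in `n`, by the power-law
majorant of `ΔW`. -/
theorem exists_laplacian_cutPotential_bound (hW : IsC2OffOrigin W) {a b : ℝ}
    (h : PowerBounds W a b) : ∃ C : ℝ, 0 ≤ C ∧ ∀ (n : ℕ) (x : Space d), x ≠ 0 →
      |Laplacian.laplacian (cutPotential W n) x| ≤ C * majorant (a - 2) (b - 2) x := by
  obtain ⟨K, hK, hcut⟩ := exists_cutoff_deriv_bound d
  obtain ⟨C, hC, hb⟩ := h.exists_bound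
  refine ⟨C + 2 * (K * C) + C * K, by positivity, fun n x hx => ?_⟩
  obtain ⟨b1, b2, b3⟩ := hb x hx
  obtain ⟨k1, k2⟩ := hcut n x
  have hM := majorant_nonneg (a - 2) (b - 2) x
  have hgrad : ‖gradient (cutoff n) x‖ = ‖fderiv ℝ (cutoff n) x‖ := by
    simp [gradient]
  have e1 : |cutoff n x * lap W x| ≤ C * majorant (a - 2) (b - 2) x := by
    rw [abs_mul]
    exact (mul_le_of_le_one_left (abs_nonneg _) (abs_cutoff_le_one n x)).trans b3
  have e2 : |2 * inner ℝ (gradient (cutoff n) x) (gradient (re W) x)| ≤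
      2 * (K * C) * majorant (a - 2) (b - 2) x := by
    rw [abs_mul, abs_two, mul_assoc]
    gcongr
    calc |inner ℝ (gradient (cutoff n) x) (gradient (re W) x)|
        ≤ ‖gradient (cutoff n) x‖ * ‖gradient (re W) x‖ := abs_real_inner_le_norm _ _
      _ ≤ ‖fderiv ℝ (cutoff n) x‖ * (C * (majorant (a - 2) (b - 2) x * ‖x‖)) := by
          rw [hgrad]; gcongr
      _ = (‖x‖ * ‖fderiv ℝ (cutoff n) x‖) * (C * majorant (a - 2) (b - 2) x) := by ring
      _ ≤ K * (C * majorant (a - 2) (b - 2) x) := by gcongr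
      _ = _ := by ring
  have e3 : |re W x * Laplacian.laplacian (cutoff n) x| ≤ C * K * majorant (a - 2) (b - 2) x := by
    rw [abs_mul]
    calc |re W x| * |Laplacian.laplacian (cutoff n) x|
        ≤ C * majorant a b x * |Laplacian.laplacian (cutoff n) x| := by gcongr
      _ = C * majorant (a - 2) (b - 2) x * (‖x‖ ^ 2 * |Laplacian.laplacian (cutoff n) x|) := by
          rw [← majorant_sub_two_mul hx]; ring
      _ ≤ C * majorant (a - 2) (b - 2) x * K := by gcongr
      _ = _ := by ring
  have := laplacian_mul (contDiff_cutoff n).contDiffAt (hW.contDiffAt hx)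
  change |Laplacian.laplacian (fun y => cutoff n y * re W y) x| ≤ _
  rw [this]
  refine (abs_add_three _ _ _).trans ?_
  change |cutoff n x * lap W x| + _ + _ ≤ _
  linarith

theorem continuousOn_lap (hW : IsC2OffOrigin W) : ContinuousOn (lap W) {0}ᶜ := by
  intro x hx
  refine ContinuousAt.continuousWithinAt ?_
  obtain ⟨n, hn, hn1⟩ :=
    ((eventually_cutPotential_eq (W := W) hx).and (eventually_ge_atTop 1)).exists
  exact (continuous_laplacian (contDiff_cutPotential hW hn1)).continuousAt.congr
    (InnerProductSpace.laplacian_congr_nhds hn)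

end cutPotential

/-! ### The Newtonian potential -/

/-- The Newtonian potential as a function of the squared norm. -/
noncomputable def newtonProfile (d : ℕ) (t : ℝ) : ℝ :=
  if d = 2 then -(1 / (4 * Real.pi)) * Real.log t
  else -(1 / ((2 - (d : ℝ)) * sphereArea d)) * t ^ ((2 - (d : ℝ)) / 2)

theorem newton_eq_profile (x : Space d) : newton x = newtonProfile d (‖x‖ ^ 2) := by
  unfold newton newtonProfile
  split_ifs
  · rw [Real.log_pow]; push_cast; ring
  · rw [← Real.rpow_natCast, ← Real.rpow_mul (norm_nonneg x)]
    congr 2; push_cast; ring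

theorem sphereArea_eq [NeZero d] :
    sphereArea d = d * (volume : Measure (Space d)).real (Metric.ball 0 1) := by
  rw [sphereArea, Measure.toSphere_real_apply_univ]
  simp

theorem sphereArea_pos [NeZero d] : 0 < sphereArea d := by
  have hd : (0 : ℝ) < d := by exact_mod_cast NeZero.pos d
  rw [sphereArea_eq]
  exact mul_pos hd (ENNReal.toReal_pos (Metric.measure_ball_pos _ _ one_pos).ne'
    measure_ball_lt_top.ne)

theorem sphereArea_two : sphereArea 2 = 2 * Real.pi := by
  rw [sphereArea_eq, Measure.real, EuclideanSpace.volume_ball_fin_two]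
  simp [ENNReal.toReal_ofReal Real.pi_pos.le]

theorem hasDerivAt_newtonProfile [NeZero d] {t : ℝ} (ht : 0 < t) :
    HasDerivAt (newtonProfile d) (-(1 / (2 * sphereArea d)) * t ^ (-(d : ℝ) / 2)) t := by
  have hS := sphereArea_pos (d := d)
  by_cases hd : d = 2
  · subst hd
    have h := (Real.hasDerivAt_log ht.ne').const_mul (-(1 / (4 * Real.pi)))
    have he : newtonProfile 2 = fun t => -(1 / (4 * Real.pi)) * Real.log t := by
      ext t; simp [newtonProfile]
    rw [he]
    convert! h using 1
    rw [sphereArea_two]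
    rw [show -((2 : ℕ) : ℝ) / 2 = -1 by norm_num, Real.rpow_neg_one]
    ring
  · have h := (Real.hasDerivAt_rpow_const (x := t) (p := (2 - (d : ℝ)) / 2)
      (Or.inl ht.ne')).const_mul (-(1 / ((2 - (d : ℝ)) * sphereArea d)))
    have he : newtonProfile d =
        fun t => -(1 / ((2 - (d : ℝ)) * sphereArea d)) * t ^ ((2 - (d : ℝ)) / 2) := by
      ext t; simp [newtonProfile, hd]
    have hd' : (2 - (d : ℝ)) ≠ 0 := by
      intro h; apply hd; exact_mod_cast (by linarith : (d : ℝ) = 2)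
    rw [he]
    convert! h using 1
    rw [show (2 - (d : ℝ)) / 2 - 1 = -(d : ℝ) / 2 by ring]
    field_simp

theorem contDiffAt_newtonProfile {t : ℝ} (ht : 0 < t) : ContDiffAt ℝ 2 (newtonProfile d) t := by
  unfold newtonProfile
  split_ifs
  · exact contDiffAt_const.mul (Real.contDiffAt_log.2 ht.ne')
  · exact contDiffAt_const.mul (Real.contDiffAt_rpow_const_of_ne ht.ne')

/-- Monotonicity of the profile makes the regularizations `N_δ` increase to `N` as `δ` decreases to
zero. -/
theorem antitoneOn_newtonProfile [NeZero d] : AntitoneOn (newtonProfile d) (Set.Ioi 0) := by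
  refine antitoneOn_of_deriv_nonpos (convex_Ioi 0)
    (fun t ht => (hasDerivAt_newtonProfile ht).continuousAt.continuousWithinAt)
    (fun t ht => ?_) (fun t ht => ?_)
  · rw [interior_Ioi] at ht
    exact (hasDerivAt_newtonProfile ht).differentiableAt.differentiableWithinAt
  · rw [interior_Ioi] at ht
    have ht' : (0 : ℝ) < t := ht
    have hS := sphereArea_pos (d := d)
    rw [(hasDerivAt_newtonProfile ht').deriv, neg_mul]
    exact neg_nonpos.2 (by positivity)

theorem contDiffAt_newton {x : Space d} (hx : x ≠ 0) : ContDiffAt ℝ 2 (newton (d := d)) x := by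
  have he : newton (d := d) = fun y => newtonProfile d (‖y‖ ^ 2) := by
    ext y; exact newton_eq_profile y
  rw [he]
  exact (contDiffAt_newtonProfile (by positivity)).comp x (contDiff_norm_sq ℝ).contDiffAt

theorem measurable_newton : Measurable (newton (d := d)) := by
  unfold newton
  split_ifs <;> fun_prop

theorem newton_neg (x : Space d) : newton (-x) = newton x := by simp [newton]

theorem newton_sub_comm (x y : Space d) : newton (x - y) = newton (y - x) := by
  rw [← newton_neg, neg_sub]

theorem exists_newton_le_majorant [NeZero d] :
    ∃ A e : ℝ, -(d : ℝ) < e ∧ ∀ x : Space d, x ≠ 0 → |newton x| ≤ A * majorant 1 e x := by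
  have hd1 : 1 ≤ d := NeZero.one_le
  by_cases hd : d = 2
  · refine ⟨1 / (2 * Real.pi), -1, by subst hd; norm_num, fun x hx => ?_⟩
    have hx' : 0 < ‖x‖ := norm_pos_iff.2 hx
    have h1 : Real.log ‖x‖ ≤ ‖x‖ := (Real.log_le_sub_one_of_pos hx').trans (by linarith)
    have h2 : -Real.log ‖x‖ ≤ ‖x‖⁻¹ := by
      rw [← Real.log_inv]
      exact (Real.log_le_sub_one_of_pos (inv_pos.2 hx')).trans (by linarith)
    have h3 : 0 < ‖x‖⁻¹ := inv_pos.2 hx'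
    rw [newton, if_pos hd, abs_mul, abs_neg, abs_of_pos (by positivity), majorant,
      Real.rpow_one, Real.rpow_neg_one]
    gcongr
    rw [abs_le]; constructor <;> linarith
  · refine ⟨|1 / ((2 - (d : ℝ)) * sphereArea d)|, 2 - d, by linarith, fun x hx => ?_⟩
    rw [newton, if_neg hd, abs_mul, abs_neg, majorant]
    gcongr
    rw [abs_of_nonneg (by positivity)]
    linarith [Real.rpow_nonneg (norm_nonneg x) 1]

theorem locallyIntegrable_newton [NeZero d] : LocallyIntegrable (newton (d := d)) := by
  obtain ⟨A, e, he, h⟩ := exists_newton_le_majorant (d := d)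
  have hd : (0 : ℝ) < d := by exact_mod_cast NeZero.pos d
  exact HasMajorant.locallyIntegrable (α := 1) (β := e) (C := A) (by linarith) he
    ⟨measurable_newton.aestronglyMeasurable, by filter_upwards [ae_ne_zero] with x hx using h x hx⟩

theorem exists_newton_le_rpow [NeZero d] {σ : ℝ} (hσ : 0 < σ) (hσ' : 2 - (d : ℝ) < σ) :
    ∃ A : ℝ, 0 ≤ A ∧ ∀ x : Space d, 1 ≤ ‖x‖ → |newton x| ≤ A * ‖x‖ ^ σ := by
  by_cases hd : d = 2
  · refine ⟨1 / (2 * Real.pi) * (1 / σ), by positivity, fun x hx => ?_⟩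
    rw [newton, if_pos hd, abs_mul, abs_neg, abs_of_pos (by positivity),
      abs_of_nonneg (Real.log_nonneg hx), mul_assoc]
    gcongr
    rw [one_div_mul_eq_div]
    exact Real.log_le_rpow_div (norm_nonneg x) hσ
  · refine ⟨|1 / ((2 - (d : ℝ)) * sphereArea d)|, abs_nonneg _, fun x hx => ?_⟩
    rw [newton, if_neg hd, abs_mul, abs_neg]
    gcongr
    rw [abs_of_nonneg (by positivity)]
    exact Real.rpow_le_rpow_of_exponent_le hx hσ'.le

/-! ### The Newtonian potential is a fundamental solution -/

/-- The smooth regularization `N_δ` of the Newtonian potential centred at `p`, obtained by replacing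
`‖x‖²` by `‖x - p‖² + δ²`. -/
noncomputable def newtonReg (δ : ℝ) (p x : Space d) : ℝ := newtonProfile d (‖x - p‖ ^ 2 + δ ^ 2)

theorem contDiff_newtonReg {δ : ℝ} (hδ : 0 < δ) (p : Space d) :
    ContDiff ℝ 2 (newtonReg δ p) := by
  rw [contDiff_iff_contDiffAt]
  intro x
  have h : ContDiff ℝ 2 fun y : Space d => ‖y - p‖ ^ 2 + δ ^ 2 :=
    ((contDiff_id.sub contDiff_const).norm_sq ℝ).add contDiff_const
  exact (contDiffAt_newtonProfile (by positivity)).comp x h.contDiffAt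

theorem hasFDerivAt_norm_sub_sq_add (δ : ℝ) (p x : Space d) :
    HasFDerivAt (fun y : Space d => ‖y - p‖ ^ 2 + δ ^ 2) (2 • innerSL ℝ (x - p)) x := by
  have h := (((hasFDerivAt_id x).sub_const p).norm_sq).add_const (δ ^ 2)
  convert! h using 1

theorem fderiv_newtonReg [NeZero d] {δ : ℝ} (hδ : 0 < δ) (p x v : Space d) :
    fderiv ℝ (newtonReg δ p) x v = -(1 / sphereArea d) *
      ((‖x - p‖ ^ 2 + δ ^ 2) ^ (-(d : ℝ) / 2) * inner ℝ (x - p) v) := by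
  have hpos : 0 < ‖x - p‖ ^ 2 + δ ^ 2 := by positivity
  have h := (hasDerivAt_newtonProfile (d := d) hpos).comp_hasFDerivAt x
    (hasFDerivAt_norm_sub_sq_add δ p x)
  have h' : HasFDerivAt (newtonReg δ p) _ x := h
  rw [h'.fderiv]
  have hS := sphereArea_pos (d := d)
  simp only [smul_apply, innerSL_apply_apply, smul_eq_mul, nsmul_eq_mul]
  push_cast
  field_simp

theorem laplacian_newtonReg [NeZero d] {δ : ℝ} (hδ : 0 < δ) (p x : Space d) :
    Laplacian.laplacian (newtonReg δ p) x =
      -(d / sphereArea d * (δ ^ 2 * (‖x - p‖ ^ 2 + δ ^ 2) ^ (-(d : ℝ) / 2 - 1))) := by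
  have hpos : 0 < ‖x - p‖ ^ 2 + δ ^ 2 := by positivity
  set q := ‖x - p‖ ^ 2 + δ ^ 2 with hq
  have hdir : ∀ v : Space d, fderiv ℝ (fun y => fderiv ℝ (newtonReg δ p) y v) x v =
      -(1 / sphereArea d) * (q ^ (-(d : ℝ) / 2) * inner ℝ v v -
        d * q ^ (-(d : ℝ) / 2 - 1) * (inner ℝ (x - p) v * inner ℝ v (x - p))) := by
    intro v
    simp only [fderiv_newtonReg hδ p]
    have h1 := (Real.hasDerivAt_rpow_const (x := q) (p := -(d : ℝ) / 2)
      (Or.inl hpos.ne')).comp_hasFDerivAt x (hasFDerivAt_norm_sub_sq_add δ p x)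
    have h2 : HasFDerivAt (fun y : Space d => inner ℝ (y - p) v) (innerSL ℝ v) x := by
      have := ((innerSL ℝ v).hasFDerivAt (x := x)).sub_const (inner ℝ v p)
      refine this.congr_of_eventuallyEq (Eventually.of_forall fun y => ?_)
      simp [inner_sub_left, real_inner_comm]
    have h3 := (h1.mul h2).const_mul (-(1 / sphereArea d))
    have h3' : HasFDerivAt (fun y : Space d => -(1 / sphereArea d) *
      ((‖y - p‖ ^ 2 + δ ^ 2) ^ (-(d : ℝ) / 2) * inner ℝ (y - p) v)) _ x := h3
    rw [h3'.fderiv]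
    simp only [Function.comp_apply, ← hq, smul_apply, add_apply, innerSL_apply_apply, smul_eq_mul,
      nsmul_eq_mul, real_inner_comm v (x - p)]
    push_cast
    ring
  rw [laplacian_eq_sum_fderiv (contDiff_newtonReg hδ p).contDiffAt]
  simp only [hdir]
  rw [← Finset.mul_sum, Finset.sum_sub_distrib, ← Finset.mul_sum, ← Finset.mul_sum,
    OrthonormalBasis.sum_inner_mul_inner]
  have hq1 : q ^ (-(d : ℝ) / 2) = q ^ (-(d : ℝ) / 2 - 1) * q := by
    rw [← Real.rpow_add_one hpos.ne']; ring_nf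
  have hsum : ∑ i, inner ℝ (EuclideanSpace.basisFun (Fin d) ℝ i)
      (EuclideanSpace.basisFun (Fin d) ℝ i) = (d : ℝ) := by
    simp
  rw [hsum, real_inner_self_eq_norm_sq, hq1, show δ ^ 2 = q - ‖x - p‖ ^ 2 by rw [hq]; ring]
  have hS := sphereArea_pos (d := d)
  field_simp

/-- The profile of the approximate identity `-ΔN_δ`. -/
noncomputable def newtonKernel (z : Space d) : ℝ :=
  d / sphereArea d * (‖z‖ ^ 2 + 1) ^ (-(d : ℝ) / 2 - 1)

theorem laplacian_newtonReg_inv [NeZero d] {c : ℝ} (hc : 0 < c) (p x : Space d) :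
    Laplacian.laplacian (newtonReg c⁻¹ p) x = -(c ^ d * newtonKernel (c • (p - x))) := by
  rw [laplacian_newtonReg (inv_pos.2 hc), newtonKernel, norm_smul, Real.norm_of_nonneg hc.le,
    norm_sub_rev p x]
  have e : ‖x - p‖ ^ 2 + c⁻¹ ^ 2 = c⁻¹ ^ 2 * ((c * ‖x - p‖) ^ 2 + 1) := by field_simp
  have e2 : (c⁻¹ ^ 2) ^ (-(d : ℝ) / 2 - 1) = c ^ (d + 2) := by
    rw [← Real.rpow_natCast, ← Real.rpow_mul (by positivity), Real.inv_rpow hc.le,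
      ← Real.rpow_neg hc.le, ← Real.rpow_natCast]
    congr 1; push_cast; ring
  rw [e, Real.mul_rpow (by positivity) (by positivity), e2]
  field_simp
  ring

theorem tendsto_pow_mul_add_one_rpow (d : ℕ) :
    Tendsto (fun r : ℝ => r ^ d * (r ^ 2 + 1) ^ (-(d : ℝ) / 2)) atTop (𝓝 1) := by
  have h : Tendsto (fun r : ℝ => (1 + (r ^ 2)⁻¹) ^ (-(d : ℝ) / 2)) atTop (𝓝 1) := by
    have h1 : Tendsto (fun r : ℝ => 1 + (r ^ 2)⁻¹) atTop (𝓝 (1 + 0)) :=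
      tendsto_const_nhds.add (tendsto_inv_atTop_zero.comp (tendsto_pow_atTop two_ne_zero))
    have h2 := h1.rpow_const (p := -(d : ℝ) / 2) (Or.inl (by norm_num))
    simpa using h2
  refine h.congr' ?_
  filter_upwards [eventually_gt_atTop 0] with r hr
  have e : r ^ 2 + 1 = r ^ 2 * (1 + (r ^ 2)⁻¹) := by field_simp
  have e2 : (r ^ 2) ^ (-(d : ℝ) / 2) = (r ^ d)⁻¹ := by
    rw [← Real.rpow_natCast, ← Real.rpow_mul hr.le, ← Real.rpow_natCast, ← Real.rpow_neg hr.le]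
    congr 1; push_cast; ring
  rw [e, Real.mul_rpow (by positivity) (by positivity), e2]
  field_simp

/-- In polar coordinates, the integrand is the derivative of `r ^ d * (r ^ 2 + 1) ^ (-d / 2)`. -/
theorem integral_newtonKernel [NeZero d] : ∫ z : Space d, newtonKernel z = 1 := by
  have hd : 1 ≤ d := NeZero.one_le
  have hS := sphereArea_pos (d := d)
  have hmain : ∫ r in Set.Ioi (0 : ℝ),
      d * r ^ (d - 1) * (r ^ 2 + 1) ^ (-(d : ℝ) / 2 - 1) = 1 := by
    have hder : ∀ r ∈ Set.Ici (0 : ℝ),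
        HasDerivAt (fun r : ℝ => r ^ d * (r ^ 2 + 1) ^ (-(d : ℝ) / 2))
        (d * r ^ (d - 1) * (r ^ 2 + 1) ^ (-(d : ℝ) / 2 - 1)) r := by
      intro r hr
      have hpos : 0 < r ^ 2 + 1 := by positivity
      have h1 := (hasDerivAt_pow 2 r).add_const 1
      have h2 := (Real.hasDerivAt_rpow_const (x := r ^ 2 + 1) (p := -(d : ℝ) / 2)
        (Or.inl hpos.ne')).comp r h1
      have h3 := (hasDerivAt_pow d r).mul h2
      convert! h3 using 1
      have hq1 : (r ^ 2 + 1) ^ (-(d : ℝ) / 2) =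
          (r ^ 2 + 1) ^ (-(d : ℝ) / 2 - 1) * (r ^ 2 + 1) := by
        rw [← Real.rpow_add_one hpos.ne']; ring_nf
      have hr2 : r ^ d = r ^ (d - 1) * r := by rw [← pow_succ, Nat.sub_add_cancel hd]
      simp only [Function.comp_apply, hq1, hr2]
      push_cast
      ring
    have := integral_Ioi_of_hasDerivAt_of_nonneg' hder
      (fun r hr => by
        have : (0 : ℝ) < r := hr
        positivity) (tendsto_pow_mul_add_one_rpow d)
    rw [this]
    have : d ≠ 0 := by omega
    simp [this]
  have h := integral_fun_norm_addHaar (volume : Measure (Space d))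
    (fun r : ℝ => (d : ℝ) / sphereArea d * (r ^ 2 + 1) ^ (-(d : ℝ) / 2 - 1))
  unfold newtonKernel
  rw [h]
  have hb : (volume : Measure (Space d)).real (Metric.ball 0 1) ≠ 0 := by
    intro h0
    rw [sphereArea_eq, h0, mul_zero] at hS
    exact lt_irrefl _ hS
  have hd0 : (d : ℝ) ≠ 0 := by
    intro h0
    rw [sphereArea_eq, h0, zero_mul] at hS
    exact lt_irrefl _ hS
  have hI : ∫ y in Set.Ioi (0 : ℝ), y ^ (Module.finrank ℝ (Space d) - 1) •
      (d / sphereArea d * (y ^ 2 + 1) ^ (-(d : ℝ) / 2 - 1)) = 1 / sphereArea d := by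
    trans ∫ y in Set.Ioi (0 : ℝ), 1 / sphereArea d *
      (d * y ^ (d - 1) * (y ^ 2 + 1) ^ (-(d : ℝ) / 2 - 1))
    · congr 1 with y
      simp only [finrank_euclideanSpace, Fintype.card_fin, smul_eq_mul]
      ring
    · rw [integral_const_mul, hmain, mul_one]
  rw [hI, sphereArea_eq]
  simp only [finrank_euclideanSpace, Fintype.card_fin, smul_eq_mul, nsmul_eq_mul]
  field_simp

theorem newtonKernel_nonneg [NeZero d] (z : Space d) : 0 ≤ newtonKernel z := by
  have hS := sphereArea_pos (d := d)
  unfold newtonKernel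
  positivity

theorem tendsto_newtonKernel_cobounded (d : ℕ) :
    Tendsto (fun z : Space d => ‖z‖ ^ d * newtonKernel z) (Bornology.cobounded _) (𝓝 0) := by
  have h1 : Tendsto (fun r : ℝ => (r ^ 2 + 1)⁻¹) atTop (𝓝 0) :=
    tendsto_inv_atTop_zero.comp
      (tendsto_atTop_add_const_right _ _ (tendsto_pow_atTop two_ne_zero))
  have h2 := ((tendsto_pow_mul_add_one_rpow d).mul h1).const_mul (d / sphereArea d)
  simp only [mul_zero] at h2
  refine (h2.comp (tendsto_norm_cobounded_atTop (E := Space d))).congr fun z => ?_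
  have hpos : 0 < ‖z‖ ^ 2 + 1 := by positivity
  simp only [Function.comp_apply, newtonKernel]
  rw [Real.rpow_sub_one hpos.ne']
  ring

theorem integrable_newton_sub_mul [NeZero d] {f : Space d → ℝ} (hf : Continuous f)
    (hfc : HasCompactSupport f) (x : Space d) : Integrable fun y => newton (y - x) * f y := by
  have h : Integrable fun y => newton y * f (y + x) :=
    (locallyIntegrable_newton (d := d)).integrable_smul_right_of_hasCompactSupport
      (f := newton (d := d)) (g := fun y => f (y + x)) (hf.comp (by fun_prop))
      (hfc.comp_homeomorph (Homeomorph.addRight x))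
  simpa using h.comp_sub_right x

/-- `-ΔN` is the Dirac measure at the origin, tested against functions of class `C²` with compact
support. -/
theorem integral_newton_sub_mul_laplacian [NeZero d] {f : Space d → ℝ} (hf : ContDiff ℝ 2 f)
    (hfc : HasCompactSupport f) (x : Space d) :
    ∫ y, newton (y - x) * Laplacian.laplacian f y = -f x := by
  have hL := continuous_laplacian hf
  have hLc := hasCompactSupport_laplacian hfc
  -- the regularizations converge to the potential, and their Laplacians to minus a point mass
  have hlim1 : Tendsto (fun c : ℝ => ∫ y, newtonReg c⁻¹ x y * Laplacian.laplacian f y) atTop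
      (𝓝 (-f x)) := by
    have h := (tendsto_integral_comp_smul_smul_of_integrable' (μ := (volume : Measure (Space d)))
      newtonKernel_nonneg integral_newtonKernel
      (by simpa using tendsto_newtonKernel_cobounded d)
      (hf.continuous.integrable_of_hasCompactSupport hfc)
      (hf.continuous.continuousAt (x := x))).neg
    refine h.congr' ?_
    filter_upwards [eventually_gt_atTop 0] with c hc
    rw [integral_mul_laplacian (contDiff_newtonReg (inv_pos.2 hc) x) hf hfc, ← integral_neg]
    congr 1 with y
    rw [laplacian_newtonReg_inv hc]
    simp
  have hlim2 : Tendsto (fun c : ℝ => ∫ y, newtonReg c⁻¹ x y * Laplacian.laplacian f y) atTop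
      (𝓝 (∫ y, newton (y - x) * Laplacian.laplacian f y)) := by
    refine tendsto_integral_filter_of_dominated_convergence
      (fun y => ‖newton (y - x) * Laplacian.laplacian f y‖ +
        ‖newtonReg 1 x y * Laplacian.laplacian f y‖) ?_ ?_ ?_ ?_
    · filter_upwards [eventually_gt_atTop 0] with c hc
      exact ((contDiff_newtonReg (inv_pos.2 hc) x).continuous.mul hL).aestronglyMeasurable
    · filter_upwards [eventually_ge_atTop 1] with c hc
      have hne : ∀ᵐ y : Space d, y ≠ x := by simp [ae_iff, measure_singleton]
      filter_upwards [hne] with y hy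
      have hyx : 0 < ‖y - x‖ := norm_pos_iff.2 (sub_ne_zero.2 hy)
      have hc0 : 0 < c := by linarith
      have hc1 : c⁻¹ ≤ 1 := inv_le_one_of_one_le₀ hc
      have m1 : newtonReg c⁻¹ x y ≤ newton (y - x) := by
        rw [newton_eq_profile]
        refine antitoneOn_newtonProfile ?_ ?_ ?_
        · exact Set.mem_Ioi.2 (by positivity)
        · exact Set.mem_Ioi.2 (by positivity)
        · nlinarith [sq_nonneg c⁻¹]
      have m2 : newtonReg 1 x y ≤ newtonReg c⁻¹ x y := by
        refine antitoneOn_newtonProfile ?_ ?_ ?_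
        · exact Set.mem_Ioi.2 (by positivity)
        · exact Set.mem_Ioi.2 (by positivity)
        · have : 0 < c⁻¹ := by positivity
          nlinarith
      rw [norm_mul, norm_mul, norm_mul, ← add_mul]
      gcongr
      simp only [Real.norm_eq_abs]
      rw [abs_le]
      constructor
      · linarith [neg_abs_le (newtonReg 1 x y), abs_nonneg (newton (y - x))]
      · linarith [le_abs_self (newton (y - x)), abs_nonneg (newtonReg 1 x y)]
    · exact (integrable_newton_sub_mul hL hLc x).norm.add
        (((contDiff_newtonReg one_pos x).continuous.mul hL).integrable_of_hasCompactSupport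
          hLc.mul_left).norm
    · have hne : ∀ᵐ y : Space d, y ≠ x := by simp [ae_iff, measure_singleton]
      filter_upwards [hne] with y hy
      have hyx : 0 < ‖y - x‖ := norm_pos_iff.2 (sub_ne_zero.2 hy)
      refine Tendsto.mul_const _ ?_
      rw [newton_eq_profile]
      have h1 : Tendsto (fun c : ℝ => ‖y - x‖ ^ 2 + c⁻¹ ^ 2) atTop (𝓝 (‖y - x‖ ^ 2)) := by
        simpa using (tendsto_inv_atTop_zero (𝕜 := ℝ)).pow 2 |>.const_add (‖y - x‖ ^ 2)
      exact ((contDiffAt_newtonProfile (d := d) (by positivity :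
        0 < ‖y - x‖ ^ 2)).continuousAt.tendsto).comp h1
  exact tendsto_nhds_unique hlim2 hlim1

theorem integral_laplacian_eq_zero {f : Space d → ℝ} (hf : ContDiff ℝ 2 f)
    (hfc : HasCompactSupport f) : ∫ y, Laplacian.laplacian f y = 0 := by
  have h := integral_mul_laplacian (g := fun _ : Space d => (1 : ℝ)) contDiff_const hf hfc
  simpa using h

/-! ### Second differences of the Newtonian potential -/

/-- A function of class `C²` at `x` has second differences of quadratic order at `x`. -/
theorem exists_second_difference_bound {f : Space d → ℝ} {x : Space d}
    (hf : ContDiffAt ℝ 2 f x) : ∃ r L : ℝ, 0 < r ∧ 0 ≤ L ∧ ∀ y : Space d, ‖y‖ < r →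
      |f x - 1 / 2 * f (x - y) - 1 / 2 * f (x + y)| ≤ L * ‖y‖ ^ 2 := by
  obtain ⟨K, t, ht, hK⟩ := (hf.fderiv_right (m := 1) (by norm_num)).exists_lipschitzOnWith
  have hev : ∀ᶠ y in 𝓝 x, y ∈ t ∧ DifferentiableAt ℝ f y :=
    (Filter.eventually_mem_set.2 ht).and ((hf.eventually (by simp)).mono fun y hy =>
      hy.differentiableAt (by norm_num))
  obtain ⟨r, hr, hball⟩ := Metric.eventually_nhds_iff_ball.1 hev
  refine ⟨r, K, hr, K.2, fun y hy => ?_⟩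
  have hmem : ∀ s ∈ Set.Icc (0 : ℝ) 1, x + s • y ∈ Metric.ball x r ∧
      x - s • y ∈ Metric.ball x r := by
    intro s hs
    have : ‖s • y‖ < r := by
      rw [norm_smul, Real.norm_of_nonneg hs.1]
      nlinarith [hs.2, norm_nonneg y]
    constructor <;> simpa [dist_eq_norm] using this
  have hder : ∀ s ∈ Set.Icc (0 : ℝ) 1, HasDerivAt (fun s : ℝ => f (x + s • y) + f (x - s • y))
      (fderiv ℝ f (x + s • y) y - fderiv ℝ f (x - s • y) y) s := by
    intro s hs
    have hs1 : HasDerivAt (fun s : ℝ => s • y) y s := by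
      simpa using (hasDerivAt_id s).smul_const y
    have h1 := (hball _ (hmem s hs).1).2.hasFDerivAt.comp_hasDerivAt s (hs1.const_add x)
    have h2 := (hball _ (hmem s hs).2).2.hasFDerivAt.comp_hasDerivAt s (hs1.const_sub x)
    have := h1.add h2
    simpa [sub_eq_add_neg] using! this
  have hbound : ∀ s ∈ Set.Ico (0 : ℝ) 1,
      ‖fderiv ℝ f (x + s • y) y - fderiv ℝ f (x - s • y) y‖ ≤ 2 * K * ‖y‖ ^ 2 := by
    intro s hs
    have hs' : s ∈ Set.Icc (0 : ℝ) 1 := ⟨hs.1, hs.2.le⟩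
    have h := hK.norm_sub_le (hball _ (hmem s hs').1).1 (hball _ (hmem s hs').2).1
    have h' := (fderiv ℝ f (x + s • y) - fderiv ℝ f (x - s • y)).le_opNorm y
    have e : ‖x + s • y - (x - s • y)‖ ≤ 2 * ‖y‖ := by
      rw [show x + s • y - (x - s • y) = (2 * s) • y by module, norm_smul,
        Real.norm_of_nonneg (by linarith [hs.1])]
      nlinarith [hs.2, norm_nonneg y]
    calc ‖fderiv ℝ f (x + s • y) y - fderiv ℝ f (x - s • y) y‖
        ≤ ‖fderiv ℝ f (x + s • y) - fderiv ℝ f (x - s • y)‖ * ‖y‖ := by simpa using h'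
      _ ≤ (K * (2 * ‖y‖)) * ‖y‖ := by
          gcongr
          exact h.trans (by gcongr)
      _ = 2 * K * ‖y‖ ^ 2 := by ring
  have := norm_image_sub_le_of_norm_deriv_le_segment_01'
    (fun s hs => (hder s hs).hasDerivWithinAt) hbound
  simp only [one_smul, zero_smul, add_zero, sub_zero, Real.norm_eq_abs] at this
  rw [show f x - 1 / 2 * f (x - y) - 1 / 2 * f (x + y) =
    -(1 / 2) * (f (x + y) + f (x - y) - (f x + f x)) by ring, abs_mul]
  norm_num
  linarith

/-- The negative of half the second difference of the Newtonian potential at `x` with step `y`. -/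
noncomputable def secondDiff (x y : Space d) : ℝ :=
  newton x - 1 / 2 * newton (x - y) - 1 / 2 * newton (x + y)

theorem measurable_secondDiff :
    Measurable fun p : Space d × Space d => secondDiff p.1 p.2 := by
  have h := measurable_newton (d := d)
  unfold secondDiff
  exact ((h.comp measurable_fst).sub ((h.comp (measurable_fst.sub measurable_snd)).const_mul _)).sub
    ((h.comp (measurable_fst.add measurable_snd)).const_mul _)

theorem integrableOn_ball_secondDiff [NeZero d] (x : Space d) (R : ℝ) :
    IntegrableOn (secondDiff x) (Metric.ball 0 R) := by
  have hloc : IntegrableOn (newton (d := d)) (Metric.ball 0 (R + ‖x‖)) :=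
    (locallyIntegrable_newton.integrableOn_isCompact (isCompact_closedBall 0 _)).mono_set
      Metric.ball_subset_closedBall
  have hind := (integrable_indicator_iff Metric.isOpen_ball.measurableSet).2 hloc
  have h1 : IntegrableOn (fun y => newton (x - y)) (Metric.ball 0 R) := by
    refine (hind.comp_sub_left x).integrableOn.congr_fun (fun y hy => ?_)
      Metric.isOpen_ball.measurableSet
    have : x - y ∈ Metric.ball (0 : Space d) (R + ‖x‖) := by
      have hy' : ‖y‖ < R := by simpa using hy
      rw [mem_ball_zero_iff]
      linarith [norm_sub_le x y]
    exact Set.indicator_of_mem this _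
  have h2 : IntegrableOn (fun y => newton (x + y)) (Metric.ball 0 R) := by
    refine (hind.comp_add_left x).integrableOn.congr_fun (fun y hy => ?_)
      Metric.isOpen_ball.measurableSet
    have : x + y ∈ Metric.ball (0 : Space d) (R + ‖x‖) := by
      have hy' : ‖y‖ < R := by simpa using hy
      rw [mem_ball_zero_iff]
      linarith [norm_add_le x y]
    exact Set.indicator_of_mem this _
  exact ((integrableOn_const (measure_ball_lt_top).ne).sub (h1.const_mul _)).sub (h2.const_mul _)

/-- Against a power `‖y‖ ^ (c - 2)` with `-d < c < min (2 - d) 0`, second differences of the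
Newtonian potential are integrable: they are quadratic at the origin, and grow no faster than the
potential at infinity. -/
theorem integrable_secondDiff_mul_rpow [NeZero d] {c : ℝ} (hc : -(d : ℝ) < c)
    (hc' : c < min (2 - (d : ℝ)) 0) {x : Space d} (hx : x ≠ 0) :
    Integrable fun y => |secondDiff x y| * ‖y‖ ^ (c - 2) := by
  have hc1 : c < 2 - (d : ℝ) := hc'.trans_le (min_le_left _ _)
  have hc0 : c < 0 := hc'.trans_le (min_le_right _ _)
  have hmeas : Measurable fun y => |secondDiff x y| * ‖y‖ ^ (c - 2) :=
    ((measurable_secondDiff.comp (measurable_const.prodMk measurable_id)).abs).mul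
      (measurable_norm_rpow _)
  obtain ⟨r, L, hr, hL, hnear⟩ := exists_second_difference_bound (contDiffAt_newton hx)
  -- an admissible growth exponent of the potential at infinity
  obtain ⟨σ, hσ1, hσ2⟩ : ∃ σ, max 0 (2 - (d : ℝ)) < σ ∧ σ < 2 - d - c :=
    exists_between (max_lt (by linarith) (by linarith))
  have hσ0 : 0 < σ := (le_max_left _ _).trans_lt hσ1
  obtain ⟨A, hA, hfar⟩ := exists_newton_le_rpow hσ0 ((le_max_right _ _).trans_lt hσ1)
  set R := 2 * ‖x‖ + 2 with hR
  have hnear' : IntegrableOn (fun y => |secondDiff x y| * ‖y‖ ^ (c - 2)) (Metric.ball 0 r) := by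
    refine ((integrableOn_ball_norm_rpow hc r).const_mul L).mono' hmeas.aestronglyMeasurable ?_
    filter_upwards [ae_restrict_mem Metric.isOpen_ball.measurableSet, ae_restrict_of_ae ae_ne_zero]
      with y hy hy0
    have hy' : 0 < ‖y‖ := norm_pos_iff.2 hy0
    rw [Real.norm_of_nonneg (by positivity)]
    calc |secondDiff x y| * ‖y‖ ^ (c - 2) ≤ L * ‖y‖ ^ 2 * ‖y‖ ^ (c - 2) := by
          gcongr
          exact hnear y (by simpa using hy)
      _ = L * ‖y‖ ^ c := by
          rw [mul_assoc, ← Real.rpow_natCast, ← Real.rpow_add hy']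
          congr 2; push_cast; ring
  have hmid : IntegrableOn (fun y => |secondDiff x y| * ‖y‖ ^ (c - 2))
      (Metric.ball 0 R \ Metric.ball 0 r) := by
    refine (((integrableOn_ball_secondDiff x R).mono_set Set.sdiff_subset).norm.mul_const
      (r ^ (c - 2))).mono' hmeas.aestronglyMeasurable ?_
    filter_upwards [ae_restrict_mem (Metric.isOpen_ball.measurableSet.diff
      Metric.isOpen_ball.measurableSet)] with y hy
    have hy' : r ≤ ‖y‖ := by simpa using hy.2
    rw [Real.norm_of_nonneg (by positivity), Real.norm_eq_abs]
    exact mul_le_mul_of_nonneg_left (Real.rpow_le_rpow_of_nonpos hr hy' (by linarith))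
      (abs_nonneg _)
  have hout : IntegrableOn (fun y => |secondDiff x y| * ‖y‖ ^ (c - 2)) (Metric.ball 0 R)ᶜ := by
    have hint := integrableOn_compl_ball_norm_rpow (d := d) (c := σ + c - 2) (by linarith)
      (r := R) (by positivity)
    refine (hint.const_mul (|newton x| + A * 2 ^ σ)).mono' hmeas.aestronglyMeasurable ?_
    filter_upwards [ae_restrict_mem Metric.isOpen_ball.measurableSet.compl] with y hy
    have hy' : R ≤ ‖y‖ := by simpa using hy
    have hx0 := norm_nonneg x
    have hy0 : 0 < ‖y‖ := by linarith
    have key : ∀ z : Space d, ‖y‖ - ‖x‖ ≤ ‖z‖ → ‖z‖ ≤ ‖x‖ + ‖y‖ →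
        |newton z| ≤ A * 2 ^ σ * ‖y‖ ^ σ := by
      intro z h1 h2
      refine (hfar z (by linarith)).trans ?_
      rw [mul_assoc, ← Real.mul_rpow zero_le_two hy0.le]
      gcongr
      linarith
    have k1 := key (x - y) (by rw [norm_sub_rev]; exact norm_sub_norm_le y x) (norm_sub_le x y)
    have k2 := key (x + y) (by
      have := norm_sub_norm_le y (-x)
      rw [norm_neg, sub_neg_eq_add, add_comm y x] at this
      exact this) (norm_add_le x y)
    have h1 : 1 ≤ ‖y‖ ^ σ := Real.one_le_rpow (by linarith) hσ0.le
    have hsd : |secondDiff x y| ≤ (|newton x| + A * 2 ^ σ) * ‖y‖ ^ σ := by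
      have e : |secondDiff x y| ≤ |newton x| + 1 / 2 * |newton (x - y)| +
          1 / 2 * |newton (x + y)| := by
        unfold secondDiff
        refine (abs_sub _ _).trans (add_le_add ((abs_sub _ _).trans ?_) ?_)
        · rw [abs_mul, abs_of_pos (by norm_num : (0 : ℝ) < 1 / 2)]
        · rw [abs_mul, abs_of_pos (by norm_num : (0 : ℝ) < 1 / 2)]
      nlinarith [abs_nonneg (newton x)]
    rw [Real.norm_of_nonneg (by positivity)]
    calc |secondDiff x y| * ‖y‖ ^ (c - 2)
        ≤ (|newton x| + A * 2 ^ σ) * ‖y‖ ^ σ * ‖y‖ ^ (c - 2) := by gcongr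
      _ = (|newton x| + A * 2 ^ σ) * ‖y‖ ^ (σ + c - 2) := by
          rw [mul_assoc, ← Real.rpow_add hy0, add_sub_assoc]
  rw [← integrableOn_univ]
  refine ((hnear'.union hmid).union hout).mono_set fun y _ => ?_
  by_cases h1 : y ∈ Metric.ball (0 : Space d) r
  · exact Or.inl (Or.inl h1)
  · by_cases h2 : y ∈ Metric.ball (0 : Space d) R
    · exact Or.inl (Or.inr ⟨h2, h1⟩)
    · exact Or.inr h2

/-- Second differences of the Newtonian potential are homogeneous of degree `2 - d`; in dimension
two the logarithms of the scaling factor cancel. -/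
theorem secondDiff_smul {t : ℝ} (ht : 0 < t) {x y : Space d} (hx : x ≠ 0) (h1 : x - y ≠ 0)
    (h2 : x + y ≠ 0) : secondDiff (t • x) (t • y) = t ^ (2 - (d : ℝ)) * secondDiff x y := by
  have hn : ∀ z : Space d, ‖t • z‖ = t * ‖z‖ := fun z => by
    rw [norm_smul, Real.norm_of_nonneg ht.le]
  unfold secondDiff newton
  simp only [← smul_sub, ← smul_add, hn]
  split_ifs with hd
  · rw [Real.log_mul ht.ne' (norm_ne_zero_iff.2 hx), Real.log_mul ht.ne' (norm_ne_zero_iff.2 h1),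
      Real.log_mul ht.ne' (norm_ne_zero_iff.2 h2)]
    subst hd
    norm_num
    ring
  · simp only [Real.mul_rpow ht.le (norm_nonneg _)]
    ring

theorem secondDiff_isometry (ρ : Space d ≃ₗᵢ[ℝ] Space d) (x y : Space d) :
    secondDiff (ρ x) (ρ y) = secondDiff x y := by
  unfold secondDiff newton
  simp only [← map_sub, ← map_add, ρ.norm_map]

theorem exists_isometry_smul {x e : Space d} (he : ‖e‖ = 1) :
    ∃ ρ : Space d ≃ₗᵢ[ℝ] Space d, x = ‖x‖ • ρ e := by
  rcases eq_or_ne x 0 with rfl | hx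
  · exact ⟨LinearIsometryEquiv.refl ℝ _, by simp⟩
  · have hx' : ‖x‖ ≠ 0 := norm_ne_zero_iff.2 hx
    have hu : ‖e‖ = ‖‖x‖⁻¹ • x‖ := by
      rw [he, norm_smul, norm_inv, norm_norm, inv_mul_cancel₀ hx']
    refine ⟨Submodule.reflection (Submodule.span ℝ {e - ‖x‖⁻¹ • x})ᗮ, ?_⟩
    rw [Submodule.reflection_sub hu, smul_smul, mul_inv_cancel₀ hx', one_smul]

/-- Scaling and rotation invariance reduce weighted integrals of second differences at `x` to those
at a fixed unit vector. -/
theorem integral_secondDiff_scaling [NeZero d] {e x : Space d} (he : ‖e‖ = 1) (hx : x ≠ 0) (c : ℝ)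
    (g : ℝ → ℝ) :
    ∫ y, g ‖y‖ * (|secondDiff x y| * ‖y‖ ^ (c - 2)) =
      ‖x‖ ^ c * ∫ z, g (‖x‖ * ‖z‖) * (|secondDiff e z| * ‖z‖ ^ (c - 2)) := by
  obtain ⟨ρ, hρ⟩ := exists_isometry_smul (x := x) he
  have ht : 0 < ‖x‖ := norm_pos_iff.2 hx
  set t := ‖x‖
  have hscale := Measure.integral_comp_smul (volume : Measure (Space d))
    (fun y => g ‖y‖ * (|secondDiff x y| * ‖y‖ ^ (c - 2))) t
  have hrot := ρ.measurePreserving.integral_comp ρ.toHomeomorph.measurableEmbedding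
    (fun z : Space d => g ‖t • z‖ * (|secondDiff x (t • z)| * ‖t • z‖ ^ (c - 2)))
  rw [finrank_euclideanSpace, Fintype.card_fin, abs_of_pos (by positivity), smul_eq_mul,
    ← hrot] at hscale
  have hI : ∫ y, g ‖y‖ * (|secondDiff x y| * ‖y‖ ^ (c - 2)) = t ^ d *
      ∫ z : Space d, g ‖t • ρ z‖ * (|secondDiff x (t • ρ z)| * ‖t • ρ z‖ ^ (c - 2)) := by
    rw [hscale]
    field_simp
  rw [hI, ← integral_const_mul, ← integral_const_mul]
  have hne1 : ∀ᵐ z : Space d, z ≠ e := by simp [ae_iff, measure_singleton]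
  have hne2 : ∀ᵐ z : Space d, z ≠ -e := by simp [ae_iff, measure_singleton]
  refine integral_congr_ae ?_
  filter_upwards [hne1, hne2] with z h1 h2
  have he0 : e ≠ 0 := by
    rintro rfl
    simp at he
  have hsd : secondDiff x (t • ρ z) = t ^ (2 - (d : ℝ)) * secondDiff e z := by
    conv_lhs => rw [hρ]
    rw [secondDiff_smul ht, secondDiff_isometry]
    · simpa using he0
    · rw [← map_sub]
      simp only [ne_eq, map_eq_zero_iff _ ρ.injective]
      exact sub_ne_zero.2 h1.symm
    · rw [← map_add]
      simp only [ne_eq, map_eq_zero_iff _ ρ.injective]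
      intro h
      exact h2 (eq_neg_of_add_eq_zero_right h)
  have hn : ‖t • ρ z‖ = t * ‖z‖ := by
    rw [norm_smul, Real.norm_of_nonneg ht.le, ρ.norm_map]
  rw [hsd, hn, abs_mul, abs_of_pos (Real.rpow_pos_of_pos ht _),
    Real.mul_rpow ht.le (norm_nonneg z)]
  have hpow : t ^ d * (t ^ (2 - (d : ℝ)) * t ^ (c - 2)) = t ^ c := by
    rw [← Real.rpow_natCast, ← Real.rpow_add ht, ← Real.rpow_add ht]
    congr 1; ring
  rw [← hpow]
  ring

/-- The representation formula for even functions of class `C²` with compact support. -/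
theorem integral_secondDiff_mul_laplacian [NeZero d] {f : Space d → ℝ} (hf : ContDiff ℝ 2 f)
    (hfc : HasCompactSupport f) (heven : ∀ x, f (-x) = f x) (x : Space d) :
    ∫ y, secondDiff x y * Laplacian.laplacian f y = f x := by
  have hL := continuous_laplacian hf
  have hLc := hasCompactSupport_laplacian hfc
  have i1 := integrable_newton_sub_mul hL hLc x
  have i2 := integrable_newton_sub_mul hL hLc (-x)
  have i0 : Integrable (Laplacian.laplacian f) := hL.integrable_of_hasCompactSupport hLc
  have e : ∀ y, secondDiff x y * Laplacian.laplacian f y =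
      newton x * Laplacian.laplacian f y - 1 / 2 * (newton (y - x) * Laplacian.laplacian f y) -
        1 / 2 * (newton (y - -x) * Laplacian.laplacian f y) := by
    intro y
    rw [secondDiff, newton_sub_comm x y, sub_neg_eq_add, add_comm y x]
    ring
  have i01 : Integrable fun y => newton x * Laplacian.laplacian f y -
      1 / 2 * (newton (y - x) * Laplacian.laplacian f y) := (i0.const_mul _).sub (i1.const_mul _)
  simp only [e]
  rw [integral_sub i01 (i2.const_mul _),
    integral_sub (i0.const_mul _) (i1.const_mul _), integral_const_mul, integral_const_mul,
    integral_const_mul, integral_laplacian_eq_zero hf hfc,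
    integral_newton_sub_mul_laplacian hf hfc, integral_newton_sub_mul_laplacian hf hfc, heven]
  ring

/-! ### The representation formula -/

theorem aestronglyMeasurable_of_continuousOn_compl_zero [NeZero d] {f : Space d → ℝ}
    (hf : ContinuousOn f {0}ᶜ) : AEStronglyMeasurable f := by
  have h := hf.aestronglyMeasurable (μ := volume) (measurableSet_singleton (0 : Space d)).compl
  rwa [Measure.restrict_eq_self_of_ae_mem] at h
  filter_upwards [ae_ne_zero] with x hx using hx

theorem measurableSet_annulus (ε R : ℝ) : MeasurableSet (annulus d ε R) :=
  (measurableSet_le measurable_const measurable_norm).inter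
    (measurableSet_le measurable_norm measurable_const)

/-- The weight `1 - 1_{ε ≤ r ≤ R}` of the complement of an annulus, as a function of the radius. -/
noncomputable def outerWeight (ε R r : ℝ) : ℝ := (Set.Icc ε R)ᶜ.indicator (fun _ => 1) r

theorem outerWeight_nonneg (ε R r : ℝ) : 0 ≤ outerWeight ε R r :=
  Set.indicator_nonneg (fun _ _ => zero_le_one) _

theorem outerWeight_le_one (ε R r : ℝ) : outerWeight ε R r ≤ 1 :=
  Set.indicator_le_self' (fun _ _ => zero_le_one) _

theorem measurable_outerWeight (ε R : ℝ) : Measurable (outerWeight ε R) :=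
  measurable_const.indicator measurableSet_Icc.compl

/-- Rescaling the radius enlarges the complement of an annulus in a controlled way. -/
theorem outerWeight_mul_le {ε R r s t u : ℝ} (hs : 0 < s) (hst : s ≤ t) (htu : t ≤ u)
    (hr : 0 ≤ r) : outerWeight ε R (t * r) ≤ outerWeight (ε / s) (R / u) r := by
  have ht : 0 < t := hs.trans_le hst
  have hu : 0 < u := ht.trans_le htu
  by_cases h : r ∈ Set.Icc (ε / s) (R / u)
  · have h1 : ε ≤ r * s := (div_le_iff₀ hs).1 h.1
    have h2 : r * u ≤ R := (le_div_iff₀ hu).1 h.2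
    have : t * r ∈ Set.Icc ε R := ⟨by nlinarith, by nlinarith⟩
    simp [outerWeight, h, this]
  · have : outerWeight (ε / s) (R / u) r = 1 := by simp [outerWeight, h]
    rw [this]
    exact outerWeight_le_one _ _ _

theorem eventually_cutoffLimit : ∀ᶠ p : ℝ × ℝ in cutoffLimit, 0 < p.1 ∧ p.1 < p.2 := by
  have h1 : ∀ᶠ ε : ℝ in 𝓝[>] 0, 0 < ε ∧ ε < 1 :=
    (eventually_mem_nhdsWithin).and
      (eventually_nhdsWithin_of_eventually_nhds (eventually_lt_nhds one_pos))
  have h2 : ∀ᶠ R : ℝ in atTop, 1 < R := eventually_gt_atTop 1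
  filter_upwards [h1.prod_mk h2] with p hp
  exact ⟨hp.1.1, hp.1.2.trans hp.2⟩

instance : (cutoffLimit).IsCountablyGenerated := by
  unfold cutoffLimit; infer_instance

theorem tendsto_scaled_cutoffLimit {s u : ℝ} (hs : 0 < s) (hu : 0 < u) :
    Tendsto (fun p : ℝ × ℝ => (p.1 / s, p.2 / u)) cutoffLimit cutoffLimit := by
  refine Tendsto.prodMap (f := fun ε : ℝ => ε / s) (g := fun R : ℝ => R / u) ?_
    (tendsto_id.atTop_div_const hu)
  refine tendsto_nhdsWithin_iff.2 ⟨?_, ?_⟩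
  · have : Tendsto (fun ε : ℝ => ε / s) (𝓝 0) (𝓝 (0 / s)) := tendsto_id.div_const s
    rw [zero_div] at this
    exact this.mono_left nhdsWithin_le_nhds
  · filter_upwards [eventually_mem_nhdsWithin] with ε hε
    exact div_pos hε hs

theorem eventually_mem_annulus {y : Space d} (hy : y ≠ 0) :
    ∀ᶠ p : ℝ × ℝ in cutoffLimit, y ∈ annulus d p.1 p.2 := by
  have hy' : 0 < ‖y‖ := norm_pos_iff.2 hy
  have h1 : ∀ᶠ ε : ℝ in 𝓝[>] 0, ε ≤ ‖y‖ :=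
    eventually_nhdsWithin_of_eventually_nhds ((eventually_lt_nhds hy').mono fun _ h => h.le)
  filter_upwards [h1.prod_mk (eventually_ge_atTop ‖y‖)] with p hp using hp

theorem tendsto_outerWeight {y : Space d} (hy : y ≠ 0) :
    Tendsto (fun p : ℝ × ℝ => outerWeight p.1 p.2 ‖y‖) cutoffLimit (𝓝 0) := by
  refine tendsto_const_nhds.congr' ?_
  filter_upwards [eventually_mem_annulus hy] with p hp
  have : ‖y‖ ∈ Set.Icc p.1 p.2 := hp
  simp [outerWeight, this]

/-- The part of an integral outside large annuli tends to zero. -/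
theorem tendsto_integral_outerWeight [NeZero d] {f : Space d → ℝ} (hf : Integrable f) :
    Tendsto (fun p : ℝ × ℝ => ∫ y, outerWeight p.1 p.2 ‖y‖ * f y) cutoffLimit (𝓝 0) := by
  have h := tendsto_integral_filter_of_dominated_convergence (l := cutoffLimit)
    (F := fun (p : ℝ × ℝ) y => outerWeight p.1 p.2 ‖y‖ * f y) (f := fun _ : Space d => (0 : ℝ))
    (μ := volume) (fun y => ‖f y‖) ?_ ?_ hf.norm ?_
  · simpa using h
  · exact Eventually.of_forall fun p => ((measurable_outerWeight _ _).comp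
      measurable_norm).aestronglyMeasurable.mul hf.1
  · refine Eventually.of_forall fun p => Eventually.of_forall fun y => ?_
    rw [norm_mul, Real.norm_of_nonneg (outerWeight_nonneg _ _ _)]
    exact mul_le_of_le_one_left (norm_nonneg _) (outerWeight_le_one _ _ _)
  · filter_upwards [ae_ne_zero] with y hy
    simpa using (tendsto_outerWeight hy).mul_const (f y)

section representation

variable {W : Space d → EReal} {a b : ℝ}

theorem integrable_secondDiff_mul_majorant [NeZero d] (h : PowerBounds W a b) {x : Space d}
    (hx : x ≠ 0) : Integrable fun y => |secondDiff x y| * majorant (a - 2) (b - 2) y := by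
  refine ((integrable_secondDiff_mul_rpow h.a_gt h.a_lt hx).add
    (integrable_secondDiff_mul_rpow h.b_gt h.b_lt hx)).congr (Eventually.of_forall fun y => ?_)
  simp only [majorant, Pi.add_apply]
  ring

theorem aestronglyMeasurable_lap [NeZero d] (hW : IsC2OffOrigin W) :
    AEStronglyMeasurable (lap W) :=
  aestronglyMeasurable_of_continuousOn_compl_zero (continuousOn_lap hW)

theorem aestronglyMeasurable_re [NeZero d] (hW : IsC2OffOrigin W) :
    AEStronglyMeasurable (re W) :=
  aestronglyMeasurable_of_continuousOn_compl_zero hW.contDiffOn.continuousOn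

theorem measurable_secondDiff_left (x : Space d) : Measurable (secondDiff x) := by
  have h : Measurable fun y : Space d => (x, y) := measurable_const.prodMk measurable_id
  exact (measurable_secondDiff.comp h :)

theorem integrable_diffIntegrand [NeZero d] (hW : IsC2OffOrigin W) (h : PowerBounds W a b)
    {x : Space d} (hx : x ≠ 0) : Integrable (diffIntegrand W x) := by
  obtain ⟨C, hC, hb⟩ := h.exists_bound
  refine ((integrable_secondDiff_mul_majorant h hx).const_mul C).mono'
    ((measurable_secondDiff_left x).aestronglyMeasurable.mul (aestronglyMeasurable_lap hW)) ?_
  filter_upwards [ae_ne_zero] with y hy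
  change ‖secondDiff x y * lap W y‖ ≤ _
  rw [norm_mul, Real.norm_eq_abs, Real.norm_eq_abs]
  calc |secondDiff x y| * |lap W y| ≤ |secondDiff x y| * (C * majorant (a - 2) (b - 2) y) := by
        gcongr
        exact (hb y hy).2.2
    _ = _ := by ring

/-- The potential is the superposition of second differences of the Newtonian potential: this
holds for the cut-off potentials, and passes to the limit by dominated convergence. -/
theorem integral_diffIntegrand [NeZero d] (hW : IsC2OffOrigin W) (hW0 : ∀ x, W (-x) = W x)
    (h : PowerBounds W a b) {x : Space d} (hx : x ≠ 0) :
    ∫ y, diffIntegrand W x y = re W x := by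
  obtain ⟨C, hC, hb⟩ := exists_laplacian_cutPotential_bound hW h
  have hlim1 : Tendsto (fun n : ℕ => ∫ y, secondDiff x y *
      Laplacian.laplacian (cutPotential W n) y) atTop (𝓝 (∫ y, diffIntegrand W x y)) := by
    refine tendsto_integral_filter_of_dominated_convergence
      (fun y => C * (|secondDiff x y| * majorant (a - 2) (b - 2) y)) ?_ ?_
      ((integrable_secondDiff_mul_majorant h hx).const_mul C) ?_
    · filter_upwards [eventually_ge_atTop 1] with n hn
      exact (measurable_secondDiff_left x).aestronglyMeasurable.mul
        (continuous_laplacian (contDiff_cutPotential hW hn)).aestronglyMeasurable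
    · refine Eventually.of_forall fun n => ?_
      filter_upwards [ae_ne_zero] with y hy
      rw [norm_mul, Real.norm_eq_abs, Real.norm_eq_abs]
      calc |secondDiff x y| * |Laplacian.laplacian (cutPotential W n) y|
          ≤ |secondDiff x y| * (C * majorant (a - 2) (b - 2) y) := by
            gcongr
            exact hb n y hy
        _ = _ := by ring
    · filter_upwards [ae_ne_zero] with y hy
      refine tendsto_const_nhds.congr' ?_
      filter_upwards [eventually_laplacian_cutPotential_eq (W := W) hy] with n hn
      rw [hn]
      rfl
  have hlim2 : Tendsto (fun n : ℕ => ∫ y, secondDiff x y *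
      Laplacian.laplacian (cutPotential W n) y) atTop (𝓝 (re W x)) := by
    refine tendsto_const_nhds.congr' ?_
    filter_upwards [eventually_ge_atTop 1, eventually_cutPotential_eq (W := W) hx] with n hn hn'
    rw [integral_secondDiff_mul_laplacian (contDiff_cutPotential hW hn)
      (hasCompactSupport_cutPotential hn) (cutPotential_neg hW0 n), hn'.eq_of_nhds]
  exact tendsto_nhds_unique hlim1 hlim2

/-- By scaling, the integral of `|secondDiff x y| * ‖y‖ ^ (c - 2)` is a multiple of `‖x‖ ^ c`, so
the truncated integrals have a common majorant of the same type as `W`. -/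
theorem abs_truncated_le [NeZero d] (hW : IsC2OffOrigin W) (h : PowerBounds W a b) :
    ∃ C : ℝ, ∀ (ε R : ℝ) (x : Space d), x ≠ 0 → |truncated W ε R x| ≤ C * majorant a b x := by
  obtain ⟨C, hC, hb⟩ := h.exists_bound
  obtain ⟨e, he⟩ := exists_norm_eq (Space d) zero_le_one
  obtain ⟨Ka, hKa'⟩ : ∃ Ka, Ka = ∫ z, |secondDiff e z| * ‖z‖ ^ (a - 2) := ⟨_, rfl⟩
  obtain ⟨Kb, hKb'⟩ : ∃ Kb, Kb = ∫ z, |secondDiff e z| * ‖z‖ ^ (b - 2) := ⟨_, rfl⟩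
  have hKa : 0 ≤ Ka := hKa' ▸ integral_nonneg fun z => by positivity
  have hKb : 0 ≤ Kb := hKb' ▸ integral_nonneg fun z => by positivity
  refine ⟨C * (Ka + Kb), fun ε R x hx => ?_⟩
  have ia := integrable_secondDiff_mul_rpow h.a_gt h.a_lt hx
  have ib := integrable_secondDiff_mul_rpow h.b_gt h.b_lt hx
  have sa := integral_secondDiff_scaling he hx a fun _ => 1
  have sb := integral_secondDiff_scaling he hx b fun _ => 1
  simp only [one_mul, ← hKa', ← hKb'] at sa sb
  calc |truncated W ε R x| ≤ ∫ y in annulus d ε R, |diffIntegrand W x y| :=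
        abs_integral_le_integral_abs
    _ ≤ ∫ y, |diffIntegrand W x y| :=
        setIntegral_le_integral (integrable_diffIntegrand hW h hx).abs
          (Eventually.of_forall fun y => abs_nonneg _)
    _ ≤ ∫ y, (C * (|secondDiff x y| * ‖y‖ ^ (a - 2)) + C * (|secondDiff x y| * ‖y‖ ^ (b - 2))) := by
        refine integral_mono_ae (integrable_diffIntegrand hW h hx).abs
          ((ia.const_mul C).add (ib.const_mul C)) ?_
        filter_upwards [ae_ne_zero] with y hy
        change |secondDiff x y * lap W y| ≤ _
        rw [abs_mul]
        calc |secondDiff x y| * |lap W y|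
            ≤ |secondDiff x y| * (C * majorant (a - 2) (b - 2) y) := by
              gcongr
              exact (hb y hy).2.2
          _ = _ := by simp only [majorant]; ring
    _ = C * (‖x‖ ^ a * Ka) + C * (‖x‖ ^ b * Kb) := by
        rw [integral_add (ia.const_mul C) (ib.const_mul C), integral_const_mul,
          integral_const_mul, sa, sb]
    _ ≤ C * (Ka + Kb) * majorant a b x := by
        unfold majorant
        have p1 : 0 ≤ ‖x‖ ^ a := by positivity
        have p2 : 0 ≤ ‖x‖ ^ b := by positivity
        have : 0 ≤ C * (‖x‖ ^ a * Kb + ‖x‖ ^ b * Ka) := by positivity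
        linarith

/-- The truncation error, rescaled to a fixed unit vector `e`: the point `x` only enters through its
norm, which makes the error uniform on compact subsets of `ℝᵈ \ {0}`. -/
theorem abs_re_sub_truncated_le [NeZero d] (hW : IsC2OffOrigin W) (hW0 : ∀ x, W (-x) = W x)
    (h : PowerBounds W a b) {e : Space d} (he : ‖e‖ = 1) :
    ∃ C : ℝ, 0 ≤ C ∧ ∀ (ε R : ℝ) (x : Space d), x ≠ 0 → |re W x - truncated W ε R x| ≤
      C * (‖x‖ ^ a *
        ∫ z, outerWeight ε R (‖x‖ * ‖z‖) * (|secondDiff e z| * ‖z‖ ^ (a - 2))) +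
      C * (‖x‖ ^ b *
        ∫ z, outerWeight ε R (‖x‖ * ‖z‖) * (|secondDiff e z| * ‖z‖ ^ (b - 2))) := by
  obtain ⟨C, hC, hb⟩ := h.exists_bound
  refine ⟨C, hC, fun ε R x hx => ?_⟩
  have iD := integrable_diffIntegrand hW h hx
  have hw : ∀ {f : Space d → ℝ}, Integrable f →
      Integrable fun y => outerWeight ε R ‖y‖ * f y := fun {f} hf =>
    hf.bdd_mul (c := 1) ((measurable_outerWeight ε R).comp measurable_norm).aestronglyMeasurable
      (Eventually.of_forall fun y => by
        rw [Real.norm_of_nonneg (outerWeight_nonneg _ _ _)]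
        exact outerWeight_le_one _ _ _)
  have ia := hw (integrable_secondDiff_mul_rpow h.a_gt h.a_lt hx)
  have ib := hw (integrable_secondDiff_mul_rpow h.b_gt h.b_lt hx)
  have e1 : re W x - truncated W ε R x = ∫ y, outerWeight ε R ‖y‖ * diffIntegrand W x y := by
    rw [← integral_diffIntegrand hW hW0 h hx, truncated,
      ← setIntegral_compl (measurableSet_annulus ε R) iD,
      ← integral_indicator (measurableSet_annulus ε R).compl]
    congr 1 with y
    by_cases hy : y ∈ annulus d ε R
    · have : ‖y‖ ∈ Set.Icc ε R := hy
      simp [outerWeight, hy, this]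
    · have : ‖y‖ ∉ Set.Icc ε R := hy
      simp [outerWeight, hy, this]
  rw [← integral_secondDiff_scaling he hx a (outerWeight ε R),
    ← integral_secondDiff_scaling he hx b (outerWeight ε R), ← integral_const_mul,
    ← integral_const_mul, ← integral_add (ia.const_mul C) (ib.const_mul C), e1]
  refine (abs_integral_le_integral_abs).trans
    (integral_mono_ae (hw iD).abs ((ia.const_mul C).add (ib.const_mul C)) ?_)
  filter_upwards [ae_ne_zero] with y hy
  change |outerWeight ε R ‖y‖ * (secondDiff x y * lap W y)| ≤ _
  rw [abs_mul, abs_of_nonneg (outerWeight_nonneg _ _ _), abs_mul]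
  calc outerWeight ε R ‖y‖ * (|secondDiff x y| * |lap W y|)
      ≤ outerWeight ε R ‖y‖ * (|secondDiff x y| * (C * majorant (a - 2) (b - 2) y)) := by
        have := outerWeight_nonneg ε R ‖y‖
        gcongr
        exact (hb y hy).2.2
    _ = _ := by simp only [majorant]; ring

theorem tendstoUniformlyOn_truncated [NeZero d] (hW : IsC2OffOrigin W) (hW0 : ∀ x, W (-x) = W x)
    (h : PowerBounds W a b) {K : Set (Space d)} (hK : IsCompact K) (hK0 : K ⊆ {0}ᶜ) :
    TendstoUniformlyOn (fun p : ℝ × ℝ => truncated W p.1 p.2) (re W) cutoffLimit K := by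
  rcases K.eq_empty_or_nonempty with rfl | hne
  · exact tendstoUniformlyOn_empty
  obtain ⟨e, he⟩ := exists_norm_eq (Space d) zero_le_one
  have he0 : e ≠ 0 := by rintro rfl; simp at he
  obtain ⟨C, hC, hb⟩ := abs_re_sub_truncated_le hW hW0 h he
  obtain ⟨x₀, hx₀, hmin⟩ := hK.exists_isMinOn hne continuous_norm.continuousOn
  obtain ⟨x₁, hx₁, hmax⟩ := hK.exists_isMaxOn hne continuous_norm.continuousOn
  have hs : 0 < ‖x₀‖ := norm_pos_iff.2 (hK0 hx₀)
  have hu : 0 < ‖x₁‖ := norm_pos_iff.2 (hK0 hx₁)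
  have ia := integrable_secondDiff_mul_rpow h.a_gt h.a_lt he0
  have ib := integrable_secondDiff_mul_rpow h.b_gt h.b_lt he0
  have hsc := tendsto_scaled_cutoffLimit hs hu
  have hlim := ((((tendsto_integral_outerWeight ia).comp hsc).const_mul (‖x₀‖ ^ a)).const_mul
    C).add ((((tendsto_integral_outerWeight ib).comp hsc).const_mul (‖x₀‖ ^ b)).const_mul C)
  simp only [mul_zero, add_zero, Function.comp_apply] at hlim
  have key : ∀ c : ℝ, c ≤ 0 → (Integrable fun z => |secondDiff e z| * ‖z‖ ^ (c - 2)) →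
      ∀ p : ℝ × ℝ, ∀ x ∈ K, ‖x‖ ^ c *
        ∫ z, outerWeight p.1 p.2 (‖x‖ * ‖z‖) * (|secondDiff e z| * ‖z‖ ^ (c - 2)) ≤
      ‖x₀‖ ^ c * ∫ z, outerWeight (p.1 / ‖x₀‖) (p.2 / ‖x₁‖) ‖z‖ *
        (|secondDiff e z| * ‖z‖ ^ (c - 2)) := by
    intro c hc ic p x hx
    have hx1 : ‖x₀‖ ≤ ‖x‖ := hmin hx
    have hx2 : ‖x‖ ≤ ‖x₁‖ := hmax hx
    have hnn : ∀ ε R r : ℝ, ∀ z : Space d,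
        0 ≤ outerWeight ε R r * (|secondDiff e z| * ‖z‖ ^ (c - 2)) := fun ε R r z =>
      mul_nonneg (outerWeight_nonneg _ _ _) (by positivity)
    refine mul_le_mul (Real.rpow_le_rpow_of_nonpos hs hx1 hc) ?_
      (integral_nonneg fun z => hnn _ _ _ z) (by positivity)
    refine integral_mono_of_nonneg (Eventually.of_forall fun z => hnn _ _ _ z) ?_
      (Eventually.of_forall fun z => ?_)
    · exact ic.bdd_mul (c := 1)
        ((measurable_outerWeight _ _).comp measurable_norm).aestronglyMeasurable
        (Eventually.of_forall fun y => by
          rw [Real.norm_of_nonneg (outerWeight_nonneg _ _ _)]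
          exact outerWeight_le_one _ _ _)
    · exact mul_le_mul_of_nonneg_right (outerWeight_mul_le hs hx1 hx2 (norm_nonneg z))
        (by positivity)
  rw [Metric.tendstoUniformlyOn_iff]
  intro δ hδ
  filter_upwards [hlim.eventually_lt_const hδ] with p hp x hx
  rw [Real.dist_eq]
  refine (hb p.1 p.2 x (hK0 hx)).trans_lt (lt_of_le_of_lt ?_ hp)
  have ka := key a (h.a_lt.le.trans (min_le_right _ _)) ia p x hx
  have kb := key b (h.b_lt.le.trans (min_le_right _ _)) ib p x hx
  gcongr

theorem aestronglyMeasurable_truncated [NeZero d] (hW : IsC2OffOrigin W) (ε R : ℝ) :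
    AEStronglyMeasurable (truncated W ε R) := by
  have hm := aestronglyMeasurable_lap hW
  have hjoint : StronglyMeasurable fun p : Space d × Space d => secondDiff p.1 p.2 * hm.mk _ p.2 :=
    measurable_secondDiff.stronglyMeasurable.mul
      (hm.stronglyMeasurable_mk.comp_measurable measurable_snd)
  have h := StronglyMeasurable.integral_prod_right (f := fun x y => secondDiff x y * hm.mk _ y)
    hjoint (ν := volume.restrict (annulus d ε R))
  refine h.aestronglyMeasurable.congr (Eventually.of_forall fun x => ?_)
  refine integral_congr_ae (ae_restrict_of_ae ?_)
  filter_upwards [hm.ae_eq_mk] with y hy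
  rw [← hy]
  rfl

theorem tendstoTempered_truncated [NeZero d] (hW : IsC2OffOrigin W) (hW0 : ∀ x, W (-x) = W x)
    (h : PowerBounds W a b) :
    TendstoTempered (fun p : ℝ × ℝ => truncated W p.1 p.2) cutoffLimit (re W) := by
  obtain ⟨C₁, h₁⟩ := abs_truncated_le hW h
  obtain ⟨C₂, hC₂, h₂⟩ := h.exists_bound
  refine tendstoTempered_of_hasMajorant (C := max C₁ C₂) h.a_gt
    (h.a_lt.le.trans (min_le_right _ _)) h.b_gt (h.b_lt.le.trans (min_le_right _ _)) ?_ ?_ ?_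
  · filter_upwards [eventually_cutoffLimit] with p hp
    refine ⟨aestronglyMeasurable_truncated hW _ _, ?_⟩
    filter_upwards [ae_ne_zero] with x hx
    exact (h₁ _ _ x hx).trans
      (mul_le_mul_of_nonneg_right (le_max_left _ _) (majorant_nonneg _ _ _))
  · refine ⟨aestronglyMeasurable_re hW, ?_⟩
    filter_upwards [ae_ne_zero] with x hx
    exact ((h₂ x hx).1).trans
      (mul_le_mul_of_nonneg_right (le_max_right _ _) (majorant_nonneg _ _ _))
  · filter_upwards [ae_ne_zero] with x hx
    exact (tendstoUniformlyOn_truncated hW hW0 h isCompact_singleton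
      (Set.singleton_subset_iff.2 hx)).tendsto_at (Set.mem_singleton x)

end representation

/-! ### The Fourier kernel -/

/-- The kernel `|ξ|⁻² (1 - cos (2π y·ξ))`. -/
noncomputable def fourierKernel (ξ y : Space d) : ℝ :=
  (1 - Real.cos (2 * Real.pi * inner ℝ y ξ)) / ‖ξ‖ ^ 2

theorem fourierKernel_nonneg (ξ y : Space d) : 0 ≤ fourierKernel ξ y :=
  div_nonneg (sub_nonneg.2 (Real.cos_le_one _)) (by positivity)

theorem measurable_fourierKernel :
    Measurable fun p : Space d × Space d => fourierKernel p.1 p.2 := by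
  unfold fourierKernel
  have h : Continuous fun p : Space d × Space d => inner ℝ p.2 p.1 :=
    continuous_snd.inner continuous_fst
  exact ((Real.measurable_cos.comp (h.measurable.const_mul _)).const_sub 1).div
    (measurable_fst.norm.pow_const 2)

theorem continuous_fourierKernel (ξ : Space d) : Continuous (fourierKernel ξ) := by
  unfold fourierKernel
  fun_prop

theorem one_sub_cos_le (ξ y : Space d) :
    1 - Real.cos (2 * Real.pi * inner ℝ y ξ) ≤
      min (2 * Real.pi ^ 2 * (‖ξ‖ * ‖y‖) ^ 2) 2 := by
  refine le_min ?_ (by linarith [Real.neg_one_le_cos (2 * Real.pi * inner ℝ y ξ)])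
  have h1 := Real.one_sub_sq_div_two_le_cos (x := 2 * Real.pi * inner ℝ y ξ)
  have h2 : inner ℝ y ξ ^ 2 ≤ (‖ξ‖ * ‖y‖) ^ 2 := by
    rw [← sq_abs]
    have := abs_real_inner_le_norm y ξ
    rw [mul_comm] at this
    gcongr
  nlinarith [sq_nonneg Real.pi]

/-- The bound `min (C r ^ 2) 2` of `1 - cos` is integrable against the same powers as second
differences of the Newtonian potential. -/
theorem integrable_min_mul_rpow [NeZero d] {c : ℝ} (hc : -(d : ℝ) < c)
    (hc' : c < min (2 - (d : ℝ)) 0) :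
    Integrable fun z : Space d => min (2 * Real.pi ^ 2 * ‖z‖ ^ 2) 2 * ‖z‖ ^ (c - 2) := by
  have hc1 : c < 2 - (d : ℝ) := hc'.trans_le (min_le_left _ _)
  have hmeas : Measurable fun z : Space d =>
      min (2 * Real.pi ^ 2 * ‖z‖ ^ 2) 2 * ‖z‖ ^ (c - 2) := by fun_prop
  have hnn : ∀ z : Space d, 0 ≤ min (2 * Real.pi ^ 2 * ‖z‖ ^ 2) 2 * ‖z‖ ^ (c - 2) := fun z =>
    mul_nonneg (le_min (by positivity) zero_le_two) (by positivity)
  rw [← integrableOn_univ, ← Set.union_compl_self (Metric.ball (0 : Space d) 1)]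
  refine IntegrableOn.union ?_ ?_
  · refine ((integrableOn_ball_norm_rpow hc 1).const_mul (2 * Real.pi ^ 2)).mono'
      hmeas.aestronglyMeasurable ?_
    filter_upwards [ae_restrict_of_ae ae_ne_zero] with z hz
    have hz' : 0 < ‖z‖ := norm_pos_iff.2 hz
    rw [Real.norm_of_nonneg (hnn z)]
    calc min (2 * Real.pi ^ 2 * ‖z‖ ^ 2) 2 * ‖z‖ ^ (c - 2)
        ≤ 2 * Real.pi ^ 2 * ‖z‖ ^ 2 * ‖z‖ ^ (c - 2) := by gcongr; exact min_le_left _ _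
      _ = 2 * Real.pi ^ 2 * ‖z‖ ^ c := by
          rw [mul_assoc, ← Real.rpow_natCast ‖z‖, ← Real.rpow_add hz']
          congr 2; push_cast; ring
  · refine ((integrableOn_compl_ball_norm_rpow (c := c - 2) (by linarith) one_pos).const_mul
      2).mono' hmeas.aestronglyMeasurable (Eventually.of_forall fun z => ?_)
    rw [Real.norm_of_nonneg (hnn z)]
    gcongr
    exact min_le_right _ _

/-- Against a power `‖y‖ ^ (c - 2)`, the Fourier kernel is integrable, and its integral scales like
`‖ξ‖ ^ (-d - c)`. -/
theorem fourierKernel_mul_rpow [NeZero d] {c : ℝ} (hc : -(d : ℝ) < c)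
    (hc' : c < min (2 - (d : ℝ)) 0) {ξ : Space d} (hξ : ξ ≠ 0) :
    Integrable (fun y => fourierKernel ξ y * ‖y‖ ^ (c - 2)) ∧
      ∫ y, fourierKernel ξ y * ‖y‖ ^ (c - 2) ≤ ‖ξ‖ ^ (-(d : ℝ) - c) *
        ∫ z : Space d, min (2 * Real.pi ^ 2 * ‖z‖ ^ 2) 2 * ‖z‖ ^ (c - 2) := by
  have ht : 0 < ‖ξ‖ := norm_pos_iff.2 hξ
  set t := ‖ξ‖ with htdef
  have hI := integrable_min_mul_rpow (d := d) hc hc'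
  have hIt := (hI.comp_smul ht.ne').const_mul (t ^ (2 - c) / t ^ 2)
  have hle : ∀ y : Space d, fourierKernel ξ y * ‖y‖ ^ (c - 2) ≤ t ^ (2 - c) / t ^ 2 *
      (min (2 * Real.pi ^ 2 * ‖t • y‖ ^ 2) 2 * ‖t • y‖ ^ (c - 2)) := by
    intro y
    have h := one_sub_cos_le ξ y
    have e : t ^ (2 - c) * t ^ (c - 2) = 1 := by
      rw [← Real.rpow_add ht]; simp
    rw [norm_smul, Real.norm_of_nonneg ht.le, Real.mul_rpow ht.le (norm_nonneg y)]
    calc fourierKernel ξ y * ‖y‖ ^ (c - 2)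
        ≤ min (2 * Real.pi ^ 2 * (t * ‖y‖) ^ 2) 2 / t ^ 2 * ‖y‖ ^ (c - 2) := by
          unfold fourierKernel; gcongr
      _ = (t ^ (2 - c) * t ^ (c - 2)) *
          (min (2 * Real.pi ^ 2 * (t * ‖y‖) ^ 2) 2 / t ^ 2 * ‖y‖ ^ (c - 2)) := by rw [e, one_mul]
      _ = _ := by ring
  have hint : Integrable fun y => fourierKernel ξ y * ‖y‖ ^ (c - 2) := by
    refine hIt.mono' ((continuous_fourierKernel ξ).measurable.mul
      (measurable_norm_rpow _)).aestronglyMeasurable (Eventually.of_forall fun y => ?_)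
    rw [Real.norm_of_nonneg (mul_nonneg (fourierKernel_nonneg _ _) (by positivity))]
    exact hle y
  refine ⟨hint, (integral_mono hint hIt hle).trans (le_of_eq ?_)⟩
  rw [integral_const_mul, Measure.integral_comp_smul volume
    (fun z : Space d => min (2 * Real.pi ^ 2 * ‖z‖ ^ 2) 2 * ‖z‖ ^ (c - 2)) t,
    finrank_euclideanSpace, Fintype.card_fin, abs_of_pos (by positivity), smul_eq_mul, ← mul_assoc]
  congr 1
  rw [← Real.rpow_natCast, ← Real.rpow_natCast, ← Real.rpow_neg ht.le, ← Real.rpow_sub ht,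
    ← Real.rpow_add ht]
  congr 1
  push_cast
  ring

theorem exists_fourierKernel_bound [NeZero d] {W : Space d → EReal} {a b : ℝ}
    (h : PowerBounds W a b) : ∃ K : ℝ, 0 ≤ K ∧ ∀ ξ : Space d, ξ ≠ 0 →
      Integrable (fun y => fourierKernel ξ y * majorant (a - 2) (b - 2) y) ∧
      ∫ y, fourierKernel ξ y * majorant (a - 2) (b - 2) y ≤
        K * majorant (-(d : ℝ) - a) (-(d : ℝ) - b) ξ := by
  obtain ⟨Ka, hKa'⟩ : ∃ Ka, Ka = ∫ z : Space d,
    min (2 * Real.pi ^ 2 * ‖z‖ ^ 2) 2 * ‖z‖ ^ (a - 2) := ⟨_, rfl⟩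
  obtain ⟨Kb, hKb'⟩ : ∃ Kb, Kb = ∫ z : Space d,
    min (2 * Real.pi ^ 2 * ‖z‖ ^ 2) 2 * ‖z‖ ^ (b - 2) := ⟨_, rfl⟩
  have hnn : ∀ (c : ℝ) (z : Space d),
      0 ≤ min (2 * Real.pi ^ 2 * ‖z‖ ^ 2) 2 * ‖z‖ ^ (c - 2) := fun c z =>
    mul_nonneg (le_min (by positivity) zero_le_two) (by positivity)
  have hKa : 0 ≤ Ka := hKa' ▸ integral_nonneg (hnn a)
  have hKb : 0 ≤ Kb := hKb' ▸ integral_nonneg (hnn b)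
  refine ⟨Ka + Kb, by positivity, fun ξ hξ => ?_⟩
  obtain ⟨ia, ha⟩ := fourierKernel_mul_rpow h.a_gt h.a_lt hξ
  obtain ⟨ib, hb⟩ := fourierKernel_mul_rpow h.b_gt h.b_lt hξ
  rw [← hKa'] at ha
  rw [← hKb'] at hb
  have e : ∀ y, fourierKernel ξ y * majorant (a - 2) (b - 2) y =
      fourierKernel ξ y * ‖y‖ ^ (a - 2) + fourierKernel ξ y * ‖y‖ ^ (b - 2) := fun y => by
    simp only [majorant]; ring
  simp only [e]
  refine ⟨ia.add ib, ?_⟩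
  rw [integral_add ia ib]
  refine (add_le_add ha hb).trans ?_
  unfold majorant
  have p1 : 0 ≤ ‖ξ‖ ^ (-(d : ℝ) - a) := by positivity
  have p2 : 0 ≤ ‖ξ‖ ^ (-(d : ℝ) - b) := by positivity
  nlinarith [mul_nonneg p1 hKb, mul_nonneg p2 hKa]

/-! ### The Fourier transform of the potential -/

/-- The Fourier transform of the potential, `(4π²)⁻¹ ∫ |ξ|⁻² (1 - cos (2π y·ξ)) ΔW(y) dy`. -/
noncomputable def fourierFun (W : Space d → EReal) (ξ : Space d) : ℝ :=
  1 / (4 * Real.pi ^ 2) * ∫ y, fourierIntegrand W ξ y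

section fourier

variable {W : Space d → EReal} {a b : ℝ}

/-- The pointwise Fourier bounds, for an arbitrary weight `F` dominated like `ΔW`. -/
theorem fourierKernel_mul_bound [NeZero d] {F : Space d → ℝ} {C K : ℝ} {ξ : Space d}
    (hF : AEStronglyMeasurable F)
    (hC : ∀ᵐ y, |F y| ≤ C * majorant (a - 2) (b - 2) y)
    (hC0 : 0 ≤ C)
    (hi : Integrable (fun y => fourierKernel ξ y * majorant (a - 2) (b - 2) y))
    (hK : ∫ y, fourierKernel ξ y * majorant (a - 2) (b - 2) y ≤ K) :
    Integrable (fun y => fourierKernel ξ y * F y) ∧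
      |∫ y, fourierKernel ξ y * F y| ≤ C * K := by
  have hle : ∀ᵐ y, ‖fourierKernel ξ y * F y‖ ≤
      C * (fourierKernel ξ y * majorant (a - 2) (b - 2) y) := by
    filter_upwards [hC] with y hy
    rw [norm_mul, Real.norm_of_nonneg (fourierKernel_nonneg _ _), Real.norm_eq_abs]
    have := fourierKernel_nonneg ξ y
    calc fourierKernel ξ y * |F y| ≤ fourierKernel ξ y * (C * majorant (a - 2) (b - 2) y) := by
          gcongr
      _ = _ := by ring
  refine ⟨(hi.const_mul C).mono' ((continuous_fourierKernel ξ).aestronglyMeasurable.mul hF) hle,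
    (norm_integral_le_of_norm_le (hi.const_mul C) hle).trans ?_⟩
  rw [integral_const_mul]
  gcongr

theorem integrable_fourierIntegrand [NeZero d] (hW : IsC2OffOrigin W) (h : PowerBounds W a b)
    {ξ : Space d} (hξ : ξ ≠ 0) : Integrable (fourierIntegrand W ξ) := by
  obtain ⟨K, -, hK⟩ := exists_fourierKernel_bound h
  obtain ⟨C, hC, hb⟩ := h.exists_bound
  exact (fourierKernel_mul_bound (aestronglyMeasurable_lap hW)
    (by filter_upwards [ae_ne_zero] with y hy using (hb y hy).2.2) hC (hK ξ hξ).1 (hK ξ hξ).2).1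

theorem exists_truncatedFourier_bound [NeZero d] (hW : IsC2OffOrigin W) (h : PowerBounds W a b) :
    ∃ C : ℝ, ∀ ξ : Space d, ξ ≠ 0 →
      |fourierFun W ξ| ≤ C * majorant (-(d : ℝ) - a) (-(d : ℝ) - b) ξ ∧
      ∀ ε R : ℝ, |truncatedFourier W ε R ξ| ≤ C * majorant (-(d : ℝ) - a) (-(d : ℝ) - b) ξ := by
  obtain ⟨K, hK0, hK⟩ := exists_fourierKernel_bound h
  obtain ⟨C, hC, hb⟩ := h.exists_bound
  have hp : (0 : ℝ) < 1 / (4 * Real.pi ^ 2) := by positivity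
  refine ⟨1 / (4 * Real.pi ^ 2) * (C * K), fun ξ hξ => ⟨?_, fun ε R => ?_⟩⟩
  · rw [fourierFun, abs_mul, abs_of_pos hp, mul_assoc, mul_assoc]
    gcongr
    exact (fourierKernel_mul_bound (aestronglyMeasurable_lap hW)
      (by filter_upwards [ae_ne_zero] with y hy using (hb y hy).2.2) hC (hK ξ hξ).1
      (hK ξ hξ).2).2
  · rw [truncatedFourier, abs_mul, abs_of_pos hp, mul_assoc, mul_assoc]
    gcongr
    have := (fourierKernel_mul_bound (F := (annulus d ε R).indicator (lap W))
      ((aestronglyMeasurable_lap hW).indicator (measurableSet_annulus ε R))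
      (by
        filter_upwards [ae_ne_zero] with y hy
        refine le_trans ?_ (hb y hy).2.2
        by_cases hy' : y ∈ annulus d ε R <;> simp [hy']) hC (hK ξ hξ).1 (hK ξ hξ).2).2
    rw [← integral_indicator (measurableSet_annulus ε R)]
    refine le_trans (le_of_eq (congrArg _ (integral_congr_ae (Eventually.of_forall fun y => ?_))))
      this
    by_cases hy : y ∈ annulus d ε R <;> simp [hy, fourierKernel, fourierIntegrand]

theorem tendsto_truncatedFourier [NeZero d] (hW : IsC2OffOrigin W) (h : PowerBounds W a b)
    {ξ : Space d} (hξ : ξ ≠ 0) :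
    Tendsto (fun p : ℝ × ℝ => truncatedFourier W p.1 p.2 ξ) cutoffLimit (𝓝 (fourierFun W ξ)) := by
  have hi := integrable_fourierIntegrand hW h hξ
  refine Tendsto.const_mul _ ?_
  simp only [← integral_indicator (measurableSet_annulus _ _)]
  refine tendsto_integral_filter_of_dominated_convergence (fun y => ‖fourierIntegrand W ξ y‖)
    (Eventually.of_forall fun p => hi.1.indicator (measurableSet_annulus _ _))
    (Eventually.of_forall fun p => Eventually.of_forall fun y => norm_indicator_le_norm_self _ _)
    hi.norm ?_
  filter_upwards [ae_ne_zero] with y hy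
  refine tendsto_const_nhds.congr' ?_
  filter_upwards [eventually_mem_annulus hy] with p hp
  rw [Set.indicator_of_mem hp]

theorem aestronglyMeasurable_truncatedFourier [NeZero d] (hW : IsC2OffOrigin W) (ε R : ℝ) :
    AEStronglyMeasurable (truncatedFourier W ε R) := by
  have hm := aestronglyMeasurable_lap hW
  have hjoint : StronglyMeasurable
      fun p : Space d × Space d => fourierKernel p.1 p.2 * hm.mk _ p.2 :=
    measurable_fourierKernel.stronglyMeasurable.mul
      (hm.stronglyMeasurable_mk.comp_measurable measurable_snd)
  have h := StronglyMeasurable.integral_prod_right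
    (f := fun x y => fourierKernel x y * hm.mk _ y) hjoint
    (ν := volume.restrict (annulus d ε R))
  refine (h.aestronglyMeasurable.const_mul (1 / (4 * Real.pi ^ 2))).congr
    (Eventually.of_forall fun x => ?_)
  refine congrArg _ (integral_congr_ae (ae_restrict_of_ae ?_))
  filter_upwards [hm.ae_eq_mk] with y hy
  rw [← hy]
  rfl

theorem aestronglyMeasurable_fourierFun [NeZero d] (hW : IsC2OffOrigin W)
    (h : PowerBounds W a b) : AEStronglyMeasurable (fourierFun W) := by
  have : cutoffLimit.NeBot := by unfold cutoffLimit; infer_instance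
  refine aestronglyMeasurable_of_tendsto_ae cutoffLimit
    (fun p : ℝ × ℝ => aestronglyMeasurable_truncatedFourier hW p.1 p.2) ?_
  filter_upwards [ae_ne_zero] with ξ hξ using tendsto_truncatedFourier hW h hξ

theorem exists_hasMajorant_fourierFun [NeZero d] (hW : IsC2OffOrigin W)
    (h : PowerBounds W a b) : ∃ C : ℝ,
      HasMajorant (-(d : ℝ) - a) (-(d : ℝ) - b) C (fourierFun W) ∧
      ∀ ε R : ℝ, HasMajorant (-(d : ℝ) - a) (-(d : ℝ) - b) C (truncatedFourier W ε R) := by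
  obtain ⟨C, hC⟩ := exists_truncatedFourier_bound hW h
  refine ⟨C, ⟨aestronglyMeasurable_fourierFun hW h, ?_⟩,
    fun ε R => ⟨aestronglyMeasurable_truncatedFourier hW ε R, ?_⟩⟩
  · filter_upwards [ae_ne_zero] with ξ hξ using (hC ξ hξ).1
  · filter_upwards [ae_ne_zero] with ξ hξ using (hC ξ hξ).2 ε R

/-- The exponents of the majorant of the Fourier transform are again locally integrable and
nonpositive. -/
theorem PowerBounds.fourier_exponents (h : PowerBounds W a b) :
    -(d : ℝ) < -(d : ℝ) - a ∧ -(d : ℝ) - a ≤ 0 ∧ -(d : ℝ) < -(d : ℝ) - b ∧ -(d : ℝ) - b ≤ 0 := by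
  have h1 := h.a_gt
  have h2 := h.a_lt.trans_le (min_le_right _ _)
  have h3 := h.b_gt
  have h4 := h.b_lt.trans_le (min_le_right _ _)
  refine ⟨by linarith, by linarith, by linarith, by linarith⟩

theorem tendstoTempered_truncatedFourier [NeZero d] (hW : IsC2OffOrigin W)
    (h : PowerBounds W a b) :
    TendstoTempered (fun p : ℝ × ℝ => truncatedFourier W p.1 p.2) cutoffLimit (fourierFun W) := by
  obtain ⟨C, h1, h2⟩ := exists_hasMajorant_fourierFun hW h
  obtain ⟨e1, e2, e3, e4⟩ := h.fourier_exponents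
  refine tendstoTempered_of_hasMajorant e1 e2 e3 e4 (Eventually.of_forall fun p => h2 p.1 p.2)
    h1 ?_
  filter_upwards [ae_ne_zero] with ξ hξ using tendsto_truncatedFourier hW h hξ

theorem contDiff_one_sub_cos (ξ : Space d) :
    ContDiff ℝ 2 fun y : Space d => 1 - Real.cos (2 * Real.pi * inner ℝ y ξ) :=
  contDiff_const.sub
    (Real.contDiff_cos.comp (contDiff_const.mul (contDiff_id.inner ℝ contDiff_const)))

theorem laplacian_one_sub_cos (ξ x : Space d) :
    Laplacian.laplacian (fun y : Space d => 1 - Real.cos (2 * Real.pi * inner ℝ y ξ)) x =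
      4 * Real.pi ^ 2 * ‖ξ‖ ^ 2 * Real.cos (2 * Real.pi * inner ℝ x ξ) := by
  have hin : ∀ y : Space d, HasFDerivAt (fun y : Space d => 2 * Real.pi * inner ℝ y ξ)
      ((2 * Real.pi) • innerSL ℝ ξ) y := by
    intro y
    have := ((innerSL ℝ ξ).hasFDerivAt (x := y)).const_mul (2 * Real.pi)
    refine this.congr_of_eventuallyEq (Eventually.of_forall fun y => ?_)
    simp [real_inner_comm]
  have h1 : ∀ y v : Space d,
      fderiv ℝ (fun y : Space d => 1 - Real.cos (2 * Real.pi * inner ℝ y ξ)) y v =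
        2 * Real.pi * inner ℝ ξ v * Real.sin (2 * Real.pi * inner ℝ y ξ) := by
    intro y v
    have := ((hin y).cos).const_sub 1
    rw [this.fderiv]
    simp
    ring
  have h2 : ∀ v : Space d, fderiv ℝ (fun y => 2 * Real.pi * inner ℝ ξ v *
      Real.sin (2 * Real.pi * inner ℝ y ξ)) x v =
        4 * Real.pi ^ 2 * Real.cos (2 * Real.pi * inner ℝ x ξ) *
          (inner ℝ ξ v * inner ℝ v ξ) := by
    intro v
    have := ((hin x).sin).const_mul (2 * Real.pi * inner ℝ ξ v)
    rw [this.fderiv]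
    simp [real_inner_comm v ξ]
    ring
  rw [laplacian_eq_sum_fderiv (contDiff_one_sub_cos ξ).contDiffAt]
  simp only [h1, h2]
  rw [← Finset.mul_sum, OrthonormalBasis.sum_inner_mul_inner, real_inner_self_eq_norm_sq]
  ring

theorem fourier_ofReal_of_even {f : Space d → ℝ} (hf : Continuous f) (hfc : HasCompactSupport f)
    (heven : ∀ x, f (-x) = f x) (ξ : Space d) :
    𝓕 (fun x => (f x : ℂ)) ξ =
      ((∫ y, Real.cos (2 * Real.pi * inner ℝ y ξ) * f y : ℝ) : ℂ) := by
  have hsin : ∫ y, Real.sin (2 * Real.pi * inner ℝ y ξ) * f y = 0 := by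
    have h := integral_neg_eq_self (fun y : Space d => Real.sin (2 * Real.pi * inner ℝ y ξ) * f y)
      volume
    simp only [inner_neg_left, mul_neg, Real.sin_neg, heven, neg_mul, integral_neg] at h
    linarith
  have ic : Integrable fun y => Real.cos (2 * Real.pi * inner ℝ y ξ) * f y := by
    refine Continuous.integrable_of_hasCompactSupport ?_ hfc.mul_left
    fun_prop
  have is : Integrable fun y => Real.sin (2 * Real.pi * inner ℝ y ξ) * f y := by
    refine Continuous.integrable_of_hasCompactSupport ?_ hfc.mul_left
    fun_prop
  rw [Real.fourier_eq']
  have e : ∀ y : Space d, Complex.exp (↑(-2 * Real.pi * inner ℝ y ξ) * Complex.I) • (f y : ℂ) =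
      ((Real.cos (2 * Real.pi * inner ℝ y ξ) * f y : ℝ) : ℂ) -
        ((Real.sin (2 * Real.pi * inner ℝ y ξ) * f y : ℝ) : ℂ) * Complex.I := by
    intro y
    rw [show -2 * Real.pi * inner ℝ y ξ = -(2 * Real.pi * inner ℝ y ξ) by ring,
      Complex.exp_mul_I, ← Complex.ofReal_cos, ← Complex.ofReal_sin, Real.cos_neg, Real.sin_neg,
      smul_eq_mul]
    push_cast
    ring
  simp only [e]
  rw [integral_sub ic.ofReal (is.ofReal.mul_const _), integral_mul_const, integral_complex_ofReal,
    integral_complex_ofReal, hsin]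
  simp

/-- The Fourier transform of an even function of class `C²` with compact support, in terms of its
Laplacian. -/
theorem fourier_eq_of_even {f : Space d → ℝ} (hf : ContDiff ℝ 2 f) (hfc : HasCompactSupport f)
    (heven : ∀ x, f (-x) = f x) {ξ : Space d} (hξ : ξ ≠ 0) :
    𝓕 (fun x => (f x : ℂ)) ξ =
      ((1 / (4 * Real.pi ^ 2) * ∫ y, fourierKernel ξ y * Laplacian.laplacian f y : ℝ) : ℂ) := by
  have hξ' : ‖ξ‖ ≠ 0 := norm_ne_zero_iff.2 hξ
  have hgreen := integral_mul_laplacian (contDiff_one_sub_cos ξ) hf hfc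
  simp only [laplacian_one_sub_cos] at hgreen
  have hcos : 1 / (4 * Real.pi ^ 2) * ∫ y, fourierKernel ξ y * Laplacian.laplacian f y =
      ∫ y, Real.cos (2 * Real.pi * inner ℝ y ξ) * f y := by
    have e1 : ∫ y, fourierKernel ξ y * Laplacian.laplacian f y = (‖ξ‖ ^ 2)⁻¹ *
        ∫ y, (1 - Real.cos (2 * Real.pi * inner ℝ y ξ)) * Laplacian.laplacian f y := by
      rw [← integral_const_mul]
      congr 1 with y
      simp only [fourierKernel]; ring
    have e2 : ∫ y, 4 * Real.pi ^ 2 * ‖ξ‖ ^ 2 * Real.cos (2 * Real.pi * inner ℝ y ξ) * f y =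
        4 * Real.pi ^ 2 * ‖ξ‖ ^ 2 * ∫ y, Real.cos (2 * Real.pi * inner ℝ y ξ) * f y := by
      rw [← integral_const_mul]
      congr 1 with y
      ring
    rw [e1, hgreen, e2]
    have := Real.pi_pos
    field_simp
  rw [fourier_ofReal_of_even hf.continuous hfc heven, hcos]

theorem integral_fourier_mul_eq {f : Space d → ℂ} (hf : Integrable f) (φ : 𝓢(Space d, ℂ)) :
    ∫ ξ, 𝓕 f ξ * φ ξ = ∫ x, f x * 𝓕 φ x := by
  have h := VectorFourier.integral_fourierIntegral_smul_eq_flip (L := innerₗ (Space d))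
    (μ := volume) (ν := volume) (f := f) (g := φ) Real.continuous_fourierChar
    continuous_inner hf φ.integrable
  rw [flip_innerₗ] at h
  exact h

/-- The Fourier transform of `W` is `fourierFun W`: this holds for the cut-off potentials, and
passes to the limit by dominated convergence on both sides. -/
theorem hasFourierTransform_re [NeZero d] (hW : IsC2OffOrigin W) (hW0 : ∀ x, W (-x) = W x)
    (h : PowerBounds W a b) : HasFourierTransform (re W) (fourierFun W) := by
  obtain ⟨C, hC, hb⟩ := h.exists_bound
  obtain ⟨Cf, hf, -⟩ := exists_hasMajorant_fourierFun hW h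
  obtain ⟨e1, e2, e3, e4⟩ := h.fourier_exponents
  have ha0 := h.a_lt.le.trans (min_le_right _ _)
  have hb0 := h.b_lt.le.trans (min_le_right _ _)
  have hmaj : HasMajorant a b C (re W) :=
    ⟨aestronglyMeasurable_re hW, by filter_upwards [ae_ne_zero] with x hx using (hb x hx).1⟩
  obtain ⟨T, hT⟩ := hmaj.exists_isGivenBy h.a_gt ha0 h.b_gt hb0
  refine ⟨T, hT, hf.locallyIntegrable e1 e3, hf.integrable_schwartz_mul e1 e2 e3 e4, fun φ => ?_⟩
  rw [TemperedDistribution.fourier_apply, hT.apply_eq]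
  have hlim1 : Tendsto (fun n : ℕ => ∫ x, (cutPotential W n x : ℂ) * 𝓕 φ x) atTop
      (𝓝 (∫ x, 𝓕 φ x * (re W x : ℂ))) := by
    refine tendsto_integral_filter_of_dominated_convergence
      (fun x => C * (‖(𝓕 φ) x‖ * majorant a b x)) ?_ ?_
      ((integrable_schwartz_mul_majorant h.a_gt ha0 h.b_gt hb0 (𝓕 φ)).const_mul C) ?_
    · filter_upwards [eventually_ge_atTop 1] with n hn
      exact ((Complex.continuous_ofReal.comp (contDiff_cutPotential hW hn).continuous).mul
        (𝓕 φ).continuous).aestronglyMeasurable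
    · refine Eventually.of_forall fun n => ?_
      filter_upwards [ae_ne_zero] with x hx
      rw [norm_mul, Complex.norm_real, Real.norm_eq_abs]
      have := (abs_cutPotential_le (W := W) n x).trans (hb x hx).1
      calc |cutPotential W n x| * ‖(𝓕 φ) x‖ ≤ C * majorant a b x * ‖(𝓕 φ) x‖ := by gcongr
        _ = _ := by ring
    · filter_upwards [ae_ne_zero] with x hx
      refine tendsto_const_nhds.congr' ?_
      filter_upwards [eventually_cutPotential_eq (W := W) hx] with n hn
      rw [hn.eq_of_nhds, mul_comm]
  obtain ⟨K, hK0, hK⟩ := exists_fourierKernel_bound h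
  obtain ⟨L, hL, hLb⟩ := exists_laplacian_cutPotential_bound hW h
  have hlim2 : Tendsto (fun n : ℕ => ∫ ξ, 𝓕 (fun x => (cutPotential W n x : ℂ)) ξ * φ ξ) atTop
      (𝓝 (∫ ξ, φ ξ * (fourierFun W ξ : ℂ))) := by
    refine tendsto_integral_filter_of_dominated_convergence
      (fun ξ => 1 / (4 * Real.pi ^ 2) * (L * K) *
        (‖φ ξ‖ * majorant (-(d : ℝ) - a) (-(d : ℝ) - b) ξ)) ?_ ?_
      ((integrable_schwartz_mul_majorant e1 e2 e3 e4 φ).const_mul _) ?_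
    · filter_upwards [eventually_ge_atTop 1] with n hn
      have hc : Integrable fun x => (cutPotential W n x : ℂ) :=
        ((contDiff_cutPotential hW hn).continuous.integrable_of_hasCompactSupport
          (hasCompactSupport_cutPotential hn)).ofReal
      exact ((VectorFourier.fourierIntegral_continuous Real.continuous_fourierChar
        continuous_inner hc).mul φ.continuous).aestronglyMeasurable
    · filter_upwards [eventually_ge_atTop 1] with n hn
      filter_upwards [ae_ne_zero] with ξ hξ
      rw [fourier_eq_of_even (contDiff_cutPotential hW hn) (hasCompactSupport_cutPotential hn)
        (cutPotential_neg hW0 n) hξ, norm_mul, Complex.norm_real, Real.norm_eq_abs, abs_mul,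
        abs_of_pos (by positivity)]
      have := (fourierKernel_mul_bound
        (continuous_laplacian (contDiff_cutPotential hW hn)).aestronglyMeasurable
        (by filter_upwards [ae_ne_zero] with y hy using hLb n y hy) hL (hK ξ hξ).1
        (hK ξ hξ).2).2
      calc 1 / (4 * Real.pi ^ 2) *
            |∫ y, fourierKernel ξ y * Laplacian.laplacian (cutPotential W n) y| * ‖φ ξ‖
          ≤ 1 / (4 * Real.pi ^ 2) *
            (L * (K * majorant (-(d : ℝ) - a) (-(d : ℝ) - b) ξ)) * ‖φ ξ‖ := by gcongr
        _ = _ := by ring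
    · filter_upwards [ae_ne_zero] with ξ hξ
      rw [mul_comm (φ ξ)]
      refine Tendsto.mul_const _ ?_
      have hint : Tendsto (fun n : ℕ => ∫ y, fourierKernel ξ y *
          Laplacian.laplacian (cutPotential W n) y) atTop (𝓝 (∫ y, fourierIntegrand W ξ y)) := by
        refine tendsto_integral_filter_of_dominated_convergence
          (fun y => L * (fourierKernel ξ y * majorant (a - 2) (b - 2) y)) ?_ ?_
          ((hK ξ hξ).1.const_mul L) ?_
        · filter_upwards [eventually_ge_atTop 1] with n hn
          exact ((continuous_fourierKernel ξ).mul
            (continuous_laplacian (contDiff_cutPotential hW hn))).aestronglyMeasurable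
        · refine Eventually.of_forall fun n => ?_
          filter_upwards [ae_ne_zero] with y hy
          have hk := fourierKernel_nonneg ξ y
          rw [norm_mul, Real.norm_of_nonneg hk, Real.norm_eq_abs]
          calc fourierKernel ξ y * |Laplacian.laplacian (cutPotential W n) y|
              ≤ fourierKernel ξ y * (L * majorant (a - 2) (b - 2) y) := by
                gcongr
                exact hLb n y hy
            _ = _ := by ring
        · filter_upwards [ae_ne_zero] with y hy
          refine tendsto_const_nhds.congr' ?_
          filter_upwards [eventually_laplacian_cutPotential_eq (W := W) hy] with n hn
          rw [hn]
          rfl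
      refine ((Complex.continuous_ofReal.tendsto _).comp
        (hint.const_mul (1 / (4 * Real.pi ^ 2)))).congr' ?_
      filter_upwards [eventually_ge_atTop 1] with n hn
      rw [fourier_eq_of_even (contDiff_cutPotential hW hn) (hasCompactSupport_cutPotential hn)
        (cutPotential_neg hW0 n) hξ]
      rfl
  refine tendsto_nhds_unique hlim1 (hlim2.congr' ?_)
  filter_upwards [eventually_ge_atTop 1] with n hn
  have hc : Integrable fun x => (cutPotential W n x : ℂ) :=
    ((contDiff_cutPotential hW hn).continuous.integrable_of_hasCompactSupport
      (hasCompactSupport_cutPotential hn)).ofReal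
  rw [integral_fourier_mul_eq hc]

/-- A positive Laplacian makes the Fourier transform positive, since `1 - cos` is nonnegative and
does not vanish identically. -/
theorem fourierFun_pos [NeZero d] (hW : IsC2OffOrigin W) (h : PowerBounds W a b)
    (hpos : ∀ x, x ≠ 0 → 0 < lap W x) {ξ : Space d} (hξ : ξ ≠ 0) : 0 < fourierFun W ξ := by
  have hi := integrable_fourierIntegrand hW h hξ
  have hnn : 0 ≤ᵐ[volume] fourierIntegrand W ξ := by
    filter_upwards [ae_ne_zero] with y hy
    exact mul_nonneg (fourierKernel_nonneg ξ y) (hpos y hy).le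
  have hξ' : 0 < ‖ξ‖ := norm_pos_iff.2 hξ
  refine mul_pos (by positivity) (lt_of_le_of_ne (integral_nonneg_of_ae hnn) fun h0 => ?_)
  have hz := (integral_eq_zero_iff_of_nonneg_ae hnn hi).1 h0.symm
  have hk : fourierKernel ξ =ᵐ[volume] fun _ => 0 := by
    filter_upwards [ae_ne_zero, hz] with y hy hy0
    exact (mul_eq_zero.1 hy0).resolve_right (hpos y hy).ne'
  have hk' := (continuous_fourierKernel ξ).ae_eq_iff_eq volume continuous_const |>.1 hk
  have h1 := congrFun hk' ((1 / (2 * ‖ξ‖ ^ 2)) • ξ)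
  have h2 : 2 * Real.pi * inner ℝ ((1 / (2 * ‖ξ‖ ^ 2)) • ξ) ξ = Real.pi := by
    rw [inner_smul_left, real_inner_self_eq_norm_sq]
    simp
    field_simp
  rw [fourierKernel, h2, Real.cos_pi] at h1
  have : (1 - (-1 : ℝ)) / ‖ξ‖ ^ 2 > 0 := by positivity
  linarith

end fourier

/-! ### Mollifiers with nonnegative Fourier transform -/

open scoped Convolution ContDiff

/-- The Fourier transform `∫ cos (2π y·ξ) k(y) dy` of an even integrable function `k`. -/
noncomputable def cosTransform (k : Space d → ℝ) (ξ : Space d) : ℝ :=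
  ∫ y, Real.cos (2 * Real.pi * inner ℝ y ξ) * k y

/-- `k` is a smooth even probability density supported in the ball of radius `ρ`, bounded by `M`
times the uniform density of that ball, with nonnegative Fourier transform. -/
structure IsMollifier (M ρ : ℝ) (k : Space d → ℝ) : Prop where
  contDiff : ContDiff ℝ ∞ k
  nonneg : ∀ x, 0 ≤ k x
  support_subset : Function.support k ⊆ Metric.ball 0 ρ
  integral_eq_one : ∫ x, k x = 1
  even : ∀ x, k (-x) = k x
  le : ∀ x, k x ≤ M / volume.real (Metric.ball (0 : Space d) ρ)
  cosTransform_nonneg : ∀ ξ, 0 ≤ cosTransform k ξ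

/-- The convolution square of an even bump function is a mollifier: its Fourier transform is the
square of a real number. -/
theorem exists_isMollifier (d : ℕ) [NeZero d] {ρ : ℝ} (hρ : 0 < ρ) :
    ∃ k : Space d → ℝ, IsMollifier (4 ^ d) ρ k := by
  -- the factor `4 ^ d` is the ratio of the volumes of the balls of radius `ρ` and `ρ / 4`
  let β : ContDiffBump (0 : Space d) := ⟨ρ / 4, ρ / 2, by positivity, by linarith⟩
  obtain ⟨κ, hκ⟩ : ∃ κ : Space d → ℝ, κ = β.normed volume := ⟨_, rfl⟩
  have hnn : ∀ x, 0 ≤ κ x := fun x => hκ ▸ β.nonneg_normed x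
  have hint : Integrable κ := hκ ▸ β.integrable_normed
  have hone : ∫ x, κ x = 1 := hκ ▸ β.integral_normed
  have heven : ∀ x, κ (-x) = κ x := fun x => hκ ▸ β.normed_neg x
  have hcs : HasCompactSupport κ := hκ ▸ β.hasCompactSupport_normed
  have hcont : Continuous κ := hκ ▸ β.continuous_normed
  have hsup : Function.support κ = Metric.ball 0 (ρ / 2) := hκ ▸ β.support_normed_eq
  have hsm : ContDiff ℝ ∞ κ := hκ ▸ β.contDiff_normed
  have hle : ∀ x, κ x ≤ 4 ^ d / volume.real (Metric.ball (0 : Space d) ρ) := fun x => by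
    have h := β.normed_le_div_measure_closedBall_rOut volume 2 (by
      change ρ / 2 ≤ 2 * (ρ / 4); linarith) x
    rw [← hκ] at h
    refine h.trans (le_of_eq ?_)
    change 2 ^ _ / volume.real (Metric.closedBall (0 : Space d) (ρ / 2)) = _
    rw [← Measure.addHaar_real_closedBall_eq_addHaar_real_ball,
      Measure.addHaar_real_closedBall' _ _ (by positivity),
      Measure.addHaar_real_closedBall' _ _ hρ.le, finrank_euclideanSpace_fin, div_pow,
      show (4 : ℝ) = 2 * 2 by norm_num, mul_pow]
    field_simp
  have hk : ∀ x, (κ ⋆[ContinuousLinearMap.lsmul ℝ ℝ, volume] κ) x = ∫ t, κ t * κ (x - t) :=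
    fun x => rfl
  have hkcs : HasCompactSupport (κ ⋆[ContinuousLinearMap.lsmul ℝ ℝ, volume] κ) :=
    hcs.convolution _ hcs
  have hksm : ContDiff ℝ ∞ (κ ⋆[ContinuousLinearMap.lsmul ℝ ℝ, volume] κ) :=
    hcs.contDiff_convolution_right _ hint.locallyIntegrable hsm
  have hkeven : ∀ x, (κ ⋆[ContinuousLinearMap.lsmul ℝ ℝ, volume] κ) (-x) =
      (κ ⋆[ContinuousLinearMap.lsmul ℝ ℝ, volume] κ) x := fun x => by
    rw [hk, hk, ← integral_neg_eq_self]
    congr 1 with t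
    rw [heven, ← heven (x - t)]
    congr 2; abel
  refine ⟨_, hksm, fun x => ?_, ?_, ?_, hkeven, fun x => ?_, fun ξ => ?_⟩
  · rw [hk]
    exact integral_nonneg fun t => mul_nonneg (hnn _) (hnn _)
  · refine (support_convolution_subset _).trans ?_
    rw [hsup]
    intro z hz
    obtain ⟨x, hx, y, hy, rfl⟩ := Set.mem_add.1 hz
    rw [mem_ball_zero_iff] at hx hy ⊢
    linarith [norm_add_le x y]
  · rw [integral_convolution _ hint hint, hone]
    simp
  · rw [hk]
    calc ∫ t, κ t * κ (x - t)
        ≤ ∫ t, κ t * (4 ^ d / volume.real (Metric.ball (0 : Space d) ρ)) := by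
          refine integral_mono ?_ (hint.mul_const _) fun t =>
            mul_le_mul_of_nonneg_left (hle _) (hnn t)
          exact (hcont.mul (hcont.comp (continuous_const.sub continuous_id)))
            |>.integrable_of_hasCompactSupport hcs.mul_right
      _ = _ := by rw [integral_mul_const, hone, one_mul]
  · have hsq : ((cosTransform (κ ⋆[ContinuousLinearMap.lsmul ℝ ℝ, volume] κ) ξ : ℝ) : ℂ) =
        ((cosTransform κ ξ * cosTransform κ ξ : ℝ) : ℂ) := by
      have h := Real.fourier_mul_convolution_eq (f₁ := fun x => (κ x : ℂ))
        (f₂ := fun x => (κ x : ℂ)) hint.ofReal hint.ofReal ξ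
      rw [fourier_ofReal_of_even hcont hcs heven] at h
      rw [Complex.ofReal_mul]
      unfold cosTransform at *
      rw [← h, ← fourier_ofReal_of_even hksm.continuous hkcs hkeven]
      refine congrArg (fun F : Space d → ℂ => 𝓕 F ξ) (funext fun x => ?_)
      rw [hk, ← integral_complex_ofReal]
      simp only [Complex.ofReal_mul]
      rfl
    rw [Complex.ofReal_inj.1 hsq]
    exact mul_self_nonneg _

namespace IsMollifier

variable {M ρ : ℝ} {k : Space d → ℝ}

theorem hasCompactSupport (hk : IsMollifier M ρ k) : HasCompactSupport k :=
  HasCompactSupport.of_support_subset_isCompact (isCompact_closedBall 0 ρ)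
    (hk.support_subset.trans Metric.ball_subset_closedBall)

theorem integrable_mul (hk : IsMollifier M ρ k) {f : Space d → ℝ} (hf : LocallyIntegrable f)
    (x : Space d) : Integrable fun t => k t * f (x - t) := by
  have h := hk.hasCompactSupport.convolutionExists_left (L := ContinuousLinearMap.lsmul ℝ ℝ)
    (μ := volume) hk.contDiff.continuous hf x
  exact h

theorem integrable (hk : IsMollifier M ρ k) : Integrable k :=
  hk.contDiff.continuous.integrable_of_hasCompactSupport hk.hasCompactSupport

theorem le_integral_mul (hk : IsMollifier M ρ k) {f : Space d → ℝ} (hf : LocallyIntegrable f)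
    {m : ℝ} (hm : ∀ x, m ≤ f x) (x : Space d) : m ≤ ∫ t, k t * f (x - t) := by
  calc m = ∫ t, k t * m := by rw [integral_mul_const, hk.integral_eq_one, one_mul]
    _ ≤ _ := integral_mono (hk.integrable.mul_const _) (hk.integrable_mul hf x) fun t =>
      mul_le_mul_of_nonneg_left (hm _) (hk.nonneg t)

end IsMollifier

/-- Averages against mollifiers concentrating at the origin converge at points of continuity. -/
theorem tendsto_integral_mollifier {M : ℝ} {ρ : ℕ → ℝ} {k : ℕ → Space d → ℝ}
    (hk : ∀ n, IsMollifier M (ρ n) (k n)) (hρ : Tendsto ρ atTop (𝓝 0)) {f : Space d → ℝ}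
    (hf : AEStronglyMeasurable f) {x : Space d} (hx : ContinuousAt f x) :
    Tendsto (fun n => ∫ t, k n t * f (x - t)) atTop (𝓝 (f x)) := by
  refine convolution_tendsto_right (φ := k) (g := fun _ => f) (k := fun _ => x) (μ := volume)
    (Eventually.of_forall fun n => (hk n).nonneg)
    (Eventually.of_forall fun n => (hk n).integral_eq_one) ?_ (Eventually.of_forall fun _ => hf)
    (hx.tendsto.comp tendsto_snd) tendsto_const_nhds
  rw [Metric.nhds_basis_ball.smallSets.tendsto_right_iff]
  intro ε hε
  filter_upwards [hρ.eventually (gt_mem_nhds hε)] with n hn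
  exact (hk n).support_subset.trans (Metric.ball_subset_ball hn.le)

theorem tendsto_cosTransform_mollifier {M : ℝ} {ρ : ℕ → ℝ} {k : ℕ → Space d → ℝ}
    (hk : ∀ n, IsMollifier M (ρ n) (k n)) (hρ : Tendsto ρ atTop (𝓝 0)) (ξ : Space d) :
    Tendsto (fun n => cosTransform (k n) ξ) atTop (𝓝 1) := by
  have hc : Continuous fun y : Space d => Real.cos (2 * Real.pi * inner ℝ y ξ) := by fun_prop
  have h := tendsto_integral_mollifier hk hρ hc.aestronglyMeasurable (x := 0) hc.continuousAt
  simp only [inner_zero_left, mul_zero, Real.cos_zero, zero_sub, inner_neg_left, mul_neg,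
    Real.cos_neg] at h
  refine h.congr fun n => ?_
  simp only [cosTransform, mul_comm]

/-- Mollification of a function whose Fourier transform is a function. -/
theorem HasFourierTransform.integral_mollifier_mul {M ρ : ℝ} {k f g : Space d → ℝ}
    (hk : IsMollifier M ρ k) (h : HasFourierTransform f g) :
    Integrable (fun ξ => cosTransform k ξ * g ξ) ∧ ∀ x, ∫ t, k t * f (x - t) =
      ∫ ξ, cosTransform k ξ * g ξ * Real.cos (2 * Real.pi * inner ℝ x ξ) := by
  obtain ⟨T, hT, hg⟩ := h
  -- the test function is the inverse Fourier transform of the mollifier centred at `x`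
  have key : ∀ x : Space d, ∃ φ : 𝓢(Space d, ℂ),
      (∀ z, 𝓕 φ z = ((k (x - z) : ℝ) : ℂ)) ∧
      ∀ ξ, φ ξ =
        Complex.exp (↑(2 * Real.pi * inner ℝ x ξ) * Complex.I) * (cosTransform k ξ : ℂ) := by
    intro x
    have hs : HasCompactSupport fun z => ((k (z - x) : ℝ) : ℂ) :=
      (hk.hasCompactSupport.comp_homeomorph (Homeomorph.subRight x)).comp_left
        (g := Complex.ofReal) Complex.ofReal_zero
    have hsm : ContDiff ℝ ∞ fun z => ((k (z - x) : ℝ) : ℂ) :=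
      Complex.ofRealCLM.contDiff.comp (hk.contDiff.comp (contDiff_id.sub contDiff_const))
    refine ⟨𝓕⁻ (hs.toSchwartzMap hsm), fun z => ?_, fun ξ => ?_⟩
    · rw [FourierTransform.fourier_fourierInv_eq]
      simp only [HasCompactSupport.toSchwartzMap_toFun]
      rw [← hk.even, neg_sub]
    · rw [SchwartzMap.fourierInv_coe, Real.fourierInv_eq']
      simp only [HasCompactSupport.toSchwartzMap_toFun]
      rw [← integral_add_right_eq_self _ x]
      have hf := fourier_ofReal_of_even hk.contDiff.continuous hk.hasCompactSupport hk.even (-ξ)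
      rw [Real.fourier_eq'] at hf
      have hc : cosTransform k ξ =
          ∫ y, Real.cos (2 * Real.pi * inner ℝ y (-ξ)) * k y := by
        simp [cosTransform]
      rw [hc, ← hf, ← integral_const_mul]
      congr 1 with v
      simp only [add_sub_cancel_right, smul_eq_mul, ← mul_assoc]
      rw [← Complex.exp_add]
      congr 2
      simp only [inner_add_left, inner_neg_right]
      push_cast
      ring
  constructor
  · obtain ⟨φ, -, hφ⟩ := key 0
    have := (hg.integrable φ).re
    refine this.congr (Eventually.of_forall fun ξ => ?_)
    simp [hφ]
  · intro x
    obtain ⟨φ, hφ1, hφ⟩ := key x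
    have h1 := hg.apply_eq φ
    rw [TemperedDistribution.fourier_apply, hT.apply_eq] at h1
    simp only [hφ1, ← Complex.ofReal_mul] at h1
    rw [integral_complex_ofReal] at h1
    have h2 := congrArg Complex.re h1
    rw [Complex.ofReal_re, ← RCLike.re_eq_complex_re, ← integral_re (hg.integrable φ)] at h2
    have h3 : ∫ t, k t * f (x - t) = ∫ z, k (x - z) * f z := by
      rw [← integral_sub_left_eq_self (fun z => k (x - z) * f z) volume x]
      simp
    rw [h3, h2]
    congr 1 with ξ
    rw [hφ, Complex.exp_mul_I, ← Complex.ofReal_cos, ← Complex.ofReal_sin]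
    generalize Real.cos _ = c, Real.sin _ = s
    simp
    ring

/-! ### Mollified potentials -/

section mollified

variable {W : Space d → EReal}

theorem measurable_re (hW : W0 W) : Measurable (re W) :=
  measurable_ereal_toReal.comp hW.lowerSemicontinuous.measurable

theorem W0.ne_bot (hW : W0 W) (x : Space d) : W x ≠ ⊥ := by
  obtain ⟨m, hm⟩ := hW.boundedBelow
  intro h
  have := hm x
  rw [h] at this
  simp at this

theorem W0.exists_neg_le_re (hW : W0 W) : ∃ c : ℝ, 0 ≤ c ∧ ∀ x, -c ≤ re W x := by
  obtain ⟨m, hm⟩ := hW.boundedBelow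
  -- the bound has to be nonpositive, since `re W` vanishes where `W` is infinite
  refine ⟨max (-m) 0, le_max_right _ _, fun x => ?_⟩
  have h0 : -max (-m) 0 ≤ min m 0 := by
    rcases le_total m 0 with h | h <;> simp [h]
  refine h0.trans ?_
  by_cases hx : W x = ⊤
  · simp [re, hx]
  · refine (min_le_left _ _).trans ?_
    have := hm x
    rw [← EReal.coe_toReal hx (hW.ne_bot x)] at this
    exact_mod_cast this

theorem EssentiallyConvex.continuousAt_re (hW : EssentiallyConvex W) {x : Space d}
    (hx : W x ≠ ⊤) : ContinuousAt (re W) x := by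
  by_cases h : x = 0
  · subst h
    rw [← continuousWithinAt_compl_self]
    exact (EReal.tendsto_toReal hx (hW.w0.ne_bot 0)).comp hW.w1.tendsto_zero
  · exact hW.c2.contDiffOn.continuousOn.continuousAt (isOpen_compl_singleton.mem_nhds h)

/-- Mollification of an essentially convex potential is controlled by the potential itself: near the
origin by the averaging condition, and away from it since the potential is bounded there. -/
theorem EssentiallyConvex.exists_mollified_le [NeZero d] (hW : EssentiallyConvex W) {M : ℝ}
    (hM : 0 ≤ M) : ∃ A B : ℝ, 0 ≤ A ∧ 0 ≤ B ∧ ∀ (ρ : ℝ) (k : Space d → ℝ), 0 < ρ → ρ < 1 →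
      IsMollifier M ρ k → ∀ x, W x ≠ ⊤ → |∫ t, k t * re W (x - t)| ≤ A + B * |re W x| := by
  obtain ⟨c, hc, hcb⟩ := hW.w0.exists_neg_le_re
  obtain ⟨C₁, C₂, hC₂, havg⟩ := hW.w1.average_le 2 two_pos
  obtain ⟨a, b, h⟩ := hW.powerBounds
  obtain ⟨C, hC, hb⟩ := h.exists_bound
  refine ⟨2 * C + M * |C₁| + M * c + c, M * C₂, by positivity, by positivity,
    fun ρ k hρ hρ1 hk x hx => ?_⟩
  have hloc := hW.w0.locallyIntegrable
  have hint := hk.integrable_mul hloc x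
  have hkint := hk.integrable
  have hlow := hk.le_integral_mul hloc hcb x
  have hup : ∫ t, k t * re W (x - t) ≤ 2 * C + M * |C₁| + M * c + M * C₂ * |re W x| := by
    by_cases hx2 : ‖x‖ < 2
    · have hv : 0 < volume.real (Metric.ball (0 : Space d) ρ) := by
        rw [measureReal_def]
        exact ENNReal.toReal_pos (Metric.measure_ball_pos _ _ hρ).ne' measure_ball_lt_top.ne
      have hvx : volume.real (Metric.ball x ρ) = volume.real (Metric.ball (0 : Space d) ρ) := by
        simp only [measureReal_def, Measure.addHaar_ball_center]
      have hWx := havg x ρ hx2 hρ hρ1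
      rw [← EReal.coe_toReal hx (hW.w0.ne_bot x)] at hWx
      have hWx' : (⨍ y in Metric.ball x ρ, re W y) ≤ C₁ + C₂ * re W x := by exact_mod_cast hWx
      rw [setAverage_eq, smul_eq_mul, hvx] at hWx'
      have hball : IntegrableOn (re W) (Metric.ball x ρ) :=
        (hloc.integrableOn_isCompact (isCompact_closedBall x ρ)).mono_set
          Metric.ball_subset_closedBall
      have e : ∫ t, k t * (re W (x - t) + c) = (∫ t, k t * re W (x - t)) + c := by
        simp only [mul_add]
        rw [integral_add hint (hkint.mul_const c), integral_mul_const, hk.integral_eq_one, one_mul]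
      have e2 : ∫ t, k t * (re W (x - t) + c) ≤
          M / volume.real (Metric.ball (0 : Space d) ρ) *
            ∫ y in Metric.ball x ρ, (re W y + c) := by
        rw [← integral_const_mul, ← integral_sub_left_eq_self _ volume x,
          ← integral_indicator measurableSet_ball]
        refine integral_mono_of_nonneg (Eventually.of_forall fun y => ?_) ?_
          (Eventually.of_forall fun y => ?_)
        · have := hcb (x - (x - y))
          exact mul_nonneg (hk.nonneg _) (by linarith)
        · rw [integrable_indicator_iff measurableSet_ball]
          exact (hball.add (integrableOn_const measure_ball_lt_top.ne)).const_mul _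
        · have h1 : 0 ≤ re W y + c := by linarith [hcb y]
          by_cases hy : y ∈ Metric.ball x ρ
          · simp only [Set.indicator_of_mem hy, sub_sub_cancel]
            exact mul_le_mul_of_nonneg_right (hk.le _) h1
          · simp only [Set.indicator_of_notMem hy]
            have : k (x - y) = 0 := by
              by_contra hne
              have := hk.support_subset hne
              rw [mem_ball_zero_iff, ← dist_eq_norm, dist_comm] at this
              exact hy this
            rw [this, zero_mul]
      rw [integral_add hball (integrableOn_const measure_ball_lt_top.ne), setIntegral_const, hvx,
        smul_eq_mul] at e2
      have e3 : M / volume.real (Metric.ball (0 : Space d) ρ) *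
          ((∫ y in Metric.ball x ρ, re W y) + volume.real (Metric.ball (0 : Space d) ρ) * c) =
          M * ((volume.real (Metric.ball (0 : Space d) ρ))⁻¹ * ∫ y in Metric.ball x ρ, re W y) +
            M * c := by
        field_simp
      rw [e3, e] at e2
      have e4 := mul_le_mul_of_nonneg_left hWx' hM
      have e5 := mul_le_mul_of_nonneg_left (le_abs_self C₁) hM
      have e6 := mul_le_mul_of_nonneg_left (le_abs_self (re W x)) (mul_nonneg hM hC₂.le)
      linarith
    · have hfar : ∀ t, k t * re W (x - t) ≤ k t * (2 * C) := fun t => by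
        by_cases ht : k t = 0
        · simp [ht]
        · have ht' : ‖t‖ < ρ := by simpa using hk.support_subset ht
          have h1 : 1 ≤ ‖x - t‖ := by
            have := norm_sub_norm_le x t
            linarith
          have hne : x - t ≠ 0 := norm_pos_iff.1 (by linarith)
          refine mul_le_mul_of_nonneg_left ?_ (hk.nonneg t)
          have h2 := majorant_le_two (h.a_lt.le.trans (min_le_right _ _))
            (h.b_lt.le.trans (min_le_right _ _)) h1
          calc re W (x - t) ≤ |re W (x - t)| := le_abs_self _
            _ ≤ C * majorant a b (x - t) := (hb _ hne).1
            _ ≤ C * 2 := by gcongr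
            _ = 2 * C := mul_comm _ _
      have := integral_mono hint (hkint.mul_const (2 * C)) hfar
      rw [integral_mul_const, hk.integral_eq_one, one_mul] at this
      have h1 : 0 ≤ M * |C₁| + M * c + M * C₂ * |re W x| := by positivity
      linarith
  rw [abs_le]
  have h1 : 0 ≤ 2 * C + M * |C₁| + M * c + M * C₂ * |re W x| := by positivity
  constructor <;> linarith

end mollified

/-! ### The energy of a mollified potential -/

/-- The squared modulus of the Fourier transform of `p - q`. -/
noncomputable def charDiff (p q : Measure (Space d)) (ξ : Space d) : ℝ :=
  ‖charFun p ((2 * Real.pi) • ξ) - charFun q ((2 * Real.pi) • ξ)‖ ^ 2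

theorem charDiff_nonneg (p q : Measure (Space d)) (ξ : Space d) : 0 ≤ charDiff p q ξ := sq_nonneg _

section energy

variable {p q : Measure (Space d)} [IsFiniteMeasure p] [IsFiniteMeasure q]

theorem continuous_charDiff : Continuous (charDiff p q) := by
  have h1 : Continuous (charFun p) := continuous_charFun
  have h2 : Continuous (charFun q) := continuous_charFun
  unfold charDiff
  fun_prop

/-- Distinct finite measures have distinct Fourier transforms, on a set of positive measure. -/
theorem not_charDiff_ae_eq_zero (h : p ≠ q) : ¬ charDiff p q =ᵐ[volume] 0 := fun h0 => by
  have h1 : charDiff p q = 0 :=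
    (Continuous.ae_eq_iff_eq volume continuous_charDiff continuous_zero).1 h0
  refine h (Measure.ext_of_charFun (funext fun t => ?_))
  have h2 := congrFun h1 ((2 * Real.pi)⁻¹ • t)
  have hpi : 2 * Real.pi ≠ 0 := by positivity
  simp only [charDiff, smul_smul, mul_inv_cancel₀ hpi, one_smul, Pi.zero_apply] at h2
  simpa [sub_eq_zero] using h2

theorem re_charFun_mul_conj (t : Space d) :
    (charFun p t * (starRingEnd ℂ) (charFun q t)).re =
      ∫ z, Real.cos (inner ℝ (z.1 - z.2) t) ∂(p.prod q) := by
  rw [← charFun_neg, charFun_apply, charFun_apply, ← integral_prod_mul]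
  have e : ∀ z : Space d × Space d, Complex.exp (inner ℝ z.1 t * Complex.I) *
      Complex.exp (inner ℝ z.2 (-t) * Complex.I) =
      Complex.exp ((inner ℝ (z.1 - z.2) t : ℝ) * Complex.I) := fun z => by
    rw [← Complex.exp_add, inner_sub_left, inner_neg_right]
    congr 1
    push_cast
    ring
  simp only [e]
  have hi : Integrable (fun z : Space d × Space d =>
      Complex.exp ((inner ℝ (z.1 - z.2) t : ℝ) * Complex.I)) (p.prod q) := by
    refine Integrable.of_bound (C := 1) (by fun_prop) (Eventually.of_forall fun z => ?_)
    rw [Complex.norm_exp_ofReal_mul_I]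
  rw [← RCLike.re_eq_complex_re, ← integral_re hi]
  simp only [RCLike.re_eq_complex_re, Complex.exp_ofReal_mul_I_re]

theorem integrable_cos_prod (t : Space d) (ν : Measure (Space d × Space d)) [IsFiniteMeasure ν] :
    Integrable (fun z : Space d × Space d => Real.cos (inner ℝ (z.1 - z.2) t)) ν :=
  Integrable.of_bound (C := 1) (by fun_prop)
    (Eventually.of_forall fun z => by simpa using Real.abs_cos_le_one _)

theorem charDiff_eq (ξ : Space d) : charDiff p q ξ =
    ∫ z, Real.cos (2 * Real.pi * inner ℝ (z.1 - z.2) ξ) ∂(p.prod p + q.prod q) -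
      ∫ z, Real.cos (2 * Real.pi * inner ℝ (z.1 - z.2) ξ) ∂(p.prod q + q.prod p) := by
  simp only [← real_inner_smul_right]
  rw [integral_add_measure (integrable_cos_prod _ _) (integrable_cos_prod _ _),
    integral_add_measure (integrable_cos_prod _ _) (integrable_cos_prod _ _),
    ← re_charFun_mul_conj, ← re_charFun_mul_conj, ← re_charFun_mul_conj, ← re_charFun_mul_conj,
    charDiff, ← Complex.normSq_eq_norm_sq, Complex.normSq_apply]
  simp
  ring

theorem integral_cos_mul {H : Space d → ℝ} (hH : Integrable H)
    (ν : Measure (Space d × Space d)) [IsFiniteMeasure ν] :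
    Integrable (fun z => ∫ ξ, H ξ * Real.cos (2 * Real.pi * inner ℝ (z.1 - z.2) ξ)) ν ∧
    Integrable (fun ξ => H ξ * ∫ z, Real.cos (2 * Real.pi * inner ℝ (z.1 - z.2) ξ) ∂ν) ∧
    ∫ z, (∫ ξ, H ξ * Real.cos (2 * Real.pi * inner ℝ (z.1 - z.2) ξ)) ∂ν =
      ∫ ξ, H ξ * ∫ z, Real.cos (2 * Real.pi * inner ℝ (z.1 - z.2) ξ) ∂ν := by
  have h1 : Integrable (fun w : (Space d × Space d) × Space d => H w.2) (ν.prod volume) :=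
    hH.comp_snd ν
  have h2 : Integrable (Function.uncurry fun (z : Space d × Space d) ξ =>
      H ξ * Real.cos (2 * Real.pi * inner ℝ (z.1 - z.2) ξ)) (ν.prod volume) := by
    refine (h1.bdd_mul (c := 1)
      (f := fun w => Real.cos (2 * Real.pi * inner ℝ (w.1.1 - w.1.2) w.2)) ?_
      (Eventually.of_forall fun w => by simpa using Real.abs_cos_le_one _)).congr
      (Eventually.of_forall fun w => ?_)
    · exact Continuous.aestronglyMeasurable (by fun_prop)
    · simp [Function.uncurry, mul_comm]
  simp only [← integral_const_mul]
  exact ⟨h2.integral_prod_left, h2.integral_prod_right, integral_integral_swap h2⟩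

theorem integrable_mul_charDiff {H : Space d → ℝ} (hH : Integrable H) :
    Integrable fun ξ => H ξ * charDiff p q ξ := by
  simp only [charDiff_eq, mul_sub]
  exact (integral_cos_mul hH _).2.1.sub (integral_cos_mul hH _).2.1

/-- Parseval's identity for the energy of `p - q`. -/
theorem energy_parseval {H w : Space d → ℝ} (hH : Integrable H)
    (hw : ∀ x, w x = ∫ ξ, H ξ * Real.cos (2 * Real.pi * inner ℝ x ξ)) :
    ∫ z, w (z.1 - z.2) ∂(p.prod p + q.prod q) =
      ∫ z, w (z.1 - z.2) ∂(p.prod q + q.prod p) + ∫ ξ, H ξ * charDiff p q ξ := by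
  simp only [hw]
  rw [(integral_cos_mul hH _).2.2, (integral_cos_mul hH _).2.2]
  simp only [charDiff_eq, mul_sub]
  rw [integral_sub (integral_cos_mul hH _).2.1 (integral_cos_mul hH _).2.1]
  ring

end energy

/-! ### Strict positive definiteness -/

/-- Superadditivity of the lower limit in `[0, ∞]`. -/
theorem add_le_of_le_liminf {u v s : ℕ → ℝ≥0∞} {a b c : ℝ≥0∞} (hu : a ≤ liminf u atTop)
    (hv : b ≤ liminf v atTop) (hs : ∀ n, u n + v n = s n) (hc : Tendsto s atTop (𝓝 c)) :
    a + b ≤ c := by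
  rw [← hc.liminf_eq]
  refine (add_le_add hu hv).trans ?_
  rw [liminf_eq_iSup_iInf_of_nat, liminf_eq_iSup_iInf_of_nat, liminf_eq_iSup_iInf_of_nat,
    ENNReal.iSup_add_iSup_of_monotone]
  · refine iSup_mono fun n => le_iInf₂ fun i hi => ?_
    rw [← hs]
    exact add_le_add (iInf₂_le i hi) (iInf₂_le i hi)
  · exact fun m n hmn => le_iInf₂ fun i hi => iInf₂_le i (hmn.trans hi)
  · exact fun m n hmn => le_iInf₂ fun i hi => iInf₂_le i (hmn.trans hi)

/-- Fatou's lemma for a sequence of real functions converging almost everywhere. -/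
theorem lintegral_ofReal_le_liminf {α : Type*} [MeasurableSpace α] {ν : Measure α}
    {F : ℕ → α → ℝ} {f : α → ℝ} (hF : ∀ n, Integrable (F n) ν) (h0 : ∀ n, 0 ≤ᵐ[ν] F n)
    (hlim : ∀ᵐ x ∂ν, Tendsto (fun n => F n x) atTop (𝓝 (f x))) :
    ∫⁻ x, ENNReal.ofReal (f x) ∂ν ≤ liminf (fun n => ENNReal.ofReal (∫ x, F n x ∂ν)) atTop := by
  have h := lintegral_liminf_le' (u := atTop)
    fun n => (hF n).aestronglyMeasurable.aemeasurable.ennreal_ofReal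
  simp only [← fun n => ofReal_integral_eq_lintegral_ofReal (hF n) (h0 n)] at h
  refine le_trans (lintegral_mono_ae ?_) h
  filter_upwards [hlim] with x hx
  exact (ENNReal.tendsto_ofReal hx).liminf_eq.ge

section interaction

variable {W : Space d → EReal} {p q : Measure (Space d)} [IsFiniteMeasure p] [IsFiniteMeasure q]

/-- Parseval's identity holds for the mollified potentials. In the limit, dominated convergence
applies to the interaction of each of `p`, `q` with itself, and Fatou's lemma to their mutual
interaction and to the integral in Fourier space, which is positive. -/
theorem EssentiallyConvex.integral_prod_lt [NeZero d] (hW : EssentiallyConvex W) (hpq : p ≠ q)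
    (hP : ∀ᵐ z ∂(p.prod p + q.prod q), W (z.1 - z.2) ≠ ⊤)
    (hQ : ∀ᵐ z ∂(p.prod q + q.prod p), W (z.1 - z.2) ≠ ⊤)
    (hint : Integrable (fun z => re W (z.1 - z.2)) (p.prod p + q.prod q)) :
    Integrable (fun z => re W (z.1 - z.2)) (p.prod q + q.prod p) ∧
      ∫ z, re W (z.1 - z.2) ∂(p.prod q + q.prod p) <
        ∫ z, re W (z.1 - z.2) ∂(p.prod p + q.prod q) := by
  obtain ⟨P, hPe⟩ : ∃ P, P = p.prod p + q.prod q := ⟨_, rfl⟩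
  obtain ⟨Q, hQe⟩ : ∃ Q, Q = p.prod q + q.prod p := ⟨_, rfl⟩
  have : IsFiniteMeasure P := hPe ▸ inferInstance
  have : IsFiniteMeasure Q := hQe ▸ inferInstance
  obtain ⟨c, hc, hcb⟩ := hW.w0.exists_neg_le_re
  obtain ⟨A, B, hA, hB, hAB⟩ := hW.exists_mollified_le (M := 4 ^ d) (by positivity)
  obtain ⟨a, b, h⟩ := hW.powerBounds
  have hloc := hW.w0.locallyIntegrable
  have hρ : ∀ n : ℕ, (0 : ℝ) < 1 / ((n : ℝ) + 1 + 1) := fun n => by positivity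
  have hρ1 : ∀ n : ℕ, 1 / ((n : ℝ) + 1 + 1) < 1 := fun n => by
    rw [div_lt_one (by positivity)]
    linarith [(Nat.cast_nonneg n : (0 : ℝ) ≤ n)]
  have hρlim : Tendsto (fun n : ℕ => 1 / ((n : ℝ) + 1 + 1)) atTop (𝓝 0) := by
    have := (tendsto_add_atTop_iff_nat 1).2 (tendsto_one_div_add_atTop_nhds_zero_nat (𝕜 := ℝ))
    simpa using this
  choose k hk using fun n => exists_isMollifier d (hρ n)
  have hfT := hasFourierTransform_re hW.c2 hW.w0.even h
  have hH := fun n => (hfT.integral_mollifier_mul (hk n)).1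
  have hw := fun n => (hfT.integral_mollifier_mul (hk n)).2
  have hpos : ∀ ξ : Space d, ξ ≠ 0 → 0 < fourierFun W ξ :=
    fun ξ hξ => fourierFun_pos hW.c2 h hW.lap_pos hξ
  have hwint : ∀ n (ν : Measure (Space d × Space d)) [IsFiniteMeasure ν],
      Integrable (fun z => ∫ t, k n t * re W (z.1 - z.2 - t)) ν := fun n ν _ => by
    simp only [hw n]
    exact (integral_cos_mul (hH n) ν).1
  have hwlim : ∀ z : Space d × Space d, W (z.1 - z.2) ≠ ⊤ →
      Tendsto (fun n => ∫ t, k n t * re W (z.1 - z.2 - t)) atTop (𝓝 (re W (z.1 - z.2))) :=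
    fun z hz => tendsto_integral_mollifier hk hρlim hloc.aestronglyMeasurable
      (hW.continuousAt_re hz)
  -- dominated convergence for the interaction of each measure with itself
  have hS : Tendsto (fun n => ∫ z, (∫ t, k n t * re W (z.1 - z.2 - t)) ∂P) atTop
      (𝓝 (∫ z, re W (z.1 - z.2) ∂P)) := by
    rw [← hPe] at hP hint
    refine tendsto_integral_of_dominated_convergence (fun z => A + B * |re W (z.1 - z.2)|)
      (fun n => (hwint n P).aestronglyMeasurable)
      ((integrable_const A).add (hint.abs.const_mul B)) (fun n => ?_) ?_
    · filter_upwards [hP] with z hz using hAB _ _ (hρ n) (hρ1 n) (hk n) _ hz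
    · filter_upwards [hP] with z hz using hwlim z hz
  -- Fatou's lemma for the mutual interaction, shifted to make the integrand nonnegative
  have hF1 : ∫⁻ z, ENNReal.ofReal (re W (z.1 - z.2) + c) ∂Q ≤ liminf (fun n =>
      ENNReal.ofReal (∫ z, ((∫ t, k n t * re W (z.1 - z.2 - t)) + c) ∂Q)) atTop := by
    rw [← hQe] at hQ
    refine lintegral_ofReal_le_liminf (fun n => (hwint n Q).add (integrable_const c))
      (fun n => Eventually.of_forall fun z => ?_) ?_
    · have := (hk n).le_integral_mul hloc hcb (z.1 - z.2)
      change 0 ≤ (∫ t, k n t * re W (z.1 - z.2 - t)) + c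
      linarith
    · filter_upwards [hQ] with z hz using (hwlim z hz).add_const c
  have hnn : ∀ n, 0 ≤ᵐ[volume] fun ξ =>
      cosTransform (k n) ξ * fourierFun W ξ * charDiff p q ξ := fun n => by
    filter_upwards [ae_ne_zero] with ξ hξ
    exact mul_nonneg (mul_nonneg ((hk n).cosTransform_nonneg ξ) (hpos ξ hξ).le)
      (charDiff_nonneg p q ξ)
  have hF2 : ∫⁻ ξ, ENNReal.ofReal (fourierFun W ξ * charDiff p q ξ) ≤ liminf (fun n =>
      ENNReal.ofReal (∫ ξ, cosTransform (k n) ξ * fourierFun W ξ * charDiff p q ξ)) atTop := by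
    refine lintegral_ofReal_le_liminf (fun n => integrable_mul_charDiff (hH n)) hnn
      (Eventually.of_forall fun ξ => ?_)
    simpa using ((tendsto_cosTransform_mollifier hk hρlim ξ).mul_const (fourierFun W ξ)).mul_const
      (charDiff p q ξ)
  have hsum : ∀ n, ENNReal.ofReal (∫ z, ((∫ t, k n t * re W (z.1 - z.2 - t)) + c) ∂Q) +
      ENNReal.ofReal (∫ ξ, cosTransform (k n) ξ * fourierFun W ξ * charDiff p q ξ) =
      ENNReal.ofReal ((∫ z, (∫ t, k n t * re W (z.1 - z.2 - t)) ∂P) + Q.real Set.univ * c) :=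
    fun n => by
    have hpar := energy_parseval (p := p) (q := q) (hH n) (hw n)
    rw [← hPe, ← hQe] at hpar
    rw [← ENNReal.ofReal_add (integral_nonneg fun z => ?_) (integral_nonneg_of_ae (hnn n)), hpar,
      integral_add (hwint n Q) (integrable_const c), integral_const, smul_eq_mul]
    · congr 1
      ring
    · have := (hk n).le_integral_mul hloc hcb (z.1 - z.2)
      change 0 ≤ (∫ t, k n t * re W (z.1 - z.2 - t)) + c
      linarith
  have hle := add_le_of_le_liminf hF1 hF2 hsum
    (ENNReal.tendsto_ofReal (hS.add_const (Q.real Set.univ * c)))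
  have hJ : ∫⁻ ξ, ENNReal.ofReal (fourierFun W ξ * charDiff p q ξ) ≠ 0 := fun h0 => by
    have hmJ : AEMeasurable fun ξ => fourierFun W ξ * charDiff p q ξ :=
      (aestronglyMeasurable_fourierFun hW.c2 h).aemeasurable.mul
        continuous_charDiff.measurable.aemeasurable
    rw [lintegral_eq_zero_iff' hmJ.ennreal_ofReal] at h0
    refine not_charDiff_ae_eq_zero hpq ?_
    filter_upwards [h0, ae_ne_zero] with ξ h1 hξ
    have h2 := ENNReal.ofReal_eq_zero.1 h1
    exact le_antisymm (nonpos_of_mul_nonpos_right h2 (hpos ξ hξ)) (charDiff_nonneg p q ξ)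
  have hm : Measurable fun z : Space d × Space d => re W (z.1 - z.2) :=
    (measurable_re hW.w0).comp (measurable_fst.sub measurable_snd)
  have h0 : ∀ ν : Measure (Space d × Space d), 0 ≤ᵐ[ν] fun z => re W (z.1 - z.2) + c :=
    fun ν => Eventually.of_forall fun z => by
      have := hcb (z.1 - z.2)
      change 0 ≤ re W (z.1 - z.2) + c
      linarith
  have hic : Integrable (fun z => re W (z.1 - z.2) + c) Q :=
    (lintegral_ofReal_ne_top_iff_integrable (hm.add_const c).aestronglyMeasurable (h0 Q)).1
      (ne_top_of_le_ne_top ENNReal.ofReal_ne_top (le_self_add.trans hle))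
  have hi : Integrable (fun z => re W (z.1 - z.2)) Q := by
    refine (hic.sub (integrable_const c)).congr (Eventually.of_forall fun z => ?_)
    simp
  rw [← hPe, ← hQe]
  refine ⟨hi, ?_⟩
  rw [← ofReal_integral_eq_lintegral_ofReal hic (h0 Q), integral_add hi (integrable_const c),
    integral_const, smul_eq_mul] at hle
  have hlt := lt_of_lt_of_le (ENNReal.lt_add_right ENNReal.ofReal_ne_top hJ) hle
  linarith [(ENNReal.ofReal_lt_ofReal_iff_of_nonneg
    (by
      have := integral_nonneg_of_ae (h0 Q)
      rwa [integral_add hi (integrable_const c), integral_const, smul_eq_mul] at this)).1 hlt]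

/-- If `W` is infinite at the origin and the self-interaction is finite, then neither measure has
atoms, so the diagonal does not contribute to the mutual interaction. -/
theorem ae_ne_top_of_ae_ne_top (hW : IsC2OffOrigin W)
    (hP : ∀ᵐ z ∂(p.prod p + q.prod q), W (z.1 - z.2) ≠ ⊤) :
    ∀ᵐ z ∂(p.prod q + q.prod p), W (z.1 - z.2) ≠ ⊤ := by
  by_cases h0 : W 0 = ⊤
  · have hD : MeasurableSet (Set.diagonal (Space d)) := measurableSet_diagonal
    have key : ∀ ν : Measure (Space d), IsFiniteMeasure ν →
        (∀ᵐ z ∂ν.prod ν, W (z.1 - z.2) ≠ ⊤) → ∀ x, ν {x} = 0 := by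
      intro ν _ hν x
      have h1 : ν.prod ν (Set.diagonal (Space d)) = 0 := by
        refine measure_mono_null (fun z hz => ?_) hν
        rw [Set.mem_diagonal_iff] at hz
        simp [hz, h0]
      have h2 : ν.prod ν ({x} ×ˢ {x}) = 0 := by
        refine measure_mono_null (fun z hz => ?_) h1
        simp only [Set.mem_prod, Set.mem_singleton_iff] at hz
        rw [Set.mem_diagonal_iff, hz.1, hz.2]
      rw [Measure.prod_prod] at h2
      exact mul_self_eq_zero.1 h2
    have key2 : ∀ μ ν : Measure (Space d), IsFiniteMeasure μ → IsFiniteMeasure ν →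
        (∀ x, ν {x} = 0) → ∀ᵐ z ∂μ.prod ν, W (z.1 - z.2) ≠ ⊤ := by
      intro μ ν _ _ hν
      have h1 : μ.prod ν (Set.diagonal (Space d)) = 0 := by
        rw [Measure.measure_prod_null hD]
        refine Eventually.of_forall fun x => measure_mono_null (fun y hy => ?_) (hν x)
        exact (Set.mem_diagonal_iff.1 hy).symm
      refine measure_mono_null (fun z hz => ?_) h1
      by_contra hne
      rw [Set.mem_diagonal_iff] at hne
      exact hz (hW.finite _ (sub_ne_zero.2 hne)).2
    rw [ae_add_measure_iff] at hP ⊢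
    exact ⟨key2 _ _ ‹_› ‹_› (key q ‹_› hP.2), key2 _ _ ‹_› ‹_› (key p ‹_› hP.1)⟩
  · refine Eventually.of_forall fun z => ?_
    by_cases hz : z.1 - z.2 = 0
    · rwa [hz]
    · exact (hW.finite _ hz).2

end interaction

theorem posPart_ne_negPart {μ : SignedMeasure (Space d)} (hμ : μ ≠ 0) :
    μ.toJordanDecomposition.posPart ≠ μ.toJordanDecomposition.negPart := fun h => by
  refine hμ ?_
  rw [← μ.toSignedMeasure_toJordanDecomposition, JordanDecomposition.toSignedMeasure]
  simp only [h, sub_self]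

/-- Essentially convex potentials are strictly positive definite. -/
theorem EssentiallyConvex.strictlyPositiveDefinite [NeZero d] {W : Space d → EReal}
    (hW : EssentiallyConvex W) : StrictlyPositiveDefinite W := by
  intro μ hμ hdef
  by_cases htop : energyPos W μ = ⊤
  · have hneg : energyNeg W μ ≠ ⊤ := hdef.resolve_left (not_not.2 htop)
    rw [energy, htop, EReal.coe_ennreal_top, EReal.top_sub (by simpa using hneg),
      EReal.coe_mul_top_of_pos (by norm_num)]
    exact EReal.zero_lt_top
  have hne := posPart_ne_negPart hμ
  rw [energyPos] at htop
  rw [energy, energyPos, energyNeg]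
  have := μ.toJordanDecomposition.posPart_finite
  have := μ.toJordanDecomposition.negPart_finite
  generalize μ.toJordanDecomposition.posPart = p at *
  generalize μ.toJordanDecomposition.negPart = q at *
  obtain ⟨c, hc, hcb⟩ := hW.w0.exists_neg_le_re
  have hWm : Measurable fun z : Space d × Space d => W (z.1 - z.2) :=
    hW.w0.lowerSemicontinuous.measurable.comp (measurable_fst.sub measurable_snd)
  have hm : Measurable fun z : Space d × Space d => re W (z.1 - z.2) :=
    hWm.ereal_toReal
  have hP : ∀ᵐ z ∂(p.prod p + q.prod q), W (z.1 - z.2) ≠ ⊤ := by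
    filter_upwards [ae_lt_top hWm.ereal_toENNReal fun h => htop (by simp [h])] with z hz h
    simp [h] at hz
  have hQ := ae_ne_top_of_ae_ne_top hW.c2 hP
  have hof : ∀ ν : Measure (Space d × Space d), (∀ᵐ z ∂ν, W (z.1 - z.2) ≠ ⊤) →
      ∫⁻ z, (W (z.1 - z.2)).toENNReal ∂ν = ∫⁻ z, ENNReal.ofReal (re W (z.1 - z.2)) ∂ν ∧
      ∫⁻ z, (-W (z.1 - z.2)).toENNReal ∂ν = ∫⁻ z, ENNReal.ofReal (-re W (z.1 - z.2)) ∂ν := by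
    intro ν hν
    refine ⟨lintegral_congr_ae ?_, lintegral_congr_ae ?_⟩
    · filter_upwards [hν] with z hz using EReal.toENNReal_of_ne_top hz
    · filter_upwards [hν] with z hz
      rw [EReal.toENNReal_of_ne_top (by simpa using hW.w0.ne_bot _), EReal.toReal_neg_eq]
      rfl
  rw [(hof _ hP).1, (hof _ hQ).2] at htop
  rw [(hof _ hP).1, (hof _ hP).2, (hof _ hQ).1, (hof _ hQ).2]
  have hi : Integrable (fun z => re W (z.1 - z.2)) (p.prod p + q.prod q) := by
    have h1 : ∫⁻ z, ENNReal.ofReal (re W (z.1 - z.2)) ∂(p.prod p + q.prod q) ≠ ⊤ :=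
      fun h => htop (by simp [h])
    have h2 := integrable_toReal_of_lintegral_ne_top hm.ennreal_ofReal.aemeasurable h1
    refine (h2.add (integrable_const c)).mono' hm.aestronglyMeasurable
      (Eventually.of_forall fun z => ?_)
    have h3 := hcb (z.1 - z.2)
    rw [Pi.add_apply, ENNReal.toReal_ofReal', Real.norm_eq_abs, abs_le]
    constructor
    · linarith [le_max_right (re W (z.1 - z.2)) 0]
    · linarith [le_max_left (re W (z.1 - z.2)) 0]
  obtain ⟨hj, hlt⟩ := hW.integral_prod_lt hne hP hQ hi
  rw [integral_eq_lintegral_pos_part_sub_lintegral_neg_part hi,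
    integral_eq_lintegral_pos_part_sub_lintegral_neg_part hj] at hlt
  have f1 := hi.lintegral_lt_top.ne
  have f2 := hi.neg.lintegral_lt_top.ne
  have f3 := hj.lintegral_lt_top.ne
  have f4 := hj.neg.lintegral_lt_top.ne
  simp only [Pi.neg_apply] at f2 f4
  rw [← EReal.coe_ennreal_toReal (ENNReal.add_ne_top.2 ⟨f1, f4⟩),
    ← EReal.coe_ennreal_toReal (ENNReal.add_ne_top.2 ⟨f2, f3⟩), ENNReal.toReal_add f1 f4,
    ENNReal.toReal_add f2 f3, ← EReal.coe_sub, ← EReal.coe_mul]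
  refine EReal.coe_pos.2 ?_
  linarith

end EssConvex

theorem mainTheorem2 (d : ℕ) (W : EssConvex.Space d → EReal) :
    -- the representation formula and the Fourier transform
    (EssConvex.W0 W → EssConvex.IsC2OffOrigin W → (∃ a b : ℝ, EssConvex.PowerBounds W a b) →
      (∀ ε R : ℝ, 0 < ε → ε < R → ∀ x : EssConvex.Space d, x ≠ 0 →
        IntegrableOn (EssConvex.diffIntegrand W x) (EssConvex.annulus d ε R) volume ∧
        IntegrableOn (EssConvex.fourierIntegrand W x) (EssConvex.annulus d ε R) volume) ∧
      (∀ K : Set (EssConvex.Space d), IsCompact K → K ⊆ {0}ᶜ →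
        TendstoUniformlyOn (fun p : ℝ × ℝ => EssConvex.truncated W p.1 p.2) (EssConvex.re W)
          EssConvex.cutoffLimit K) ∧
      EssConvex.TendstoTempered (fun p : ℝ × ℝ => EssConvex.truncated W p.1 p.2)
        EssConvex.cutoffLimit (EssConvex.re W) ∧
      ∃ What : EssConvex.Space d → ℝ,
        EssConvex.HasFourierTransform (EssConvex.re W) What ∧
        EssConvex.TendstoTempered (fun p : ℝ × ℝ => EssConvex.truncatedFourier W p.1 p.2)
          EssConvex.cutoffLimit What ∧
        (∀ ξ : EssConvex.Space d, ξ ≠ 0 →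
          Tendsto (fun p : ℝ × ℝ => EssConvex.truncatedFourier W p.1 p.2 ξ)
            EssConvex.cutoffLimit (𝓝 (What ξ))) ∧
        -- strict positivity
        (EssConvex.EssentiallyConvex W → ∀ ξ : EssConvex.Space d, ξ ≠ 0 → 0 < What ξ)) ∧
    -- essentially convex potentials are strictly positive definite
    (EssConvex.EssentiallyConvex W → EssConvex.StrictlyPositiveDefinite W) := by
  -- in dimension zero there is no exponent `a` with `-d < a < 0`
  have hd : ∀ {a b : ℝ}, EssConvex.PowerBounds W a b → NeZero d := fun {a b} h => ⟨fun h0 => by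
    have h1 := h.a_gt
    have h2 := h.a_lt.trans_le (min_le_right _ _)
    simp only [h0, Nat.cast_zero, neg_zero] at h1
    exact absurd h1 h2.not_gt⟩
  refine ⟨fun hW0 hW ⟨a, b, h⟩ => ?_, fun hW => ?_⟩
  · have := hd h
    exact ⟨fun ε R _ _ x hx => ⟨(EssConvex.integrable_diffIntegrand hW h hx).integrableOn,
        (EssConvex.integrable_fourierIntegrand hW h hx).integrableOn⟩,
      fun K hK hK0 => EssConvex.tendstoUniformlyOn_truncated hW hW0.even h hK hK0,
      EssConvex.tendstoTempered_truncated hW hW0.even h, EssConvex.fourierFun W,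
      EssConvex.hasFourierTransform_re hW hW0.even h,
      EssConvex.tendstoTempered_truncatedFourier hW h,
      fun ξ hξ => EssConvex.tendsto_truncatedFourier hW h hξ,
      fun hE ξ hξ => EssConvex.fourierFun_pos hW h hE.lap_pos hξ⟩
  · obtain ⟨a, b, h⟩ := hW.powerBounds
    have := hd h
    exact hW.strictlyPositiveDefinite
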